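/- **Conventions.** Let $\Bbbk$ be an algebraically closed field. All categories and functors are $\Bbbk$-linear, 2-categories and 2-semicategories (2-categories without units) are strict with $\Bbbk$-bilinear horizontal composition, and $GF$ denotes the composite of $F\in C(\mathtt i,\mathtt j)$ and $G\in C(\mathtt j,\mathtt k)$. For a class $X$ of objects of an additive category, $\mathrm{add}(X)$ is the class of all direct summands of finite direct sums of objects of $X$. A category is *finitary* if it is additive, idempotent split, has finite-dimensional morphism spaces and finitely many isomorphism classes of indecomposable objects. **Bilax-unital and fiax 2-categories.** A *bilax-unital 2-category* is a 2-semicategory $C$ with, for each object $\mathtt i$, 1-morphisms $I_{\mathtt i},I'_{\mathtt i}\in C(\mathtt i,\mathtt i)$ (the lax and the oplax unit) and natural transformations $l_F:I_{\mathtt i}F\to F$, $l'_F:F\to I'_{\mathtt i}F$ for $F\in C(\mathtt j,\mathtt i)$ and $r_G:GI_{\mathtt i}\to G$, $r'_G:G\to GI'_{\mathtt i}$ for $G\in C(\mathtt i,\mathtt k)$, such that $$\mathrm{id}_G\, l_F=r_G\,\mathrm{id}_F,\qquad l_{FH}=l_F\,\mathrm{id}_H,\qquad r_{KG}=\mathrm{id}_K\,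 r_G$$ and the same three identities hold for $l',r'$. It is *finitary* if it has finitely many objects, all categories $C(\mathtt i,\mathtt j)$ are finitary and all $I_{\mathtt i},I'_{\mathtt i}$ are indecomposable. A finitary bilax-unital 2-category is *fiax* with respect to an equivalence $(-)^\star:C\to C^{\mathrm{op},\mathrm{op}}$ (reversing 1- and 2-morphisms, the identity on objects, compatible with horizontal composition up to coherent isomorphisms $(GF)^\star\cong F^\star G^\star$) if 1. $(I_{\mathtt i})^\star=I'_{\mathtt i}$, and, up to the isomorphisms $(GF)^\star\cong F^\star G^\star$, $(l_F)^\star=r'_{F^\star}$ and $(r_G)^\star=l'_{G^\star}$; 2. for each $F\in C(\mathtt j,\mathtt i)$ there are $\alpha_F:I'_{\mathtt j}\to F^\star F$ and $\beta_F:FF^\star\to I_{\mathtt i}$ such that the composites $$F\xrightarrow{r'_F}FI'_{\mathtt j}\xrightarrow{\mathrm{id}_F\alpha_F}FF^\star F\xrightarrow{\beta_F\mathrm{id}_F}I_{\mathtt i}F\xrightarrow{l_F}F,\qquad F^\star\xrightarrow{l'_{F^\star}}I'_{\mathtt j}F^\star\xrightarrow{\alpha_F\mathrm{id}_{F^\star}}F^\star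 FF^\star\xrightarrow{\mathrm{id}_{F^\star}\beta_F}F^\star I_{\mathtt i}\xrightarrow{r_{F^\star}}F^\star$$ are identities; 3. with these $\alpha_F,\beta_F$, for each $\gamma:F\to G$ in $C(\mathtt j,\mathtt i)$ the 2-morphism $\gamma^\star$ is the composite $$G^\star\xrightarrow{l'_{G^\star}}I'_{\mathtt j}G^\star\xrightarrow{\alpha_F\mathrm{id}}F^\star FG^\star\xrightarrow{\mathrm{id}\,\gamma\,\mathrm{id}}F^\star GG^\star\xrightarrow{\mathrm{id}\,\beta_G}F^\star I_{\mathtt i}\xrightarrow{r_{F^\star}}F^\star;$$ 4. $(-)^{\star\star}\cong\mathrm{Id}_C$. A *fiat 2-category* is a 2-category $C$ with finitely many objects, finitary categories $C(\mathtt i,\mathtt j)$ and indecomposable identity 1-morphisms $\mathbb 1_{\mathtt i}$, with a weak involution $(-)^\star:C\to C^{\mathrm{op},\mathrm{op}}$ (an equivalence of 2-categories as above, also compatible with identity 1-morphisms up to coherent isomorphisms $\mathbb 1_{\mathtt i}^\star\cong\mathbb 1_{\mathtt i}$), such that 2, 3 and 4 hold with $I_{\mathtt i}=I'_{\mathtt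 i}=\mathbb 1_{\mathtt i}$ and identity unitors. **Cells.** Let $C$ be fiat. For 1-morphisms $F,G$ write $F\le_L G$ if $G$ is a direct summand of $HF$ for some $H$, and $F\le_J G$ if $G$ is a direct summand of $KFH$ for some $H,K$. *Left cells* and *two-sided cells* are the equivalence classes of indecomposable 1-morphisms for $\le_L$ and $\le_J$. Fix a two-sided cell $\mathcal J$; let $\mathcal L_1,\dots,\mathcal L_n$ be the left cells in $\mathcal J$, let $\mathtt i_i$ be the common source of the elements of $\mathcal L_i$, and put $\mathcal R_i=\mathcal L_i^\star=\{F\mid F\cong G^\star\text{ for some }G\in\mathcal L_i\}$. **Duflo 1-morphisms.** Let $P_{\mathbb 1}=C(\mathtt i_i,\mathtt i_i)(-,\mathbb 1_{\mathtt i_i})$ in the projective abelianization of the principal 2-representation $C(\mathtt i_i,-)$. A *Duflo 1-morphism* of $\mathcal L_i$, with *defining 2-morphism* $d_i$, is an indecomposable $D_i\in C(\mathtt i_i,\mathtt i_i)$ together with $d_i:D_i\to\mathbb 1_{\mathtt i_i}$ for which there is a submodule $K_i\subseteq P_{\mathbb 1}$ that is minimal among the submodules $K$ with $F(P_{\mathbb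 1}/K)=0$ for all $F\in\mathcal L_i$, such that $K_i$ has simple top $L_{D_i}$ (the simple top of the indecomposable projective $P_{D_i}$) and is the image of $P_{d_i}:P_{D_i}\to P_{\mathbb 1}$. **The objects $C(\mathcal J)$ and $C_{\mathcal J}$.** Let $C(\mathcal J)=\mathrm{add}\{F\mid F\ge_J\mathcal J\}/\mathbf I$, a 2-semicategory whose objects are the sources and targets of the elements of $\mathcal J$, where $\mathbf I$ is the largest 2-ideal containing no $\mathrm{id}_F$ with $F\in\mathcal J$. Given Duflo 1-morphisms $(D_i,d_i)$ of all $\mathcal L_i$, let $C_{\mathcal J}$ have objects $1,\dots,n$ and morphism categories $C_{\mathcal J}(i,j)=\mathrm{add}(\mathcal L_i\cap\mathcal R_j)$, taken 2-full in $C(\mathcal J)$, with the composition of $C(\mathcal J)$; the lax unit at $i$ is $D_i$, with $l_F=d_i\,\mathrm{id}_F:D_iF\to F$ and $r_G=\mathrm{id}_G\,d_i:GD_i\to G$; the oplax unit at $i$ is $D_i^\star$, with $l'_F=d_i^\star\,\mathrm{id}_F:F\to D_i^\star F$ and $r'_G=\mathrm{id}_G\,d_i^\star:G\to GD_i^\star$,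 where $d_i^\star:\mathbb 1_{\mathtt i_i}\cong\mathbb 1_{\mathtt i_i}^\star\to D_i^\star$. **Proposition.** Let $C$ be a fiat 2-category over $\Bbbk$ and $\mathcal J$ a two-sided cell in $C$. * (a) Among the 2-ideals of $\mathrm{add}\{F\mid F\ge_J\mathcal J\}$ that contain no $\mathrm{id}_F$ with $F\in\mathcal J$ there is a largest one, $\mathbf I$, namely the sum of all of them. * (b) Every left cell $\mathcal L_i$ in $\mathcal J$ has a Duflo 1-morphism, and it is unique up to isomorphism. * (c) The classes $\mathrm{add}(\mathcal L_i\cap\mathcal R_j)$ are closed under the composition of $C(\mathcal J)$; the weak involution $(-)^\star$ of $C$ preserves $\mathrm{add}\{F\mid F\ge_J\mathcal J\}$ and $\mathbf I$, and maps $\mathrm{add}(\mathcal L_i\cap\mathcal R_j)$ to $\mathrm{add}(\mathcal L_j\cap\mathcal R_i)$. For every choice of Duflo 1-morphisms $(D_i,d_i)$ one has $D_i\in\mathcal L_i\cap\mathcal R_i$, and $C_{\mathcal J}$, with the above lax and oplax units, is a finitary bilax-unital 2-category which is fiax with respect to the weak involution induced by $(-)^\star$. -/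

import Mathlib

open CategoryTheory CategoryTheory.Limits

namespace Fiax

universe u₀ u v w u' v' w'

/-! ### Additive and finitary categories -/

section Additive

variable {A : Type u} [Category.{v} A] [Preadditive A]

/-- An indecomposable object of an additive category: a nonzero object that is not isomorphic
to the biproduct of two nonzero objects. -/
def IsIndec (X : A) : Prop :=
  ¬ IsZero X ∧ ∀ (Y Z : A) (b : BinaryBicone Y Z), Nonempty b.IsBilimit →
    Nonempty (X ≅ b.pt) → IsZero Y ∨ IsZero Z

/-- `InAdd P X`: the object `X` lies in `add P`, that is, `X` is a direct summand of a finite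
direct sum `f 0 ⊕ ... ⊕ f (n - 1)` of objects satisfying `P`. The maps `s t` and `r t` are the
components of the split inclusion and of the projection. -/
def InAdd (P : A → Prop) (X : A) : Prop :=
  ∃ (n : ℕ) (f : Fin n → A) (s : ∀ t, X ⟶ f t) (r : ∀ t, f t ⟶ X),
    (∀ t, P (f t)) ∧ ∑ t, s t ≫ r t = 𝟙 X

theorem InAdd.of_mem {P : A → Prop} {X : A} (h : P X) : InAdd P X :=
  ⟨1, fun _ => X, fun _ => 𝟙 X, fun _ => 𝟙 X, fun _ => h, by simp⟩

/-- A finitary `k`-linear category. -/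
structure IsFinitaryCategory (k : Type u₀) [Field k] (A : Type u) [Category.{v} A]
    [Preadditive A] [Linear k A] : Prop where
  hasFiniteBiproducts : HasFiniteBiproducts A
  isIdempotentComplete : IsIdempotentComplete A
  finite_hom : ∀ X Y : A, Module.Finite k (X ⟶ Y)
  finite_indec : ∃ (n : ℕ) (f : Fin n → A), ∀ X : A, IsIndec X → ∃ t, Nonempty (X ≅ f t)

/-- A submodule of the representable module `P_X = Hom(-, X)`. -/
structure RepSubmodule (k : Type u₀) [Field k] [Linear k A] (X : A) where
  carrier : ∀ Y : A, Submodule k (Y ⟶ X)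
  comp_mem : ∀ {Y Z : A} (f : Z ⟶ Y) {g : Y ⟶ X}, g ∈ carrier Y → f ≫ g ∈ carrier Z

instance (k : Type u₀) [Field k] [Linear k A] (X : A) : PartialOrder (RepSubmodule k X) where
  le K M := ∀ Y, K.carrier Y ≤ M.carrier Y
  le_refl _ _ := le_rfl
  le_trans _ _ _ h₁ h₂ Y := (h₁ Y).trans (h₂ Y)
  le_antisymm K M h₁ h₂ := by
    cases K; cases M; congr; funext Y; exact le_antisymm (h₁ Y) (h₂ Y)

/-- `d : D ⟶ X` generates the submodule `K` of `P_X`, that is, `K` is the image of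
`P_d : P_D ⟶ P_X`. -/
def RepSubmodule.IsGeneratedBy {k : Type u₀} [Field k] [Linear k A] {X : A}
    (K : RepSubmodule k X) {D : A} (d : D ⟶ X) : Prop :=
  ∀ (Y : A) (g : Y ⟶ X), g ∈ K.carrier Y ↔ ∃ h : Y ⟶ D, g = h ≫ d

/-- For an indecomposable object `D`: the submodule `K` has simple top `L_D` (the simple top of
`P_D`). That is, `K` has a largest proper submodule `M`, and the simple module `K / M` does not
vanish at `D`. -/
def RepSubmodule.HasSimpleTop {k : Type u₀} [Field k] [Linear k A] {X : A}
    (K : RepSubmodule k X) (D : A) : Prop :=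
  ∃ M : RepSubmodule k X, M < K ∧ (∀ N : RepSubmodule k X, N < K → N ≤ M) ∧
    ¬ K.carrier D ≤ M.carrier D

end Additive

set_option linter.checkUnivs false

/-! ### `k`-linear 2-semicategories and bilax-unital 2-categories

Composition of 1-morphisms is written in diagrammatic order: `comp F G` is what is usually
written `GF`. -/

/-- A `k`-linear 2-semicategory: horizontal composition is functorial, `k`-bilinear on
2-morphisms and strictly associative; no units are required. The functor `h(-,-)` is given by the
two whiskerings. -/
structure TwoSemicat (k : Type u₀) [Field k] where
  Obj : Type u
  Hom : Obj → Obj → Type v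
  [cat : ∀ i j, Category.{w} (Hom i j)]
  [preadd : ∀ i j, Preadditive (Hom i j)]
  [lin : ∀ i j, Linear k (Hom i j)]
  comp : ∀ {i j l : Obj}, Hom i j → Hom j l → Hom i l
  whiskerLeft : ∀ {i j l : Obj} (F : Hom i j) {G G' : Hom j l},
    (G ⟶ G') →ₗ[k] (comp F G ⟶ comp F G')
  whiskerRight : ∀ {i j l : Obj} {F F' : Hom i j} (G : Hom j l),
    (F ⟶ F') →ₗ[k] (comp F G ⟶ comp F' G)
  whiskerLeft_id : ∀ {i j l : Obj} (F : Hom i j) (G : Hom j l),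
    whiskerLeft F (𝟙 G) = 𝟙 (comp F G)
  whiskerLeft_comp : ∀ {i j l : Obj} (F : Hom i j) {G G' G'' : Hom j l} (γ : G ⟶ G')
    (δ : G' ⟶ G''), whiskerLeft F (γ ≫ δ) = whiskerLeft F γ ≫ whiskerLeft F δ
  whiskerRight_id : ∀ {i j l : Obj} (F : Hom i j) (G : Hom j l),
    whiskerRight G (𝟙 F) = 𝟙 (comp F G)
  whiskerRight_comp : ∀ {i j l : Obj} {F F' F'' : Hom i j} (G : Hom j l) (γ : F ⟶ F')
    (δ : F' ⟶ F''), whiskerRight G (γ ≫ δ) = whiskerRight G γ ≫ whiskerRight G δ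
  whisker_exchange : ∀ {i j l : Obj} {F F' : Hom i j} {G G' : Hom j l} (γ : F ⟶ F')
    (δ : G ⟶ G'),
    whiskerLeft F δ ≫ whiskerRight G' γ = whiskerRight G γ ≫ whiskerLeft F' δ
  assoc : ∀ {i j l m : Obj} (F : Hom i j) (G : Hom j l) (H : Hom l m),
    comp (comp F G) H = comp F (comp G H)
  assoc_left : ∀ {i j l m : Obj} {F F' : Hom i j} (γ : F ⟶ F') (G : Hom j l) (H : Hom l m),
    whiskerRight H (whiskerRight G γ) ≫ eqToHom (assoc F' G H) =
      eqToHom (assoc F G H) ≫ whiskerRight (comp G H) γ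
  assoc_middle : ∀ {i j l m : Obj} (F : Hom i j) {G G' : Hom j l} (γ : G ⟶ G') (H : Hom l m),
    whiskerRight H (whiskerLeft F γ) ≫ eqToHom (assoc F G' H) =
      eqToHom (assoc F G H) ≫ whiskerLeft F (whiskerRight H γ)
  assoc_right : ∀ {i j l m : Obj} (F : Hom i j) (G : Hom j l) {H H' : Hom l m} (γ : H ⟶ H'),
    whiskerLeft (comp F G) γ ≫ eqToHom (assoc F G H') =
      eqToHom (assoc F G H) ≫ whiskerLeft F (whiskerLeft G γ)

namespace TwoSemicat

attribute [instance] TwoSemicat.cat TwoSemicat.preadd TwoSemicat.lin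

variable {k : Type u₀} [Field k] (C : TwoSemicat.{u₀, u, v, w} k)

/-- The identity `(FG)H = F(GH)` as an isomorphism. -/
def associator {C : TwoSemicat.{u₀, u, v, w} k} {i j l m : C.Obj} (F : C.Hom i j)
    (G : C.Hom j l) (H : C.Hom l m) :
    C.comp (C.comp F G) H ≅ C.comp F (C.comp G H) :=
  eqToIso (C.assoc F G H)

/-- The data of a lax unit `(I, l, r)` and an oplax unit `(I', l', r')` at each object. -/
structure BilaxUnits where
  I : ∀ i : C.Obj, C.Hom i i
  l : ∀ {j i : C.Obj} (F : C.Hom j i), C.comp F (I i) ⟶ F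
  r : ∀ {i j : C.Obj} (G : C.Hom i j), C.comp (I i) G ⟶ G
  I' : ∀ i : C.Obj, C.Hom i i
  l' : ∀ {j i : C.Obj} (F : C.Hom j i), F ⟶ C.comp F (I' i)
  r' : ∀ {i j : C.Obj} (G : C.Hom i j), G ⟶ C.comp (I' i) G

variable {C}

/-- The axioms of a bilax-unital 2-category. -/
structure IsBilaxUnital (U : BilaxUnits C) : Prop where
  l_naturality : ∀ {j i : C.Obj} {F F' : C.Hom j i} (γ : F ⟶ F'),
    C.whiskerRight (U.I i) γ ≫ U.l F' = U.l F ≫ γ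
  r_naturality : ∀ {i j : C.Obj} {G G' : C.Hom i j} (γ : G ⟶ G'),
    C.whiskerLeft (U.I i) γ ≫ U.r G' = U.r G ≫ γ
  l_r : ∀ {j i m : C.Obj} (F : C.Hom j i) (G : C.Hom i m),
    C.whiskerRight G (U.l F) = (associator F (U.I i) G).hom ≫ C.whiskerLeft F (U.r G)
  l_comp : ∀ {m j i : C.Obj} (H : C.Hom m j) (F : C.Hom j i),
    (associator H F (U.I i)).hom ≫ C.whiskerLeft H (U.l F) = U.l (C.comp H F)
  r_comp : ∀ {i j m : C.Obj} (G : C.Hom i j) (K : C.Hom j m),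
    (associator (U.I i) G K).hom ≫ U.r (C.comp G K) = C.whiskerRight K (U.r G)
  l'_naturality : ∀ {j i : C.Obj} {F F' : C.Hom j i} (γ : F ⟶ F'),
    U.l' F ≫ C.whiskerRight (U.I' i) γ = γ ≫ U.l' F'
  r'_naturality : ∀ {i j : C.Obj} {G G' : C.Hom i j} (γ : G ⟶ G'),
    U.r' G ≫ C.whiskerLeft (U.I' i) γ = γ ≫ U.r' G'
  l'_r' : ∀ {j i m : C.Obj} (F : C.Hom j i) (G : C.Hom i m),
    C.whiskerRight G (U.l' F) ≫ (associator F (U.I' i) G).hom = C.whiskerLeft F (U.r' G)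
  l'_comp : ∀ {m j i : C.Obj} (H : C.Hom m j) (F : C.Hom j i),
    U.l' (C.comp H F) ≫ (associator H F (U.I' i)).hom = C.whiskerLeft H (U.l' F)
  r'_comp : ∀ {i j m : C.Obj} (G : C.Hom i j) (K : C.Hom j m),
    C.whiskerRight K (U.r' G) ≫ (associator (U.I' i) G K).hom = U.r' (C.comp G K)

/-- A finitary bilax-unital 2-category. -/
structure IsFinitaryBilaxUnital (U : BilaxUnits C) : Prop where
  bilaxUnital : IsBilaxUnital U
  finite_obj : Finite C.Obj
  finitary_hom : ∀ i j : C.Obj, IsFinitaryCategory k (C.Hom i j)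
  indec_lax : ∀ i : C.Obj, IsIndec (U.I i)
  indec_oplax : ∀ i : C.Obj, IsIndec (U.I' i)

variable (C) in
/-- The data of a `k`-linear 2-functor `⋆` from `C` to `C` with both 1- and 2-morphisms reversed,
identical on objects and compatible with horizontal composition up to the isomorphisms
`mapComp : (GF)⋆ ≅ F⋆G⋆`. -/
structure StarData where
  obj : ∀ {i j : C.Obj}, C.Hom i j → C.Hom j i
  map : ∀ {i j : C.Obj} {F G : C.Hom i j}, (F ⟶ G) →ₗ[k] (obj G ⟶ obj F)
  mapComp : ∀ {i j l : C.Obj} (F : C.Hom i j) (G : C.Hom j l),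
    obj (C.comp F G) ≅ C.comp (obj G) (obj F)

/-- `⋆` is an equivalence `C ⟶ C^{op,op}`: the 2-functor axioms hold and `⋆` is locally full,
faithful and essentially surjective. -/
structure StarData.IsEquivalence (S : StarData C) : Prop where
  map_id : ∀ {i j : C.Obj} (F : C.Hom i j), S.map (𝟙 F) = 𝟙 (S.obj F)
  map_comp : ∀ {i j : C.Obj} {F G H : C.Hom i j} (γ : F ⟶ G) (δ : G ⟶ H),
    S.map (γ ≫ δ) = S.map δ ≫ S.map γ
  mapComp_whiskerLeft : ∀ {i j l : C.Obj} (F : C.Hom i j) {G G' : C.Hom j l} (γ : G ⟶ G'),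
    S.map (C.whiskerLeft F γ) ≫ (S.mapComp F G).hom =
      (S.mapComp F G').hom ≫ C.whiskerRight (S.obj F) (S.map γ)
  mapComp_whiskerRight : ∀ {i j l : C.Obj} {F F' : C.Hom i j} (γ : F ⟶ F') (G : C.Hom j l),
    S.map (C.whiskerRight G γ) ≫ (S.mapComp F G).hom =
      (S.mapComp F' G).hom ≫ C.whiskerLeft (S.obj G) (S.map γ)
  mapComp_assoc : ∀ {i j l m : C.Obj} (F : C.Hom i j) (G : C.Hom j l) (H : C.Hom l m),
    S.map (associator F G H).hom ≫ (S.mapComp (C.comp F G) H).hom ≫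
        C.whiskerLeft (S.obj H) (S.mapComp F G).hom =
      (S.mapComp F (C.comp G H)).hom ≫ C.whiskerRight (S.obj F) (S.mapComp G H).hom ≫
        (associator (S.obj H) (S.obj G) (S.obj F)).hom
  map_bijective : ∀ {i j : C.Obj} (F G : C.Hom i j),
    Function.Bijective (fun γ : F ⟶ G => S.map γ)
  ess_surj : ∀ {i j : C.Obj} (G : C.Hom j i), ∃ F : C.Hom i j, Nonempty (S.obj F ≅ G)

/-- `⋆⋆` is isomorphic to the identity 2-functor. -/
def StarData.IsInvolutive (S : StarData C) : Prop :=
  ∃ θ : ∀ {i j : C.Obj} (F : C.Hom i j), S.obj (S.obj F) ≅ F,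
    (∀ {i j : C.Obj} {F G : C.Hom i j} (γ : F ⟶ G),
      S.map (S.map γ) ≫ (θ G).hom = (θ F).hom ≫ γ) ∧
    (∀ {i j l : C.Obj} (F : C.Hom i j) (G : C.Hom j l),
      S.map (S.mapComp F G).inv ≫ (S.mapComp (S.obj G) (S.obj F)).hom ≫
          C.whiskerRight (S.obj (S.obj G)) (θ F).hom ≫ C.whiskerLeft F (θ G).hom =
        (θ (C.comp F G)).hom)

/-- The finitary bilax-unital 2-category `(C, U)` is fiax, with weak involution `S`. -/
structure BilaxUnits.IsFiax (U : BilaxUnits C) (S : StarData C) : Prop where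
  finitary : IsFinitaryBilaxUnital U
  equivalence : S.IsEquivalence
  star_I : ∀ i : C.Obj, S.obj (U.I i) = U.I' i
  star_l : ∀ {j i : C.Obj} (F : C.Hom j i),
    S.map (U.l F) ≫ (S.mapComp F (U.I i)).hom ≫
      C.whiskerRight (S.obj F) (eqToHom (star_I i)) = U.r' (S.obj F)
  star_r : ∀ {i j : C.Obj} (G : C.Hom i j),
    S.map (U.r G) ≫ (S.mapComp (U.I i) G).hom ≫
      C.whiskerLeft (S.obj G) (eqToHom (star_I i)) = U.l' (S.obj G)
  /-- Adjunction morphisms `α F : I' ⟶ F⋆F` and `β F : FF⋆ ⟶ I` for all `F`, which make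
  `(F, F⋆)` an adjoint pair and through which `⋆` acts on 2-morphisms. -/
  adjunctions : ∃ (α : ∀ {j i : C.Obj} (F : C.Hom j i), U.I' j ⟶ C.comp F (S.obj F))
      (β : ∀ {j i : C.Obj} (F : C.Hom j i), C.comp (S.obj F) F ⟶ U.I i),
    (∀ {j i : C.Obj} (F : C.Hom j i),
      U.r' F ≫ C.whiskerRight F (α F) ≫ (associator F (S.obj F) F).hom ≫
        C.whiskerLeft F (β F) ≫ U.l F = 𝟙 F) ∧
    (∀ {j i : C.Obj} (F : C.Hom j i),
      U.l' (S.obj F) ≫ C.whiskerLeft (S.obj F) (α F) ≫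
        (associator (S.obj F) F (S.obj F)).inv ≫ C.whiskerRight (S.obj F) (β F) ≫
        U.r (S.obj F) = 𝟙 (S.obj F)) ∧
    (∀ {j i : C.Obj} {F G : C.Hom j i} (γ : F ⟶ G),
      S.map γ =
        U.l' (S.obj G) ≫ C.whiskerLeft (S.obj G) (α F) ≫
          C.whiskerLeft (S.obj G) (C.whiskerRight (S.obj F) γ) ≫
          (associator (S.obj G) G (S.obj F)).inv ≫ C.whiskerRight (S.obj F) (β G) ≫
          U.r (S.obj F))
  involutive : S.IsInvolutive

/-! The 2-full 2-semisubcategory on a class `P` of 1-morphisms closed under composition, with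
objects indexed by a map `o : ι → C.Obj` (several indices may give the same object of `C`). -/

section Full

variable {ι : Type u'} (o : ι → C.Obj) (P : ∀ i j : ι, C.Hom (o i) (o j) → Prop)

@[ext] structure FullHom (i j : ι) where
  hom : C.Hom (o i) (o j)
  mem : P i j hom

instance (i j : ι) : Category.{w} (FullHom o P i j) where
  Hom X Y := X.hom ⟶ Y.hom
  id X := 𝟙 X.hom
  comp f g := f ≫ g
  id_comp _ := Category.id_comp _
  comp_id _ := Category.comp_id _
  assoc _ _ _ := Category.assoc _ _ _

instance (i j : ι) : Preadditive (FullHom o P i j) where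
  homGroup X Y := inferInstanceAs (AddCommGroup (X.hom ⟶ Y.hom))
  add_comp _ _ _ _ _ _ := Preadditive.add_comp _ _ _ _ _ _
  comp_add _ _ _ _ _ _ := Preadditive.comp_add _ _ _ _ _ _

instance (i j : ι) : Linear k (FullHom o P i j) where
  homModule X Y := inferInstanceAs (Module k (X.hom ⟶ Y.hom))
  smul_comp _ _ _ _ _ _ := Linear.smul_comp _ _ _ _ _ _
  comp_smul _ _ _ _ _ _ := Linear.comp_smul _ _ _ _ _ _

theorem FullHom.eqToHom_eq {i j : ι} {X Y : FullHom o P i j} (h : X = Y) :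
    (eqToHom h : X ⟶ Y) = (eqToHom (congrArg FullHom.hom h) : X.hom ⟶ Y.hom) := by
  subst h; rfl

def full (hP : ∀ {i j l : ι} (F : C.Hom (o i) (o j)) (G : C.Hom (o j) (o l)),
    P i j F → P j l G → P i l (C.comp F G)) : TwoSemicat.{u₀, u', v, w} k where
  Obj := ι
  Hom := FullHom o P
  comp F G := ⟨C.comp F.hom G.hom, hP _ _ F.mem G.mem⟩
  whiskerLeft {_ _ _} F {G G'} := (C.whiskerLeft F.hom : (G.hom ⟶ G'.hom) →ₗ[k] _)
  whiskerRight {_ _ _ F F'} G := (C.whiskerRight G.hom : (F.hom ⟶ F'.hom) →ₗ[k] _)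
  whiskerLeft_id _ _ := C.whiskerLeft_id _ _
  whiskerLeft_comp _ _ _ _ _ _ := C.whiskerLeft_comp _ _ _
  whiskerRight_id _ _ := C.whiskerRight_id _ _
  whiskerRight_comp _ _ _ := C.whiskerRight_comp _ _ _
  whisker_exchange _ _ := C.whisker_exchange _ _
  assoc _ _ _ := FullHom.ext (C.assoc _ _ _)
  assoc_left γ G H := by
    rw [FullHom.eqToHom_eq, FullHom.eqToHom_eq]; exact C.assoc_left _ _ _
  assoc_middle F _ _ γ H := by
    rw [FullHom.eqToHom_eq, FullHom.eqToHom_eq]; exact C.assoc_middle _ _ _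
  assoc_right F G _ _ γ := by
    rw [FullHom.eqToHom_eq, FullHom.eqToHom_eq]; exact C.assoc_right _ _ _

/-- The restriction of `⋆` to a 2-full 2-semisubcategory stable under `⋆`. -/
def StarData.full (S : StarData C)
    (hP : ∀ {i j l : ι} (F : C.Hom (o i) (o j)) (G : C.Hom (o j) (o l)),
      P i j F → P j l G → P i l (C.comp F G))
    (hS : ∀ {i j : ι} (F : C.Hom (o i) (o j)), P i j F → P j i (S.obj F)) :
    StarData (TwoSemicat.full o P hP) where
  obj {i j} (F : FullHom o P i j) := (⟨S.obj F.hom, hS _ F.mem⟩ : FullHom o P j i)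
  map {i j} {F G : FullHom o P i j} := (S.map : (F.hom ⟶ G.hom) →ₗ[k] _)
  mapComp {i j l} (F : FullHom o P i j) (G : FullHom o P j l) :=
    { hom := (S.mapComp F.hom G.hom).hom
      inv := (S.mapComp F.hom G.hom).inv
      hom_inv_id := (S.mapComp F.hom G.hom).hom_inv_id
      inv_hom_id := (S.mapComp F.hom G.hom).inv_hom_id }

end Full

end TwoSemicat

open Bicategory

/-! ### The left and the two-sided preorder -/

section Orders

variable {B : Type u} [Bicategory.{w, v} B]

/-- `F ≤_L G`: `G` is a direct summand of some `HF`. -/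
def LeftLE {a b c : B} (F : a ⟶ b) (G : a ⟶ c) : Prop :=
  ∃ H : b ⟶ c, Nonempty (Retract G (F ≫ H))

/-- `F ≤_J G`: `G` is a direct summand of some `KFH`. -/
def TwoSidedLE {a b c d : B} (F : a ⟶ b) (G : c ⟶ d) : Prop :=
  ∃ (H : c ⟶ a) (K : b ⟶ d), Nonempty (Retract G (H ≫ F ≫ K))

theorem LeftLE.twoSidedLE {a b c : B} {F : a ⟶ b} {G : a ⟶ c} (h : LeftLE F G) :
    TwoSidedLE F G := by
  obtain ⟨H, ⟨R⟩⟩ := h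
  exact ⟨𝟙 a, H, ⟨R.trans (Retract.ofIso (λ_ (F ≫ H)).symm)⟩⟩

theorem TwoSidedLE.comp_left {a b c d e : B} {F : a ⟶ b} {G : c ⟶ d} (h : TwoSidedLE F G)
    (W : e ⟶ c) : TwoSidedLE F (W ≫ G) := by
  obtain ⟨H, K, ⟨R⟩⟩ := h
  exact ⟨W ≫ H, K, ⟨(R.map ((Bicategory.precomposing e c d).obj W)).trans
    (Retract.ofIso (α_ W H (F ≫ K)).symm)⟩⟩

theorem TwoSidedLE.comp_right {a b c d e : B} {F : a ⟶ b} {G : c ⟶ d} (h : TwoSidedLE F G)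
    (W : d ⟶ e) : TwoSidedLE F (G ≫ W) := by
  obtain ⟨H, K, ⟨R⟩⟩ := h
  exact ⟨H, K ≫ W, ⟨(R.map ((Bicategory.postcomposing c d e).obj W)).trans
    (Retract.ofIso (α_ H (F ≫ K) W ≪≫ whiskerLeftIso H (α_ F K W)))⟩⟩

theorem TwoSidedLE.of_retract {a b c d : B} {F : a ⟶ b} {G G' : c ⟶ d} (h : TwoSidedLE F G)
    (R : Retract G' G) : TwoSidedLE F G' := by
  obtain ⟨H, K, ⟨R'⟩⟩ := h
  exact ⟨H, K, ⟨R.trans R'⟩⟩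

theorem TwoSidedLE.trans {a b c d e f : B} {E : a ⟶ b} {F : c ⟶ d} {G : e ⟶ f}
    (h : TwoSidedLE E F) (h' : TwoSidedLE F G) : TwoSidedLE E G := by
  obtain ⟨H, K, ⟨R⟩⟩ := h'
  exact ((h.comp_right K).comp_left H).of_retract R

theorem strict_assoc_left [Bicategory.Strict B] {a b c d : B} {F F' : a ⟶ b} (γ : F ⟶ F')
    (G : b ⟶ c) (H : c ⟶ d) :
    γ ▷ G ▷ H ≫ eqToHom (Bicategory.Strict.assoc F' G H) =
      eqToHom (Bicategory.Strict.assoc F G H) ≫ γ ▷ (G ≫ H) := by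
  have := Bicategory.associator_naturality_left γ G H
  rwa [Bicategory.Strict.associator_eqToIso, Bicategory.Strict.associator_eqToIso] at this

theorem strict_assoc_middle [Bicategory.Strict B] {a b c d : B} (F : a ⟶ b) {G G' : b ⟶ c}
    (γ : G ⟶ G') (H : c ⟶ d) :
    (F ◁ γ) ▷ H ≫ eqToHom (Bicategory.Strict.assoc F G' H) =
      eqToHom (Bicategory.Strict.assoc F G H) ≫ F ◁ γ ▷ H := by
  have := Bicategory.associator_naturality_middle F γ H
  rwa [Bicategory.Strict.associator_eqToIso, Bicategory.Strict.associator_eqToIso] at this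

theorem strict_assoc_right [Bicategory.Strict B] {a b c d : B} (F : a ⟶ b) (G : b ⟶ c)
    {H H' : c ⟶ d} (γ : H ⟶ H') :
    (F ≫ G) ◁ γ ≫ eqToHom (Bicategory.Strict.assoc F G H') =
      eqToHom (Bicategory.Strict.assoc F G H) ≫ F ◁ G ◁ γ := by
  have := Bicategory.associator_naturality_right F G γ
  rwa [Bicategory.Strict.associator_eqToIso, Bicategory.Strict.associator_eqToIso] at this

end Orders

/-! ### Fiat 2-categories -/

/-- Whiskering in the 2-category `B` is `k`-linear. -/
class LinearTwoCategory (k : Type u₀) [Field k] (B : Type u) [Bicategory.{w, v} B]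
    [∀ a b : B, Preadditive (a ⟶ b)] [∀ a b : B, Linear k (a ⟶ b)] : Prop where
  whiskerLeft_add : ∀ {a b c : B} (F : a ⟶ b) {G H : b ⟶ c} (γ δ : G ⟶ H),
    F ◁ (γ + δ) = F ◁ γ + F ◁ δ
  whiskerLeft_smul : ∀ {a b c : B} (F : a ⟶ b) {G H : b ⟶ c} (x : k) (γ : G ⟶ H),
    F ◁ (x • γ) = x • F ◁ γ
  add_whiskerRight : ∀ {a b c : B} {F G : a ⟶ b} (γ δ : F ⟶ G) (H : b ⟶ c),
    (γ + δ) ▷ H = γ ▷ H + δ ▷ H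
  smul_whiskerRight : ∀ {a b c : B} {F G : a ⟶ b} (x : k) (γ : F ⟶ G) (H : b ⟶ c),
    (x • γ) ▷ H = x • γ ▷ H

section TwoCategory

variable (k : Type u₀) [Field k] (B : Type u) [Bicategory.{w, v} B]
  [∀ a b : B, Preadditive (a ⟶ b)] [∀ a b : B, Linear k (a ⟶ b)]

/-- A finitary 2-category. -/
structure IsFinitaryTwoCategory : Prop where
  finite_obj : Finite B
  finitary_hom : ∀ a b : B, IsFinitaryCategory k (a ⟶ b)
  indec_id : ∀ a : B, IsIndec (𝟙 a)

/-- A `k`-linear 2-functor `⋆` from `B` to `B` with both 1- and 2-morphisms reversed, identical on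
objects and compatible with identities and horizontal composition up to coherent isomorphism. -/
structure Star where
  obj : ∀ {a b : B}, (a ⟶ b) → (b ⟶ a)
  map : ∀ {a b : B} {F G : a ⟶ b}, (F ⟶ G) →ₗ[k] (obj G ⟶ obj F)
  mapId : ∀ a : B, obj (𝟙 a) ≅ 𝟙 a
  mapComp : ∀ {a b c : B} (F : a ⟶ b) (G : b ⟶ c), obj (F ≫ G) ≅ obj G ≫ obj F
  map_id : ∀ {a b : B} (F : a ⟶ b), map (𝟙 F) = 𝟙 (obj F)
  map_comp : ∀ {a b : B} {F G H : a ⟶ b} (γ : F ⟶ G) (δ : G ⟶ H),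
    map (γ ≫ δ) = map δ ≫ map γ
  mapComp_whiskerLeft : ∀ {a b c : B} (F : a ⟶ b) {G G' : b ⟶ c} (γ : G ⟶ G'),
    map (F ◁ γ) ≫ (mapComp F G).hom = (mapComp F G').hom ≫ map γ ▷ obj F
  mapComp_whiskerRight : ∀ {a b c : B} {F F' : a ⟶ b} (γ : F ⟶ F') (G : b ⟶ c),
    map (γ ▷ G) ≫ (mapComp F G).hom = (mapComp F' G).hom ≫ obj G ◁ map γ
  mapComp_assoc : ∀ {a b c d : B} (F : a ⟶ b) (G : b ⟶ c) (H : c ⟶ d),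
    map (α_ F G H).hom ≫ (mapComp (F ≫ G) H).hom ≫ obj H ◁ (mapComp F G).hom =
      (mapComp F (G ≫ H)).hom ≫ (mapComp G H).hom ▷ obj F ≫ (α_ (obj H) (obj G) (obj F)).hom
  map_leftUnitor : ∀ {a b : B} (F : a ⟶ b),
    map (λ_ F).hom ≫ (mapComp (𝟙 a) F).hom ≫ obj F ◁ (mapId a).hom = (ρ_ (obj F)).inv
  map_rightUnitor : ∀ {a b : B} (F : a ⟶ b),
    map (ρ_ F).hom ≫ (mapComp F (𝟙 b)).hom ≫ (mapId b).hom ▷ obj F = (λ_ (obj F)).inv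

variable {k B}

/-- The finitary 2-category `B` is fiat, with weak involution `S`: the 2-functor `⋆` is an
equivalence, every `(F, F⋆)` is an adjoint pair, adjunctions can be chosen through which `⋆` acts on
2-morphisms, and `⋆⋆` is isomorphic to the identity 2-functor. -/
structure IsFiat (S : Star k B) : Prop where
  finitary : IsFinitaryTwoCategory k B
  map_bijective : ∀ {a b : B} (F G : a ⟶ b), Function.Bijective (fun γ : F ⟶ G => S.map γ)
  ess_surj : ∀ {a b : B} (G : b ⟶ a), ∃ F : a ⟶ b, Nonempty (S.obj F ≅ G)
  adjunctions : ∃ adj : ∀ {a b : B} (F : a ⟶ b), Bicategory.Adjunction F (S.obj F),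
    ∀ {a b : B} {F G : a ⟶ b} (γ : F ⟶ G), S.map γ = conjugateEquiv (adj G) (adj F) γ
  involutive : ∃ θ : ∀ {a b : B} (F : a ⟶ b), S.obj (S.obj F) ≅ F,
    (∀ {a b : B} {F G : a ⟶ b} (γ : F ⟶ G), S.map (S.map γ) ≫ (θ G).hom = (θ F).hom ≫ γ) ∧
    (∀ {a b c : B} (F : a ⟶ b) (G : b ⟶ c),
      S.map (S.mapComp F G).inv ≫ (S.mapComp (S.obj G) (S.obj F)).hom ≫
          (θ F).hom ▷ S.obj (S.obj G) ≫ F ◁ (θ G).hom = (θ (F ≫ G)).hom)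

/-! ### Cells -/

variable (B) in
/-- A two-sided cell: an equivalence class of indecomposable 1-morphisms for `≤_J`. -/
structure TwoSidedCell where
  mem : ∀ {a b : B}, (a ⟶ b) → Prop
  isCell : ∃ (a b : B) (F : a ⟶ b), IsIndec F ∧
    ∀ {c d : B} (G : c ⟶ d), mem G ↔ IsIndec G ∧ TwoSidedLE F G ∧ TwoSidedLE G F

/-- A left cell in the two-sided cell `J`: the equivalence class for `≤_L` of some element of `J`.
All its elements have the same source `src`. -/
structure LeftCell (J : TwoSidedCell B) where
  src : B
  mem : ∀ {b : B}, (src ⟶ b) → Prop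
  isCell : ∃ (b : B) (F : src ⟶ b), J.mem F ∧
    ∀ {c : B} (G : src ⟶ c), mem G ↔ IsIndec G ∧ LeftLE F G ∧ LeftLE G F

/-- Membership in the right cell `R = L⋆`; its elements have target `L.src`. -/
def LeftCell.starMem {J : TwoSidedCell B} (S : Star k B) (L : LeftCell J) {c : B}
    (F : c ⟶ L.src) : Prop :=
  ∃ G : L.src ⟶ c, L.mem G ∧ Nonempty (F ≅ S.obj G)

/-- `F ≥_J J`. -/
def TwoSidedCell.Ge (J : TwoSidedCell B) {c d : B} (G : c ⟶ d) : Prop :=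
  ∃ (a b : B) (F : a ⟶ b), J.mem F ∧ TwoSidedLE F G

theorem TwoSidedCell.ge_of_mem (J : TwoSidedCell B) {a b : B} {F : a ⟶ b} (h : J.mem F) :
    J.Ge F :=
  ⟨a, b, F, h, LeftLE.twoSidedLE ⟨𝟙 b, ⟨Retract.ofIso (ρ_ F).symm⟩⟩⟩

theorem LeftCell.mem_twoSidedCell {J : TwoSidedCell B} (L : LeftCell J) {c : B}
    {G : L.src ⟶ c} (h : L.mem G) : J.mem G := by
  obtain ⟨b, F, hF, hL⟩ := L.isCell
  obtain ⟨hi, h₁, h₂⟩ := (hL G).1 h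
  obtain ⟨x, y, E, -, hJ⟩ := J.isCell
  obtain ⟨-, h₃, h₄⟩ := (hJ F).1 hF
  exact (hJ G).2 ⟨hi, h₃.trans h₁.twoSidedLE, h₂.twoSidedLE.trans h₄⟩

/-! ### The 2-semicategory `C(J)` -/

/-- A 1-morphism in `add {F | F ≥_J J}`. -/
@[ext] structure GeHom (J : TwoSidedCell B) (a b : B) where
  hom : a ⟶ b
  mem : InAdd (fun F : a ⟶ b => J.Ge F) hom

end TwoCategory

section CofJ

variable (k : Type u₀) [Field k] {B : Type u} [Bicategory.{w, v} B]
  [∀ a b : B, Preadditive (a ⟶ b)] [∀ a b : B, Linear k (a ⟶ b)] [LinearTwoCategory k B]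

theorem whiskerRight_sum (k : Type u₀) [Field k] {B : Type u} [Bicategory.{w, v} B]
    [∀ a b : B, Preadditive (a ⟶ b)] [∀ a b : B, Linear k (a ⟶ b)] [LinearTwoCategory k B]
    {a b c : B} {F G : a ⟶ b} (H : b ⟶ c) {n : ℕ} (γ : Fin n → (F ⟶ G)) :
    (∑ t, γ t) ▷ H = ∑ t, γ t ▷ H :=
  map_sum (AddMonoidHom.mk' (fun γ : F ⟶ G => γ ▷ H)
    (fun γ δ => LinearTwoCategory.add_whiskerRight k γ δ H)) γ _

variable {J : TwoSidedCell B}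

def GeHom.comp {a b c : B} (X : GeHom J a b) (Y : GeHom J b c) : GeHom J a c where
  hom := X.hom ≫ Y.hom
  mem := by
    obtain ⟨n, f, s, r, hf, h⟩ := X.mem
    refine ⟨n, fun t => f t ≫ Y.hom, fun t => s t ▷ Y.hom, fun t => r t ▷ Y.hom, fun t => ?_, ?_⟩
    · obtain ⟨x, y, F, hF, hle⟩ := hf t
      exact ⟨x, y, F, hF, hle.comp_right _⟩
    · have := whiskerRight_sum k Y.hom (fun t => s t ≫ r t)
      rw [h] at this
      simpa using this.symm

variable (J)

/-- A 2-ideal of the 2-semicategory `add {F | F ≥_J J}`. -/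
structure TwoIdeal where
  carrier : ∀ {a b : B} (X Y : GeHom J a b), Submodule k (X.hom ⟶ Y.hom)
  comp_mem_left : ∀ {a b : B} {W X Y : GeHom J a b} (γ : W.hom ⟶ X.hom) {δ : X.hom ⟶ Y.hom},
    δ ∈ carrier X Y → γ ≫ δ ∈ carrier W Y
  comp_mem_right : ∀ {a b : B} {X Y Z : GeHom J a b} {γ : X.hom ⟶ Y.hom} (δ : Y.hom ⟶ Z.hom),
    γ ∈ carrier X Y → γ ≫ δ ∈ carrier X Z
  whiskerLeft_mem : ∀ {a b c : B} (W : GeHom J a b) {X Y : GeHom J b c} {γ : X.hom ⟶ Y.hom},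
    γ ∈ carrier X Y → W.hom ◁ γ ∈ carrier (W.comp k X) (W.comp k Y)
  whiskerRight_mem : ∀ {a b c : B} {X Y : GeHom J a b} {γ : X.hom ⟶ Y.hom} (W : GeHom J b c),
    γ ∈ carrier X Y → γ ▷ W.hom ∈ carrier (X.comp k W) (Y.comp k W)

variable {k J}

instance : LE (TwoIdeal k J) where
  le K M := ∀ {a b : B} (X Y : GeHom J a b), K.carrier X Y ≤ M.carrier X Y

/-- The ideal contains no `id_F` with `F ∈ J`. -/
def TwoIdeal.Avoids (K : TwoIdeal k J) : Prop :=
  ∀ {a b : B} (X : GeHom J a b), J.mem X.hom → 𝟙 X.hom ∉ K.carrier X X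

variable (k J)

/-- The sum of all 2-ideals that contain no `id_F` with `F ∈ J`. -/
def maxIdeal : TwoIdeal k J where
  carrier X Y := ⨆ K : {K : TwoIdeal k J // K.Avoids}, K.1.carrier X Y
  comp_mem_left {_ _ W X Y} γ {δ} h := by
    have : (⨆ K : {K : TwoIdeal k J // K.Avoids}, K.1.carrier X Y) ≤
        (⨆ K : {K : TwoIdeal k J // K.Avoids}, K.1.carrier W Y).comap
          (Linear.leftComp k Y.hom γ) :=
      iSup_le fun K _ hδ => Submodule.mem_iSup_of_mem K (K.1.comp_mem_left γ hδ)
    exact this h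
  comp_mem_right {_ _ X Y Z} γ δ h := by
    have : (⨆ K : {K : TwoIdeal k J // K.Avoids}, K.1.carrier X Y) ≤
        (⨆ K : {K : TwoIdeal k J // K.Avoids}, K.1.carrier X Z).comap
          (Linear.rightComp k X.hom δ) :=
      iSup_le fun K _ hδ => Submodule.mem_iSup_of_mem K (K.1.comp_mem_right δ hδ)
    exact this h
  whiskerLeft_mem {_ _ _} W {X Y} γ h := by
    have : (⨆ K : {K : TwoIdeal k J // K.Avoids}, K.1.carrier X Y) ≤
        (⨆ K : {K : TwoIdeal k J // K.Avoids}, K.1.carrier (W.comp k X) (W.comp k Y)).comap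
          ({ toFun := fun γ => W.hom ◁ γ
             map_add' := LinearTwoCategory.whiskerLeft_add k W.hom
             map_smul' := LinearTwoCategory.whiskerLeft_smul W.hom } :
            (X.hom ⟶ Y.hom) →ₗ[k] (W.hom ≫ X.hom ⟶ W.hom ≫ Y.hom)) :=
      iSup_le fun K _ hδ => Submodule.mem_iSup_of_mem K (K.1.whiskerLeft_mem W hδ)
    exact this h
  whiskerRight_mem {_ _ _ X Y γ} W h := by
    have : (⨆ K : {K : TwoIdeal k J // K.Avoids}, K.1.carrier X Y) ≤
        (⨆ K : {K : TwoIdeal k J // K.Avoids}, K.1.carrier (X.comp k W) (Y.comp k W)).comap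
          ({ toFun := fun γ => γ ▷ W.hom
             map_add' := fun γ δ => LinearTwoCategory.add_whiskerRight k γ δ W.hom
             map_smul' := fun x γ => LinearTwoCategory.smul_whiskerRight x γ W.hom } :
            (X.hom ⟶ Y.hom) →ₗ[k] (X.hom ≫ W.hom ⟶ Y.hom ≫ W.hom)) :=
      iSup_le fun K _ hδ => Submodule.mem_iSup_of_mem K (K.1.whiskerRight_mem W hδ)
    exact this h

/-- A 1-morphism of `C(J)`. -/
@[ext] structure QHom (k : Type u₀) {B : Type u} [Bicategory.{w, v} B]
    [∀ a b : B, Preadditive (a ⟶ b)] (J : TwoSidedCell B) (a b : B) where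
  rep : GeHom J a b

variable {k J}

instance (a b : B) : Category.{w} (QHom k J a b) where
  Hom X Y := (X.rep.hom ⟶ Y.rep.hom) ⧸ (maxIdeal k J).carrier X.rep Y.rep
  id X := Submodule.Quotient.mk (𝟙 X.rep.hom)
  comp {X Y Z} f g := Quotient.map₂ (fun γ δ => γ ≫ δ)
    (by
      intro γ γ' h δ δ' h'
      have h := (Submodule.quotientRel_def _).1 h
      have h' := (Submodule.quotientRel_def _).1 h'
      refine (Submodule.quotientRel_def _).2 ?_
      have e : γ ≫ δ - γ' ≫ δ' = (γ - γ') ≫ δ + γ' ≫ (δ - δ') := by simp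
      rw [e]
      exact add_mem ((maxIdeal k J).comp_mem_right (Z := Z.rep) δ h)
        ((maxIdeal k J).comp_mem_left (W := X.rep) γ' h')) f g
  id_comp f := by
    induction f using Submodule.Quotient.induction_on
    exact congrArg Submodule.Quotient.mk (Category.id_comp _)
  comp_id f := by
    induction f using Submodule.Quotient.induction_on
    exact congrArg Submodule.Quotient.mk (Category.comp_id _)
  assoc f g h := by
    induction f using Submodule.Quotient.induction_on
    induction g using Submodule.Quotient.induction_on
    induction h using Submodule.Quotient.induction_on
    exact congrArg Submodule.Quotient.mk (Category.assoc _ _ _)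

/-- The class in `C(J)` of a 2-morphism of the fiat 2-category. -/
def QHom.mk₂ {a b : B} {X Y : QHom k J a b} (γ : X.rep.hom ⟶ Y.rep.hom) : X ⟶ Y :=
  Submodule.Quotient.mk γ

theorem QHom.mk₂_surjective {a b : B} {X Y : QHom k J a b} (f : X ⟶ Y) :
    ∃ γ, f = QHom.mk₂ γ := by
  obtain ⟨γ, rfl⟩ := Submodule.Quotient.mk_surjective _ f
  exact ⟨γ, rfl⟩

theorem QHom.mk₂_comp {a b : B} {X Y Z : QHom k J a b} (γ : X.rep.hom ⟶ Y.rep.hom)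
    (δ : Y.rep.hom ⟶ Z.rep.hom) :
    (QHom.mk₂ γ : X ⟶ Y) ≫ (QHom.mk₂ δ : Y ⟶ Z) = QHom.mk₂ (γ ≫ δ) := rfl

theorem QHom.mk₂_id {a b : B} (X : QHom k J a b) :
    (QHom.mk₂ (𝟙 X.rep.hom) : X ⟶ X) = 𝟙 X := rfl

instance (a b : B) : Preadditive (QHom k J a b) where
  homGroup X Y := inferInstanceAs
    (AddCommGroup ((X.rep.hom ⟶ Y.rep.hom) ⧸ (maxIdeal k J).carrier X.rep Y.rep))
  add_comp _ _ _ f g h := by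
    induction f using Submodule.Quotient.induction_on
    induction g using Submodule.Quotient.induction_on
    induction h using Submodule.Quotient.induction_on
    exact congrArg Submodule.Quotient.mk (Preadditive.add_comp _ _ _ _ _ _)
  comp_add _ _ _ f g h := by
    induction f using Submodule.Quotient.induction_on
    induction g using Submodule.Quotient.induction_on
    induction h using Submodule.Quotient.induction_on
    exact congrArg Submodule.Quotient.mk (Preadditive.comp_add _ _ _ _ _ _)

instance (a b : B) : Linear k (QHom k J a b) where
  homModule X Y := inferInstanceAs
    (Module k ((X.rep.hom ⟶ Y.rep.hom) ⧸ (maxIdeal k J).carrier X.rep Y.rep))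
  smul_comp _ _ _ x f g := by
    induction f using Submodule.Quotient.induction_on
    induction g using Submodule.Quotient.induction_on
    exact congrArg Submodule.Quotient.mk (Linear.smul_comp _ _ _ _ _ _)
  comp_smul _ _ _ f x g := by
    induction f using Submodule.Quotient.induction_on
    induction g using Submodule.Quotient.induction_on
    exact congrArg Submodule.Quotient.mk (Linear.comp_smul _ _ _ _ _ _)

theorem QHom.mk₂_eqToHom {a b : B} {X Y : QHom k J a b} (h : X = Y) :
    (eqToHom h : X ⟶ Y) = QHom.mk₂ (eqToHom (congrArg (fun Z => Z.rep.hom) h)) := by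
  subst h; rfl

def QHom.mk₂Iso {a b : B} {X Y : QHom k J a b} (e : X.rep.hom ≅ Y.rep.hom) : X ≅ Y where
  hom := QHom.mk₂ e.hom
  inv := QHom.mk₂ e.inv
  hom_inv_id := by rw [QHom.mk₂_comp, e.hom_inv_id, QHom.mk₂_id]
  inv_hom_id := by rw [QHom.mk₂_comp, e.inv_hom_id, QHom.mk₂_id]

def QHom.comp {a b c : B} (X : QHom k J a b) (Y : QHom k J b c) : QHom k J a c :=
  ⟨X.rep.comp k Y.rep⟩

def QHom.whiskerLeft {a b c : B} (W : QHom k J a b) {X Y : QHom k J b c} :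
    (X ⟶ Y) →ₗ[k] (W.comp X ⟶ W.comp Y) :=
  Submodule.mapQ _ ((maxIdeal k J).carrier (W.comp X).rep (W.comp Y).rep)
    ({ toFun := fun γ => W.rep.hom ◁ γ
       map_add' := LinearTwoCategory.whiskerLeft_add k W.rep.hom
       map_smul' := LinearTwoCategory.whiskerLeft_smul W.rep.hom } :
      (X.rep.hom ⟶ Y.rep.hom) →ₗ[k] (W.rep.hom ≫ X.rep.hom ⟶ W.rep.hom ≫ Y.rep.hom))
    (fun _ h => (maxIdeal k J).whiskerLeft_mem W.rep h)

def QHom.whiskerRight {a b c : B} {X Y : QHom k J a b} (W : QHom k J b c) :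
    (X ⟶ Y) →ₗ[k] (X.comp W ⟶ Y.comp W) :=
  Submodule.mapQ _ ((maxIdeal k J).carrier (X.comp W).rep (Y.comp W).rep)
    ({ toFun := fun γ => γ ▷ W.rep.hom
       map_add' := fun γ δ => LinearTwoCategory.add_whiskerRight k γ δ W.rep.hom
       map_smul' := fun x γ => LinearTwoCategory.smul_whiskerRight x γ W.rep.hom } :
      (X.rep.hom ⟶ Y.rep.hom) →ₗ[k] (X.rep.hom ≫ W.rep.hom ⟶ Y.rep.hom ≫ W.rep.hom))
    (fun _ h => (maxIdeal k J).whiskerRight_mem W.rep h)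

theorem QHom.whiskerLeft_mk₂ {a b c : B} (W : QHom k J a b) {X Y : QHom k J b c}
    (γ : X.rep.hom ⟶ Y.rep.hom) :
    W.whiskerLeft (QHom.mk₂ γ : X ⟶ Y) = QHom.mk₂ (W.rep.hom ◁ γ) := rfl

theorem QHom.whiskerRight_mk₂ {a b c : B} {X Y : QHom k J a b} (W : QHom k J b c)
    (γ : X.rep.hom ⟶ Y.rep.hom) :
    QHom.whiskerRight W (QHom.mk₂ γ : X ⟶ Y) = QHom.mk₂ (γ ▷ W.rep.hom) := rfl

variable (k J)

/-- The 2-semicategory `C(J) = add {F | F ≥_J J} / I`, where `I` is the maximal 2-ideal. Its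
objects are the sources and targets of the elements of `J`. -/
def CofJ [Bicategory.Strict B] : TwoSemicat.{u₀, u, v, w} k where
  Obj := {a : B // (∃ (b : B) (F : a ⟶ b), J.mem F) ∨ ∃ (b : B) (F : b ⟶ a), J.mem F}
  Hom a b := QHom k J a.1 b.1
  comp X Y := X.comp Y
  whiskerLeft W _ _ := W.whiskerLeft
  whiskerRight W := QHom.whiskerRight W
  whiskerLeft_id _ _ := congrArg QHom.mk₂ (Bicategory.whiskerLeft_id _ _)
  whiskerLeft_comp W _ _ _ f g := by
    obtain ⟨f, rfl⟩ := QHom.mk₂_surjective f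
    obtain ⟨g, rfl⟩ := QHom.mk₂_surjective g
    exact congrArg QHom.mk₂ (Bicategory.whiskerLeft_comp _ _ _)
  whiskerRight_id _ _ := congrArg QHom.mk₂ (Bicategory.id_whiskerRight _ _)
  whiskerRight_comp W f g := by
    obtain ⟨f, rfl⟩ := QHom.mk₂_surjective f
    obtain ⟨g, rfl⟩ := QHom.mk₂_surjective g
    exact congrArg QHom.mk₂ (Bicategory.comp_whiskerRight f g W.rep.hom)
  whisker_exchange f g := by
    obtain ⟨f, rfl⟩ := QHom.mk₂_surjective f
    obtain ⟨g, rfl⟩ := QHom.mk₂_surjective g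
    exact congrArg QHom.mk₂ (Bicategory.whisker_exchange f g)
  assoc X Y Z := QHom.ext (GeHom.ext (Bicategory.Strict.assoc _ _ _))
  assoc_left f Y Z := by
    obtain ⟨f, rfl⟩ := QHom.mk₂_surjective f
    rw [QHom.mk₂_eqToHom, QHom.mk₂_eqToHom]
    exact congrArg QHom.mk₂ (strict_assoc_left f Y.rep.hom Z.rep.hom)
  assoc_middle X _ _ f Z := by
    obtain ⟨f, rfl⟩ := QHom.mk₂_surjective f
    rw [QHom.mk₂_eqToHom, QHom.mk₂_eqToHom]
    exact congrArg QHom.mk₂ (strict_assoc_middle X.rep.hom f Z.rep.hom)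
  assoc_right X Y _ _ f := by
    obtain ⟨f, rfl⟩ := QHom.mk₂_surjective f
    rw [QHom.mk₂_eqToHom, QHom.mk₂_eqToHom]
    exact congrArg QHom.mk₂ (strict_assoc_right X.rep.hom Y.rep.hom f)

variable {k J}

/-- The weak involution that `⋆` induces on `C(J)`, once `add {F | F ≥_J J}` and the maximal
2-ideal are known to be stable under `⋆`. -/
def CofJ.star [Bicategory.Strict B] (S : Star k B)
    (hge : ∀ {a b : B} (F : a ⟶ b), InAdd (fun G : a ⟶ b => J.Ge G) F →
      InAdd (fun G : b ⟶ a => J.Ge G) (S.obj F))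
    (hI : ∀ {a b : B} (X Y : GeHom J a b) (γ : X.hom ⟶ Y.hom), γ ∈ (maxIdeal k J).carrier X Y →
      S.map γ ∈ (maxIdeal k J).carrier ⟨S.obj Y.hom, hge _ Y.mem⟩ ⟨S.obj X.hom, hge _ X.mem⟩) :
    (CofJ k J).StarData where
  obj {a b} (X : QHom k J a.1 b.1) := (⟨⟨S.obj X.rep.hom, hge _ X.rep.mem⟩⟩ : QHom k J b.1 a.1)
  map {a b} {X Y : QHom k J a.1 b.1} := Submodule.mapQ _
    ((maxIdeal k J).carrier ⟨S.obj Y.rep.hom, hge _ Y.rep.mem⟩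
      ⟨S.obj X.rep.hom, hge _ X.rep.mem⟩)
    (S.map : (X.rep.hom ⟶ Y.rep.hom) →ₗ[k] _) (fun γ h => hI X.rep Y.rep γ h)
  mapComp {a b c} (X : QHom k J a.1 b.1) (Y : QHom k J b.1 c.1) :=
    QHom.mk₂Iso (S.mapComp X.rep.hom Y.rep.hom)

/-! ### Duflo 1-morphisms -/

/-- `F (P / K) = 0`, where `P = Hom(-, 𝟙 a)` and `F : a ⟶ b` acts on the projective
abelianization: if `K` is the image of `P_κ : P_X ⟶ P`, then `P / K` is the cokernel of `P_κ`, and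
`F (P / K)` is the cokernel of the map `P_{FX} ⟶ P_F` given by `Fκ`. -/
def Annihilates {a b : B} (F : a ⟶ b) (K : RepSubmodule k (𝟙 a)) : Prop :=
  ∃ (X : a ⟶ a) (κ : X ⟶ 𝟙 a), K.IsGeneratedBy κ ∧
    ∀ (Y : a ⟶ b) (g : Y ⟶ F), ∃ h : Y ⟶ X ≫ F, g = h ≫ κ ▷ F ≫ (λ_ F).hom

variable (k) in
/-- `D` is a Duflo 1-morphism of the left cell `L` and `d : D ⟶ 𝟙` its defining 2-morphism:
the minimal submodule `K` of `P = Hom(-, 𝟙)` such that all 1-morphisms in `L` annihilate `P / K`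
has simple top `L_D`, and `d` gives the projective cover `P_D ⟶ K ⊆ P`. -/
structure IsDuflo (L : LeftCell J) (D : L.src ⟶ L.src) (d : D ⟶ 𝟙 L.src) : Prop where
  indec : IsIndec D
  exists_submodule : ∃ K : RepSubmodule k (𝟙 L.src),
    Minimal (fun K => ∀ {b : B} (F : L.src ⟶ b), L.mem F → Annihilates F K) K ∧
      K.HasSimpleTop D ∧ K.IsGeneratedBy d

/-! ### The bilax-unital 2-category `C_J` -/

/-- `F ∈ L_i ∩ R_j`, where `R_j = L_j⋆`. -/
def cellMem (S : Star k B) (i j : LeftCell J) (F : i.src ⟶ j.src) : Prop :=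
  i.mem F ∧ j.starMem S F

/-- The class `add (L_i ∩ R_j)` of 1-morphisms of `C(J)`. -/
def CJMem (S : Star k B) (i j : LeftCell J) (X : QHom k J i.src j.src) : Prop :=
  InAdd (fun Y : QHom k J i.src j.src => cellMem S i j Y.rep.hom) X

variable (J) in
/-- The closure properties needed to form `C_J` and to restrict `⋆` to it. -/
structure IsCellClosed (S : Star k B) : Prop where
  comp_mem : ∀ {i j l : LeftCell J} (X : QHom k J i.src j.src) (Y : QHom k J j.src l.src),
    CJMem S i j X → CJMem S j l Y → CJMem S i l (X.comp Y)
  star_ge : ∀ {a b : B} (F : a ⟶ b), InAdd (fun G : a ⟶ b => J.Ge G) F →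
    InAdd (fun G : b ⟶ a => J.Ge G) (S.obj F)
  star_ideal : ∀ {a b : B} (X Y : GeHom J a b) (γ : X.hom ⟶ Y.hom),
    γ ∈ (maxIdeal k J).carrier X Y →
      S.map γ ∈ (maxIdeal k J).carrier ⟨S.obj Y.hom, star_ge _ Y.mem⟩
        ⟨S.obj X.hom, star_ge _ X.mem⟩
  star_mem : ∀ {i j : LeftCell J} (X : QHom k J i.src j.src), CJMem S i j X →
    CJMem S j i ⟨⟨S.obj X.rep.hom, star_ge _ X.rep.mem⟩⟩

variable (k) in
/-- The source of a left cell in `J`, as an object of `C(J)`. -/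
def LeftCell.obj [Bicategory.Strict B] (i : LeftCell J) : (CofJ k J).Obj :=
  ⟨i.src, Or.inl (i.isCell.imp fun _ h => h.imp fun _ h => h.1)⟩

/-- The 2-semicategory `C_J`: its objects are the left cells `L_i` in `J`, and
`C_J(i, j) = add (L_i ∩ R_j)` inside `C(J)`. -/
def CJ [Bicategory.Strict B] {S : Star k B} (h : IsCellClosed J S) :
    TwoSemicat.{u₀, max u v, v, w} k :=
  (CofJ k J).full (LeftCell.obj k) (CJMem S) h.comp_mem

/-- The weak involution on `C_J` induced by `⋆`. -/
def CJ.star [Bicategory.Strict B] {S : Star k B} (h : IsCellClosed J S) :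
    (CJ h).StarData :=
  (CofJ.star S h.star_ge h.star_ideal).full (LeftCell.obj k) (CJMem S) h.comp_mem h.star_mem

/-- An element of `L_i ∩ R_j` as a 1-morphism of `C(J)`. -/
def CJ.ofMem {S : Star k B} {i j : LeftCell J} {F : i.src ⟶ j.src} (hF : cellMem S i j F) :
    QHom k J i.src j.src :=
  ⟨⟨F, InAdd.of_mem (J.ge_of_mem (i.mem_twoSidedCell hF.1))⟩⟩

/-- `d⋆ : 𝟙 ≅ 𝟙⋆ ⟶ D⋆`. -/
def Star.dual (S : Star k B) {a : B} {D : a ⟶ a} (d : D ⟶ 𝟙 a) : 𝟙 a ⟶ S.obj D :=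
  (S.mapId a).inv ≫ S.map d

/-- The lax units `D_i` and the oplax units `D_i⋆` of `C_J`. The lax unitors are given by
horizontal composition with `d_i`, the oplax unitors by horizontal composition with `d_i⋆`. -/
def CJ.units [Bicategory.Strict B] {S : Star k B} (h : IsCellClosed J S)
    (D : ∀ i : LeftCell J, i.src ⟶ i.src) (d : ∀ i, D i ⟶ 𝟙 i.src)
    (hD : ∀ i, cellMem S i i (D i)) : (CJ h).BilaxUnits where
  I i := ⟨CJ.ofMem (hD i), InAdd.of_mem (hD i)⟩
  l F := QHom.mk₂ (F.hom.rep.hom ◁ d _ ≫ (ρ_ F.hom.rep.hom).hom)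
  r G := QHom.mk₂ (d _ ▷ G.hom.rep.hom ≫ (λ_ G.hom.rep.hom).hom)
  I' i := (CJ.star h).obj ⟨CJ.ofMem (hD i), InAdd.of_mem (hD i)⟩
  l' F := QHom.mk₂ ((ρ_ F.hom.rep.hom).inv ≫ F.hom.rep.hom ◁ S.dual (d _))
  r' G := QHom.mk₂ ((λ_ G.hom.rep.hom).inv ≫ S.dual (d _) ▷ G.hom.rep.hom)

end CofJ

end Fiax

namespace Fiax

open Bicategory

universe u₀ u v w u' v'

/-! ### Finite-dimensional algebras -/

section Algebra

/-! The main tool is the counit ev_F : F⋆F → 𝟙 of the adjunction F⋆ ⊣ F. For a submodule K of P_𝟙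
generated by one morphism, F annihilates P_𝟙/K exactly when ev_F lies in K (`annihilates_iff`), and
the image of ev_F depends only on the left cell of F (`exists_comp_eq_ev_of_leftLE`). So the minimal
submodule attached to a left cell is the image of ev_F for any F in it. As End F is local, one
indecomposable summand D of F⋆F already generates this image (`exists_isEvCover`), and locality of
End D gives the simple top and the uniqueness of D.

The maximal 2-ideal: an ideal without identities of J meets End F, F ∈ J, in non-invertible
elements, which form a subspace because End F is local; hence the sum of all such ideals is again
one (`maxIdeal_avoids`). The preimage of this sum under ⋆ has the same property, whence stability
under ⋆.

Closure of L_i ∩ R_j: an indecomposable summand of GF outside J becomes zero in C(J)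
(`id_mem_maxIdeal`). For a summand in J it must be shown that F ≤_L G within J forces G ≤_L F
(`leftLE_symm`). This is a Perron–Frobenius argument. The matrices of multiplicities for left and
for two-sided multiplication commute, and the second is positive on J; a nonnegative matrix that
commutes with a positive one is block diagonal once it is block triangular
(`eq_zero_of_commute_pos`).

The fiax structure: units of F ⊣ F⋆ for F in L_j factor through d_j⋆, and counits for F in R_i
factor through d_i. The factors are α_F and β_F, and the axioms reduce to the triangle identities of
the fiat 2-category. A general F in C_J is a summand of cell elements only modulo the ideal, so the
factorizations hold up to an endomorphism e that represents 𝟙_F (`exists_factorizations`).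

Finitarity of C_J follows by lifting idempotents along quotients of finite-dimensional algebras,
with the Fitting idempotents constructed next. -/

theorem exists_pow_eq_pow_mul {k A : Type*} [Field k] [Ring A] [Algebra k A] [Module.Finite k A]
    (a : A) : ∃ (n : ℕ) (z : A), 0 < n ∧ Commute a z ∧ a ^ n = a ^ n * (a ^ n * z) := by
  have hp : minpoly k a ≠ 0 := minpoly.ne_zero (Algebra.IsIntegral.isIntegral a)
  obtain ⟨q, hq, hdvd⟩ := Polynomial.exists_eq_pow_rootMultiplicity_mul_and_not_dvd _ hp 0
  set m := (minpoly k a).rootMultiplicity 0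
  rw [Polynomial.C_0, sub_zero] at hq hdvd
  have hc : q.coeff 0 ≠ 0 := fun h => hdvd (Polynomial.X_dvd_iff.2 h)
  -- The minimal polynomial is X ^ m * q with q(0) ≠ 0, and `s` is chosen so that 1 - a * s = q(a) /
  -- q(0). Hence a ^ m * (1 - a * s) = 0.
  set s : A := Polynomial.aeval a (-(Polynomial.C (q.coeff 0)⁻¹ * q.divX))
  have hcom : Commute a s := by
    have : Commute (Polynomial.aeval a (Polynomial.X : Polynomial k)) s :=
      Commute.map (Commute.all _ _) _
    rwa [Polynomial.aeval_X] at this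
  have h1 : a ^ m = a ^ m * (a * s) := by
    have h0 : Polynomial.aeval a (minpoly k a) = 0 := minpoly.aeval k a
    rw [hq, map_mul, map_pow, Polynomial.aeval_X] at h0
    have e : Polynomial.C (q.coeff 0)⁻¹ * q =
        1 - Polynomial.X * -(Polynomial.C (q.coeff 0)⁻¹ * q.divX) := by
      have e₁ : Polynomial.C (q.coeff 0)⁻¹ * Polynomial.C (q.coeff 0) = 1 := by
        rw [← Polynomial.C_mul, inv_mul_cancel₀ hc, Polynomial.C_1]
      have e₂ := Polynomial.X_mul_divX_add q
      linear_combination (-Polynomial.C (q.coeff 0)⁻¹) * e₂ + e₁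
    have h2 : a ^ m * Polynomial.aeval a (Polynomial.C (q.coeff 0)⁻¹ * q) = 0 := by
      rw [mul_comm, map_mul, ← mul_assoc, h0, zero_mul]
    rw [e, map_sub, map_one, map_mul, Polynomial.aeval_X, mul_sub, mul_one, sub_eq_zero] at h2
    exact h2
  have h2 : ∀ j : ℕ, a ^ m = a ^ m * (a * s) ^ j := by
    intro j
    induction j with
    | zero => simp
    | succ j ih => rw [pow_succ, ← mul_assoc, ← ih, ← h1]
  -- The exponent m + 1 instead of m ensures that it is positive.
  refine ⟨m + 1, s ^ (m + 1), Nat.succ_pos _, hcom.pow_right _, ?_⟩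
  rw [← hcom.mul_pow, pow_succ, (Commute.refl a).pow_left m |>.eq, mul_assoc, ← h2]

/-- Fitting's lemma: `a ^ n * z` is idempotent; if it is 0 then `a ^ n = 0`, and if it is 1 then `z`
inverts `a ^ n`. -/
theorem isNilpotent_or_isUnit_of_idempotents {k A : Type*} [Field k] [Ring A] [Algebra k A]
    [Module.Finite k A] (h : ∀ e : A, e * e = e → e = 0 ∨ e = 1) (a : A) :
    IsNilpotent a ∨ IsUnit a := by
  obtain ⟨n, z, hn, hc, e⟩ := exists_pow_eq_pow_mul (k := k) a
  have hc' : Commute (a ^ n) z := hc.pow_left n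
  rcases h (a ^ n * z) (by
    rw [← mul_assoc, mul_assoc (a ^ n) z, ← hc'.eq, ← e]) with h0 | h1
  · left; exact ⟨n, by rw [e, h0, mul_zero]⟩
  · right
    have : IsUnit (a ^ n) := ⟨⟨a ^ n, z, h1, hc'.eq ▸ h1⟩, rfl⟩
    exact (isUnit_pow_iff hn.ne').1 this

/-- The kernel of `φ` need not be nilpotent. The Fitting idempotent `a ^ n * z` works because φ(a ^
n) = φ a turns the relation for `a ^ n` into φ a = φ a * φ z. -/
theorem exists_idempotent_lift {k A R : Type*} [Field k] [Ring A] [Algebra k A]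
    [Module.Finite k A] [Ring R] (φ : A →+* R) (a : A) (h : φ a * φ a = φ a) :
    ∃ e : A, e * e = e ∧ φ e = φ a := by
  obtain ⟨n, z, hn, hc, e⟩ := exists_pow_eq_pow_mul (k := k) a
  have hc' : Commute (a ^ n) z := hc.pow_left n
  refine ⟨a ^ n * z, ?_, ?_⟩
  · rw [← mul_assoc, mul_assoc (a ^ n) z, ← hc'.eq, ← e]
  · have hp : φ (a ^ n) = φ a := by
      rw [map_pow]; exact IsIdempotentElem.pow_eq h hn.ne'
    have e' := congrArg φ e
    rw [map_mul, map_mul, hp, ← mul_assoc, h] at e'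
    rw [map_mul, hp, ← e']

end Algebra

/-! ### Objects with local endomorphism rings. -/

section Local

theorem nonempty_retract_of_isIso {A : Type u} [Category.{v} A] {X Y : A} {s : X ⟶ Y} {r : Y ⟶ X}
    (h : IsIso (s ≫ r)) : Nonempty (Retract X Y) :=
  ⟨⟨s, r ≫ inv (s ≫ r), by rw [← Category.assoc, IsIso.hom_inv_id]⟩⟩

variable {A : Type u} [Category.{v} A] [Preadditive A]

/-- A nonzero object all of whose endomorphisms are nilpotent or invertible. -/
structure HasLocalEnd (X : A) : Prop where
  id_ne : 𝟙 X ≠ 0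
  nilpotent_or_isIso : ∀ f : End X, IsNilpotent f ∨ IsIso (f : X ⟶ X)

namespace HasLocalEnd

variable {X Y : A}

theorem isIso_of_comp_eq_id (hX : HasLocalEnd X) {f g : X ⟶ X} (h : f ≫ g = 𝟙 X) :
    IsIso f ∧ IsIso g := by
  have key : ∀ n : ℕ, (End.of g : End X) * End.of f = 1 → (End.of g : End X) ^ n * End.of f ^ n = 1 :=
    fun n h => pow_mul_pow_eq_one n h
  have hne : (1 : End X) ≠ 0 := hX.id_ne
  constructor
  · rcases hX.nilpotent_or_isIso (End.of f) with ⟨n, hn⟩ | h'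
    · exact absurd ((key n h).symm.trans (by rw [hn, mul_zero])) hne
    · exact h'
  · rcases hX.nilpotent_or_isIso (End.of g) with ⟨n, hn⟩ | h'
    · exact absurd ((key n h).symm.trans (by rw [hn, zero_mul])) hne
    · exact h'

theorem isIso_of_isIso_comp (hX : HasLocalEnd X) {f g : X ⟶ X} (h : IsIso (f ≫ g)) :
    IsIso f ∧ IsIso g := by
  refine ⟨(hX.isIso_of_comp_eq_id (f := f) (g := g ≫ inv (f ≫ g)) ?_).1,
    (hX.isIso_of_comp_eq_id (f := inv (f ≫ g) ≫ f) (g := g) ?_).2⟩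
  · rw [← Category.assoc, IsIso.hom_inv_id]
  · rw [Category.assoc, IsIso.inv_hom_id]

/-- After normalising the sum to 𝟙 the two terms are x and 1 - x, and 1 - x is invertible when x is
nilpotent. -/
theorem isIso_of_isIso_add (hX : HasLocalEnd X) {f g : X ⟶ X} (h : IsIso (f + g)) :
    IsIso f ∨ IsIso g := by
  have e : f ≫ inv (f + g) + g ≫ inv (f + g) = 𝟙 X := by
    rw [← Preadditive.add_comp, IsIso.hom_inv_id]
  rcases hX.nilpotent_or_isIso (End.of (f ≫ inv (f + g))) with hn | hi
  · right
    have : IsUnit (1 - End.of (f ≫ inv (f + g)) : End X) := hn.isUnit_one_sub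
    have h2 : (1 - End.of (f ≫ inv (f + g)) : End X) = g ≫ inv (f + g) :=
      sub_eq_of_eq_add' e.symm
    rw [h2] at this
    exact (hX.isIso_of_isIso_comp ((isUnit_iff_isIso _).1 this)).1
  · left
    exact (hX.isIso_of_isIso_comp hi).1

theorem not_isIso_zero (hX : HasLocalEnd X) : ¬ IsIso (0 : X ⟶ X) := by
  intro h
  apply hX.id_ne
  rw [← IsIso.hom_inv_id (0 : X ⟶ X), zero_comp]

theorem exists_isIso_of_sum (hX : HasLocalEnd X) {ι : Type*} {s : Finset ι} {f : ι → (X ⟶ X)}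
    (h : IsIso (∑ t ∈ s, f t)) : ∃ t, IsIso (f t) := by
  classical
  induction s using Finset.induction_on with
  | empty => exact absurd h (by simpa using hX.not_isIso_zero)
  | insert a s ha ih =>
    rw [Finset.sum_insert ha] at h
    rcases hX.isIso_of_isIso_add h with h | h
    · exact ⟨a, h⟩
    · exact ih h

/-- `𝟙 - f` kills the nonzero `d`, so it is not invertible, and locality leaves only `f`. This is
what makes projective covers unique and tops simple. -/
theorem isIso_of_comp_eq (hX : HasLocalEnd X) {f : X ⟶ X} {d : X ⟶ Y} (hd : d ≠ 0)
    (h : f ≫ d = d) : IsIso f := by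
  have e : (f + (𝟙 X - f)) = 𝟙 X := by abel
  rcases hX.isIso_of_isIso_add (f := f) (g := 𝟙 X - f) (by rw [e]; infer_instance) with h' | h'
  · exact h'
  · refine absurd ?_ hd
    rw [← cancel_epi (𝟙 X - f), Preadditive.sub_comp, h]
    simp

/-- The idempotent `R.r ≫ R.i` of `Y` is nilpotent or invertible; a nilpotent idempotent is zero,
which would kill `X`. -/
theorem nonempty_iso_of_retract (hX : HasLocalEnd X) (hY : HasLocalEnd Y) (R : Retract X Y) :
    Nonempty (X ≅ Y) := by
  have hid : (R.r ≫ R.i) ≫ (R.r ≫ R.i) = R.r ≫ R.i := by simp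
  have hi : IsIso (R.r ≫ R.i) := by
    rcases hY.nilpotent_or_isIso (End.of (R.r ≫ R.i)) with ⟨n, hn⟩ | h
    · exfalso
      have hidem : IsIdempotentElem (End.of (R.r ≫ R.i) : End Y) := hid
      have h0 : (R.r ≫ R.i : Y ⟶ Y) = 0 := by
        have h1 : (End.of (R.r ≫ R.i) : End Y) ^ (n + 1) = End.of (R.r ≫ R.i) :=
          hidem.pow_succ_eq n
        rw [pow_succ, hn, zero_mul] at h1
        exact h1.symm
      apply hX.id_ne
      calc 𝟙 X = R.i ≫ (R.r ≫ R.i) ≫ R.r := by simp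
        _ = 0 := by rw [h0]; simp
    · exact h
  refine ⟨⟨R.i, R.r, R.retract, ?_⟩⟩
  rw [← cancel_epi (R.r ≫ R.i), hid, Category.comp_id]

theorem exists_retract_of_inAdd (hX : HasLocalEnd X) {P : A → Prop} (h : InAdd P X) :
    ∃ Y, P Y ∧ Nonempty (Retract X Y) := by
  obtain ⟨n, f, s, r, hf, hs⟩ := h
  obtain ⟨t, ht⟩ := hX.exists_isIso_of_sum (s := Finset.univ) (f := fun t => s t ≫ r t)
    (by rw [hs]; infer_instance)
  exact ⟨f t, hf t, nonempty_retract_of_isIso ht⟩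

theorem isIndec (hX : HasLocalEnd X) : IsIndec X := by
  refine ⟨fun h => hX.id_ne (h.eq_of_src _ _), ?_⟩
  rintro Y Z b ⟨hb⟩ ⟨e⟩
  have htot : b.fst ≫ b.inl + b.snd ≫ b.inr = 𝟙 b.pt := by
    apply hb.isLimit.hom_ext
    rintro ⟨⟨⟩⟩ <;> simp [BinaryBicone.toCone]
  have h1 : e.hom ≫ (b.fst ≫ b.inl) ≫ e.inv + e.hom ≫ (b.snd ≫ b.inr) ≫ e.inv = 𝟙 X := by
    rw [← Preadditive.comp_add, ← Preadditive.add_comp, htot]; simp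
  rcases hX.isIso_of_isIso_add (by rw [h1]; infer_instance) with h | h
  · right
    have h2 : IsIso (b.fst ≫ b.inl) := by
      have : b.fst ≫ b.inl = e.inv ≫ (e.hom ≫ (b.fst ≫ b.inl) ≫ e.inv) ≫ e.hom := by simp
      rw [this]; infer_instance
    have h3 : b.inr = 0 := by
      rw [← cancel_mono (b.fst ≫ b.inl)]; simp
    rw [IsZero.iff_id_eq_zero, ← b.inr_snd, h3, zero_comp]
  · left
    have h2 : IsIso (b.snd ≫ b.inr) := by
      have : b.snd ≫ b.inr = e.inv ≫ (e.hom ≫ (b.snd ≫ b.inr) ≫ e.inv) ≫ e.hom := by simp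
      rw [this]; infer_instance
    have h3 : b.inl = 0 := by
      rw [← cancel_mono (b.snd ≫ b.inr)]; simp
    rw [IsZero.iff_id_eq_zero, ← b.inl_fst, h3, zero_comp]

theorem of_iso (hX : HasLocalEnd X) (e : X ≅ Y) : HasLocalEnd Y where
  id_ne h := hX.id_ne (by
    calc 𝟙 X = e.hom ≫ 𝟙 Y ≫ e.inv := by simp
      _ = 0 := by rw [h]; simp)
  nilpotent_or_isIso f := by
    rcases hX.nilpotent_or_isIso (e.symm.conj f) with ⟨n, hn⟩ | h
    · left
      refine ⟨n, ?_⟩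
      rw [← Iso.conj_pow] at hn
      have := congrArg e.conj hn
      rw [← Iso.symm_self_conj e.symm (f ^ n), Iso.symm_symm_eq, hn]
      simp [Iso.conj_apply]
    · right
      have : (f : Y ⟶ Y) = e.inv ≫ (e.symm.conj f) ≫ e.hom := by simp [Iso.conj_apply]
      rw [this]; infer_instance

end HasLocalEnd

end Local

/-! ### Closure properties of `add`. -/

section InAdd

variable {A : Type u} [Category.{v} A] [Preadditive A]

theorem InAdd.of_fintype {P : A → Prop} {X : A} {ι : Type*} [Fintype ι] (f : ι → A)
    (s : ∀ t, X ⟶ f t) (r : ∀ t, f t ⟶ X) (hf : ∀ t, P (f t)) (h : ∑ t, s t ≫ r t = 𝟙 X) :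
    InAdd P X := by
  let e := (Fintype.equivFin ι).symm
  exact ⟨_, fun t => f (e t), fun t => s (e t), fun t => r (e t), fun t => hf _, by
    rw [← h, ← e.sum_comp (fun t => s t ≫ r t)]⟩

theorem InAdd.trans {P Q : A → Prop} {X : A} (h : InAdd P X) (hPQ : ∀ Y, P Y → InAdd Q Y) :
    InAdd Q X := by
  obtain ⟨n, f, s, r, hf, hs⟩ := h
  choose m g s' r' hg hs' using fun t => hPQ (f t) (hf t)
  refine InAdd.of_fintype (ι := Σ t, Fin (m t)) (fun x => g x.1 x.2) (fun x => s x.1 ≫ s' x.1 x.2)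
    (fun x => r' x.1 x.2 ≫ r x.1) (fun x => hg _ _) ?_
  rw [Fintype.sum_sigma, ← hs]
  refine Finset.sum_congr rfl fun t _ => ?_
  have : s t ≫ (∑ u, s' t u ≫ r' t u) ≫ r t = s t ≫ r t := by rw [hs']; simp
  rw [← this, Preadditive.sum_comp, Preadditive.comp_sum]
  simp

theorem InAdd.of_retract {P : A → Prop} {X Y : A} (h : InAdd P Y) (R : Retract X Y) :
    InAdd P X := by
  refine InAdd.trans (P := fun Z => Z = Y) ⟨1, fun _ => Y, fun _ => R.i, fun _ => R.r,
    fun _ => rfl, by simp⟩ ?_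
  rintro _ rfl
  exact h

theorem InAdd.map {A' : Type u'} [Category.{v'} A'] [Preadditive A'] (T : A ⥤ A') [T.Additive]
    {P : A → Prop} {Q : A' → Prop} {X : A} (h : InAdd P X) (hPQ : ∀ Y, P Y → Q (T.obj Y)) :
    InAdd Q (T.obj X) := by
  obtain ⟨n, f, s, r, hf, hs⟩ := h
  refine ⟨n, fun t => T.obj (f t), fun t => T.map (s t), fun t => T.map (r t),
    fun t => hPQ _ (hf t), ?_⟩
  have := congrArg T.map hs
  rw [T.map_sum, T.map_id] at this
  simpa using this

end InAdd

/-! ### Decomposition into indecomposables in finitary categories. -/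

section Finitary

variable {k : Type u₀} [Field k] {A : Type u} [Category.{v} A] [Preadditive A] [Linear k A]

/-- `X` is the direct sum of the objects `f t`, with injections `r t` and projections `s t`. -/
structure IsDirectSum {ι : Type*} [Fintype ι] (X : A) (f : ι → A) (s : ∀ t, X ⟶ f t)
    (r : ∀ t, f t ⟶ X) : Prop where
  total : ∑ t, s t ≫ r t = 𝟙 X
  inj_proj : ∀ t, r t ≫ s t = 𝟙 (f t)
  inj_proj_ne : ∀ t u, t ≠ u → r t ≫ s u = 0

theorem IsDirectSum.map {ι : Type*} [Fintype ι] {X : A} {f : ι → A} {s : ∀ t, X ⟶ f t}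
    {r : ∀ t, f t ⟶ X} (h : IsDirectSum X f s r) {A' : Type u'} [Category.{v'} A']
    [Preadditive A'] (T : A ⥤ A') [T.Additive] :
    IsDirectSum (T.obj X) (fun t => T.obj (f t)) (fun t => T.map (s t)) (fun t => T.map (r t)) where
  total := by
    have := congrArg T.map h.total
    rw [T.map_sum, T.map_id] at this
    simpa using this
  inj_proj t := by rw [← T.map_comp, h.inj_proj, T.map_id]
  inj_proj_ne t u htu := by rw [← T.map_comp, h.inj_proj_ne t u htu, T.map_zero]

theorem hasLocalEnd_of_idempotents (k : Type u₀) [Field k] [Linear k A] {X : A}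
    [Module.Finite k (X ⟶ X)] (h0 : 𝟙 X ≠ 0)
    (h : ∀ e : X ⟶ X, e ≫ e = e → e = 0 ∨ e = 𝟙 X) : HasLocalEnd X where
  id_ne := h0
  nilpotent_or_isIso f := by
    have : Module.Finite k (End X) := inferInstanceAs (Module.Finite k (X ⟶ X))
    rw [← isUnit_iff_isIso]
    exact isNilpotent_or_isUnit_of_idempotents (k := k) (A := End X) h f

theorem exists_complementary_splittings {A : Type u} [Category.{v} A] [Preadditive A]
    [IsIdempotentComplete A] {X : A} (e : X ⟶ X) (he : e ≫ e = e) :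
    ∃ (Y Z : A) (i : Y ⟶ X) (p : X ⟶ Y) (j : Z ⟶ X) (q : X ⟶ Z), i ≫ p = 𝟙 Y ∧ p ≫ i = e ∧
      j ≫ q = 𝟙 Z ∧ q ≫ j = 𝟙 X - e ∧ i ≫ q = 0 ∧ j ≫ p = 0 := by
  obtain ⟨Y, i, p, h1, h2⟩ := IsIdempotentComplete.idempotents_split X e he
  obtain ⟨Z, j, q, h3, h4⟩ := IsIdempotentComplete.idempotents_split X (𝟙 X - e)
    (by simp [he])
  have hij : i ≫ q = 0 := by
    have : IsSplitMono j := ⟨⟨⟨q, h3⟩⟩⟩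
    have : IsSplitEpi p := ⟨⟨⟨i, h1⟩⟩⟩
    rw [← cancel_mono j, ← cancel_epi p]
    simp only [Category.assoc, h4, zero_comp, comp_zero]
    rw [← Category.assoc, h2]; simp [he]
  have hji : j ≫ p = 0 := by
    have : IsSplitMono i := ⟨⟨⟨p, h1⟩⟩⟩
    have : IsSplitEpi q := ⟨⟨⟨j, h3⟩⟩⟩
    rw [← cancel_mono i, ← cancel_epi q]
    simp only [Category.assoc, h2, zero_comp, comp_zero]
    rw [← Category.assoc, h4]; simp [he]
  exact ⟨Y, Z, i, p, j, q, h1, h2, h3, h4, hij, hji⟩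

theorem IsIndec.eq_zero_or_eq_id [IsIdempotentComplete A] {X : A} (hX : IsIndec X) (e : X ⟶ X)
    (he : e ≫ e = e) : e = 0 ∨ e = 𝟙 X := by
  obtain ⟨Y, Z, i, r, j, q, h1, h2, h3, h4, hij, hji⟩ := exists_complementary_splittings e he
  let b : BinaryBicone Y Z :=
    { pt := X, fst := r, snd := q, inl := i, inr := j, inl_fst := h1, inl_snd := hij
      inr_fst := hji, inr_snd := h3 }
  rcases hX.2 Y Z b ⟨isBinaryBilimitOfTotal b (by simp [b, h2, h4])⟩ ⟨Iso.refl _⟩ with h | h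
  · left; rw [← h2, h.eq_of_tgt r 0, zero_comp]
  · right
    rw [h.eq_of_tgt q 0, zero_comp] at h4
    exact (sub_eq_zero.1 h4.symm).symm

theorem IsFinitaryCategory.hasLocalEnd (h : IsFinitaryCategory k A) {X : A} (hX : IsIndec X) :
    HasLocalEnd X := by
  have := h.finite_hom X X
  have := h.isIdempotentComplete
  exact hasLocalEnd_of_idempotents k (fun h0 => hX.1 ((IsZero.iff_id_eq_zero X).2 h0))
    hX.eq_zero_or_eq_id

/-- y ↦ r y i embeds End Y into End X, and 𝟙 is not in its image. This drives the induction that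
splits an object into indecomposables. -/
theorem finrank_end_lt {X Y : A} [Module.Finite k (X ⟶ X)] {i : Y ⟶ X} {r : X ⟶ Y}
    (h1 : i ≫ r = 𝟙 Y) (h2 : r ≫ i ≠ 𝟙 X) :
    Module.finrank k (Y ⟶ Y) < Module.finrank k (X ⟶ X) := by
  let φ : (Y ⟶ Y) →ₗ[k] (X ⟶ X) := Linear.leftComp k X r ∘ₗ Linear.rightComp k Y i
  have hφ : ∀ y, φ y = r ≫ y ≫ i := fun y => rfl
  have hinj : Function.Injective φ := fun y y' hy => by
    have := congrArg (fun x => i ≫ x ≫ r) hy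
    simpa [hφ, h1, reassoc_of% h1] using this
  rw [← LinearMap.finrank_range_of_inj hinj]
  refine Submodule.finrank_lt (fun htop => h2 ?_)
  obtain ⟨y, hy⟩ : 𝟙 X ∈ LinearMap.range φ := by rw [htop]; trivial
  rw [hφ] at hy
  calc r ≫ i = r ≫ i ≫ 𝟙 X := by simp
    _ = 𝟙 X := by rw [← hy]; simp [reassoc_of% h1]

theorem IsFinitaryCategory.exists_isDirectSum (h : IsFinitaryCategory k A) (X : A) :
    ∃ (ι : Type) (_ : Fintype ι) (f : ι → A) (s : ∀ t, X ⟶ f t) (r : ∀ t, f t ⟶ X),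
      IsDirectSum X f s r ∧ ∀ t, IsIndec (f t) := by
  have := h.isIdempotentComplete
  have := h.finite_hom
  induction hn : Module.finrank k (X ⟶ X) using Nat.strong_induction_on generalizing X with
  | _ n ih =>
    subst hn
    by_cases h0 : 𝟙 X = 0
    · exact ⟨Empty, inferInstance, Empty.elim, fun t => t.elim, fun t => t.elim,
        ⟨by simp [h0], fun t => t.elim, fun t => t.elim⟩, fun t => t.elim⟩
    by_cases hidem : ∀ e : X ⟶ X, e ≫ e = e → e = 0 ∨ e = 𝟙 X
    · exact ⟨Unit, inferInstance, fun _ => X, fun _ => 𝟙 X, fun _ => 𝟙 X,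
        ⟨by simp, fun t => by simp, fun t u htu => (htu rfl).elim⟩,
        fun _ => (hasLocalEnd_of_idempotents k h0 hidem).isIndec⟩
    push Not at hidem
    obtain ⟨e, he, he0, he1⟩ := hidem
    obtain ⟨Y, Z, i, p, j, q, h1, h2, h3, h4, hiq, hjp⟩ := exists_complementary_splittings e he
    obtain ⟨ι, _, f, s, r, hY, hf⟩ := ih _ (finrank_end_lt h1 (by rwa [h2])) Y rfl
    obtain ⟨κ, _, g, s', r', hZ, hg⟩ := ih _ (finrank_end_lt h3 (by rw [h4]; simpa using he0)) Z rfl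
    refine ⟨ι ⊕ κ, inferInstance, Sum.elim f g,
      Sum.rec (fun t => p ≫ s t) (fun t => q ≫ s' t),
      Sum.rec (fun t => r t ≫ i) (fun t => r' t ≫ j), ⟨?_, ?_, ?_⟩, ?_⟩
    · rw [Fintype.sum_sum_type]
      have e1 : ∑ t, (p ≫ s t) ≫ r t ≫ i = p ≫ (∑ t, s t ≫ r t) ≫ i := by
        rw [Preadditive.sum_comp, Preadditive.comp_sum]; simp
      have e2 : ∑ t, (q ≫ s' t) ≫ r' t ≫ j = q ≫ (∑ t, s' t ≫ r' t) ≫ j := by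
        rw [Preadditive.sum_comp, Preadditive.comp_sum]; simp
      refine (congrArg₂ (· + ·) e1 e2).trans ?_
      rw [hY.total, hZ.total]
      simp [h2, h4]
    · rintro (t | t)
      · simp [reassoc_of% h1, hY.inj_proj]
      · simp [reassoc_of% h3, hZ.inj_proj]
    · rintro (t | t) (u | u) htu
      · simp [reassoc_of% h1, hY.inj_proj_ne t u (fun h => htu (by rw [h]))]; rfl
      · simp [reassoc_of% hiq]; rfl
      · simp [reassoc_of% hjp]; rfl
      · simp [reassoc_of% h3, hZ.inj_proj_ne t u (fun h => htu (by rw [h]))]; rfl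
    · rintro (t | t)
      · exact hf t
      · exact hg t

theorem IsFinitaryCategory.inAdd_isIndec (h : IsFinitaryCategory k A) (X : A) :
    InAdd (IsIndec : A → Prop) X := by
  obtain ⟨ι, _, f, s, r, hX, hf⟩ := h.exists_isDirectSum X
  exact InAdd.of_fintype f s r hf hX.total

end Finitary

/-! ### Multiplicities of indecomposable summands. -/

section Multiplicity

variable (k : Type u₀) [Field k] {A : Type u} [Category.{v} A] [Preadditive A] [Linear k A]

/-- The span of the non-invertible endomorphisms. -/
def radEnd (F : A) : Submodule k (F ⟶ F) := Submodule.span k {f | ¬ IsIso f}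

/-- The morphisms `F ⟶ Y` all of whose composites with morphisms `Y ⟶ F` lie in `radEnd k F`. -/
def radHom (F Y : A) : Submodule k (F ⟶ Y) :=
  ⨅ g : Y ⟶ F, (radEnd k F).comap (Linear.rightComp k F g)

/-- The multiplicity of `F` as a direct summand of `Y`. -/
noncomputable def mult (F Y : A) : ℝ :=
  Module.finrank k ((F ⟶ Y) ⧸ radHom k F Y) / Module.finrank k ((F ⟶ F) ⧸ radHom k F F)

variable {k}

theorem mem_radEnd {F : A} (hF : HasLocalEnd F) {f : F ⟶ F} : f ∈ radEnd k F ↔ ¬ IsIso f := by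
  refine ⟨fun h => ?_, fun h => Submodule.subset_span h⟩
  induction h using Submodule.span_induction with
  | mem f hf => exact hf
  | zero => exact hF.not_isIso_zero
  | add f g _ _ hf hg => exact fun h => (hF.isIso_of_isIso_add h).elim hf hg
  | smul c f _ hf =>
    intro h
    have e : c • f = f ≫ (c • 𝟙 F) := by simp
    rw [e] at h
    exact hf (hF.isIso_of_isIso_comp h).1

theorem mem_radHom {F Y : A} {h : F ⟶ Y} :
    h ∈ radHom k F Y ↔ ∀ g : Y ⟶ F, h ≫ g ∈ radEnd k F := by
  simp [radHom, Submodule.mem_iInf]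

theorem mult_nonneg (F Y : A) : 0 ≤ mult k F Y := by
  unfold mult; positivity

/-- `radHom` is compatible with direct sums in its second argument, so Hom(F, -) modulo `radHom`
turns direct sums into products. -/
theorem mult_eq_sum {F X : A} {ι : Type*} [Fintype ι] {f : ι → A} {s : ∀ t, X ⟶ f t}
    {r : ∀ t, f t ⟶ X} (h : IsDirectSum X f s r) [∀ Y : A, Module.Finite k (F ⟶ Y)] :
    mult k F X = ∑ t, mult k F (f t) := by
  classical
  let e : (F ⟶ X) ≃ₗ[k] (∀ t, F ⟶ f t) :=
    { toFun := fun x t => x ≫ s t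
      map_add' := fun x y => by ext t; simp
      map_smul' := fun c x => by ext t; simp
      invFun := fun x => ∑ t, x t ≫ r t
      left_inv := fun x => by
        simp only [Category.assoc]
        rw [← Preadditive.comp_sum, h.total, Category.comp_id]
      right_inv := fun x => by
        ext t
        simp only [Preadditive.sum_comp, Category.assoc]
        rw [Finset.sum_eq_single t]
        · rw [h.inj_proj, Category.comp_id]
        · intro u _ hut; rw [h.inj_proj_ne u t hut, comp_zero]
        · simp }
  have hmap : (radHom k F X).map (e : (F ⟶ X) →ₗ[k] (∀ t, F ⟶ f t)) =
      Submodule.pi Set.univ (fun t => radHom k F (f t)) := by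
    ext x
    constructor
    · rintro ⟨y, hy, rfl⟩ t -
      refine mem_radHom.2 fun g => ?_
      have := mem_radHom.1 hy (s t ≫ g)
      rwa [← Category.assoc] at this
    · intro hx
      refine ⟨e.symm x, mem_radHom.2 fun g => ?_, e.apply_symm_apply x⟩
      have : e.symm x ≫ g = ∑ t, x t ≫ (r t ≫ g) := by
        change (∑ t, x t ≫ r t) ≫ g = _
        rw [Preadditive.sum_comp]; simp
      rw [this]
      exact Submodule.sum_mem _ fun t _ => mem_radHom.1 (hx t trivial) _
  have hfin : Module.finrank k ((F ⟶ X) ⧸ radHom k F X) =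
      ∑ t, Module.finrank k ((F ⟶ f t) ⧸ radHom k F (f t)) := by
    rw [(Submodule.Quotient.equiv _ _ e hmap).finrank_eq,
      (Submodule.quotientPi (fun t => radHom k F (f t))).finrank_eq, Module.finrank_pi_fintype]
  rw [mult, hfin, Nat.cast_sum, Finset.sum_div]
  rfl

theorem mult_congr {F X Y : A} [∀ Y : A, Module.Finite k (F ⟶ Y)] (e : X ≅ Y) :
    mult k F X = mult k F Y := by
  have : IsDirectSum X (fun _ : Unit => Y) (fun _ => e.hom) (fun _ => e.inv) :=
    ⟨by simp, fun _ => by simp, fun _ _ h => (h rfl).elim⟩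
  rw [mult_eq_sum (k := k) (F := F) this]
  simp

/-- A morphism `F ⟶ Y` lies outside `radHom` exactly when some composite `F ⟶ Y ⟶ F` is invertible.
-/
theorem mult_pos_iff {F Y : A} (hF : HasLocalEnd F) [∀ Y : A, Module.Finite k (F ⟶ Y)] :
    0 < mult k F Y ↔ Nonempty (Retract F Y) := by
  have key : ∀ Z : A, 0 < Module.finrank k ((F ⟶ Z) ⧸ radHom k F Z) ↔ Nonempty (Retract F Z) := by
    intro Z
    rw [Module.finrank_pos_iff, Submodule.Quotient.nontrivial_iff, ne_eq, Submodule.eq_top_iff']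
    push Not
    constructor
    · rintro ⟨x, hx⟩
      rw [mem_radHom] at hx
      push Not at hx
      obtain ⟨g, hg⟩ := hx
      rw [mem_radEnd hF, not_not] at hg
      exact nonempty_retract_of_isIso hg
    · rintro ⟨R⟩
      refine ⟨R.i, fun h => (mem_radEnd hF).1 (mem_radHom.1 h R.r) ?_⟩
      rw [R.retract]; infer_instance
  have hFF := (key F).2 ⟨Retract.refl F⟩
  rw [← key Y, mult, div_pos_iff_of_pos_right (by exact_mod_cast hFF)]
  exact_mod_cast Iff.rfl

/-- The denominator of `mult` is the dimension of the residue division algebra of End F, so this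
normalisation holds whatever that algebra is. -/
theorem mult_self {F : A} (hF : HasLocalEnd F) [∀ Y : A, Module.Finite k (F ⟶ Y)] :
    mult k F F = 1 := by
  have h := (mult_pos_iff (k := k) hF).2 ⟨Retract.refl F⟩
  rw [mult] at h ⊢
  exact div_self fun h0 => by rw [h0] at h; simp at h

theorem mult_eq_zero {F Y : A} (hF : HasLocalEnd F) (hY : HasLocalEnd Y)
    [∀ Y : A, Module.Finite k (F ⟶ Y)] (h : IsEmpty (F ≅ Y)) : mult k F Y = 0 := by
  by_contra h0
  obtain ⟨R⟩ := (mult_pos_iff (k := k) hF).1 (lt_of_le_of_ne (mult_nonneg F Y) (Ne.symm h0))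
  exact (not_nonempty_iff.2 h) (hF.nonempty_iso_of_retract hY R)

/-- The isomorphism classes of indecomposable objects. -/
def IndecClass (A : Type u) [Category.{v} A] [Preadditive A] : Type u :=
  {c : Quotient (isIsomorphicSetoid A) // IsIndec c.out}

noncomputable def IndecClass.rep (c : IndecClass A) : A := c.1.out

theorem IndecClass.isIndec (c : IndecClass A) : IsIndec c.rep := c.2

theorem IndecClass.eq_of_iso {c c' : IndecClass A} (h : Nonempty (c.rep ≅ c'.rep)) : c = c' := by
  refine Subtype.ext ?_
  rw [← Quotient.out_eq c.1, ← Quotient.out_eq c'.1]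
  exact Quotient.sound h

theorem IsIndec.of_iso (h : IsFinitaryCategory k A) {X Y : A} (hX : IsIndec X) (e : X ≅ Y) :
    IsIndec Y :=
  ((h.hasLocalEnd hX).of_iso e).isIndec

theorem IsFinitaryCategory.exists_indecClass (h : IsFinitaryCategory k A) {X : A}
    (hX : IsIndec X) : ∃ c : IndecClass A, Nonempty (X ≅ c.rep) := by
  have e : Nonempty (X ≅ (Quotient.mk (isIsomorphicSetoid A) X).out) :=
    (isIsomorphicSetoid A).symm (Quotient.mk_out (s := isIsomorphicSetoid A) X)
  exact ⟨⟨_, hX.of_iso h e.some⟩, e⟩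

theorem IsFinitaryCategory.finite_indecClass (h : IsFinitaryCategory k A) :
    Finite (IndecClass A) := by
  obtain ⟨n, f, hf⟩ := h.finite_indec
  choose φ hφ using fun c : IndecClass A => hf c.rep c.isIndec
  refine Finite.of_injective φ fun c c' hcc => IndecClass.eq_of_iso ?_
  exact ⟨(hφ c).some ≪≫ (eqToIso (by rw [hcc])) ≪≫ (hφ c').some.symm⟩

/-- Sorting the indecomposable summands of `Y` by isomorphism class gives a matrix product formula.
Later it makes composition of 1-morphisms correspond to multiplication of multiplicity matrices. -/
theorem mult_map (h : IsFinitaryCategory k A) {A' : Type u'} [Category.{v'} A'] [Preadditive A']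
    [Linear k A'] (h' : IsFinitaryCategory k A') (T : A ⥤ A') [T.Additive]
    [Fintype (IndecClass A)] (G : A') (Y : A) :
    mult k G (T.obj Y) = ∑ c : IndecClass A, mult k c.rep Y * mult k G (T.obj c.rep) := by
  classical
  have := h.finite_hom
  have := h'.finite_hom
  obtain ⟨ι, _, f, s, r, hY, hf⟩ := h.exists_isDirectSum Y
  rw [mult_eq_sum (hY.map T)]
  simp_rw [mult_eq_sum hY, Finset.sum_mul]
  rw [Finset.sum_comm]
  refine Finset.sum_congr rfl fun t _ => ?_
  obtain ⟨c, ⟨e⟩⟩ := h.exists_indecClass (hf t)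
  rw [Finset.sum_eq_single c]
  · rw [mult_congr (k := k) (F := c.rep) e, mult_self (h.hasLocalEnd c.isIndec), one_mul,
      mult_congr (T.mapIso e)]
  · intro c' _ hc
    rw [mult_eq_zero (h.hasLocalEnd c'.isIndec) (h.hasLocalEnd (hf t)), zero_mul]
    exact ⟨fun e' => hc (IndecClass.eq_of_iso ⟨e' ≪≫ e⟩)⟩
  · simp

end Multiplicity

/-! ### Perron–Frobenius theory for commuting nonnegative matrices. -/

section Matrices

open Matrix

/-- Perron-Frobenius for a nonnegative matrix that commutes with a positive one. -/
theorem exists_pos_eigenvector {I : Type*} [Fintype I] [Nonempty I] {M P : Matrix I I ℝ}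
    (hM : ∀ i j, 0 ≤ M i j) (hP : ∀ i j, 0 < P i j) (hMP : M * P = P * M) :
    ∃ (v : I → ℝ) (c : ℝ), (∀ i, 0 < v i) ∧ M *ᵥ v = c • v := by
  classical
  have hPpos : ∀ x : I → ℝ, (∀ i, 0 ≤ x i) → x ≠ 0 → ∀ i, 0 < (P *ᵥ x) i := by
    intro x hx hx0 i
    obtain ⟨j, hj⟩ := Function.ne_iff.1 hx0
    exact Finset.sum_pos' (fun j _ => mul_nonneg (hP i j).le (hx j))
      ⟨j, Finset.mem_univ j, mul_pos (hP i j) (lt_of_le_of_ne (hx j) (Ne.symm hj))⟩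
  set C : ℝ := ∑ i, ∑ j, M i j
  have hC : 0 ≤ C := Finset.sum_nonneg fun i _ => Finset.sum_nonneg fun j _ => hM i j
  -- Pairs (x, c) with x in the simplex and M x ≤ c x entrywise, on which c is minimised. Bounding c
  -- by the sum `C` of all entries makes the set compact and leaves it nonempty.
  let T : Set ((I → ℝ) × ℝ) :=
    (stdSimplex ℝ I ×ˢ Set.Icc 0 C) ∩ {p | ∀ i, (M *ᵥ p.1) i ≤ p.2 * p.1 i}
  have hcont : ∀ i, Continuous fun p : (I → ℝ) × ℝ => (M *ᵥ p.1) i := by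
    intro i
    simp only [mulVec, dotProduct]
    fun_prop
  have hT : IsCompact T := by
    refine ((isCompact_stdSimplex ℝ I).prod isCompact_Icc).inter_right ?_
    rw [Set.ofPred_forall]
    exact isClosed_iInter fun i => isClosed_le (hcont i) (by fun_prop)
  have hcard : (0 : ℝ) < Fintype.card I := by exact_mod_cast Fintype.card_pos
  have hne : T.Nonempty := by
    refine ⟨(fun _ => (Fintype.card I : ℝ)⁻¹, C), ⟨⟨fun i => by positivity, by simp⟩, hC, le_rfl⟩, ?_⟩
    intro i
    simp only [mulVec, dotProduct]
    rw [← Finset.sum_mul]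
    refine mul_le_mul_of_nonneg_right ?_ (by positivity)
    exact Finset.single_le_sum (f := fun i => ∑ j, M i j)
      (fun i _ => Finset.sum_nonneg fun j _ => hM i j) (Finset.mem_univ i)
  obtain ⟨⟨x, c⟩, ⟨⟨hx, hc⟩, hxc⟩, hmin⟩ := hT.exists_isMinOn hne continuous_snd.continuousOn
  simp only [Set.mem_ofPred_eq] at hx hc hxc
  have hx0 : x ≠ 0 := by
    rintro rfl
    have := hx.2
    simp at this
  have hw := hPpos x hx.1 hx0
  set w := P *ᵥ x
  refine ⟨w, c, hw, ?_⟩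
  -- Otherwise P (c x - M x) is strictly positive, so M w < c w in every coordinate for w = P x, and
  -- the rescaled w admits a constant smaller than the minimal c.
  have hy : M *ᵥ x = c • x := by
    by_contra hne'
    have hpos := hPpos (c • x - M *ᵥ x) (fun i => sub_nonneg.2 (hxc i))
      (fun h0 => hne' (sub_eq_zero.1 h0).symm)
    have hlt : ∀ i, (M *ᵥ w) i < c * w i := by
      intro i
      have h1 := hpos i
      rw [mulVec_sub, mulVec_smul, mulVec_mulVec, ← hMP, ← mulVec_mulVec] at h1
      exact sub_pos.1 h1
    obtain ⟨i₀, -, hi₀⟩ := Finset.exists_max_image Finset.univ (fun i => (M *ᵥ w) i / w i)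
      Finset.univ_nonempty
    set c' := (M *ᵥ w) i₀ / w i₀
    have hc' : c' < c := (div_lt_iff₀ (hw i₀)).2 (hlt i₀)
    have hc'0 : 0 ≤ c' :=
      div_nonneg (Finset.sum_nonneg fun j _ => mul_nonneg (hM _ j) (hw j).le) (hw i₀).le
    have hsum : 0 < ∑ i, w i := Finset.sum_pos (fun i _ => hw i) Finset.univ_nonempty
    have hmem : ((∑ i, w i)⁻¹ • w, c') ∈ T := by
      refine ⟨⟨⟨fun i => ?_, ?_⟩, hc'0, hc'.le.trans hc.2⟩, fun i => ?_⟩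
      · exact mul_nonneg (inv_nonneg.2 hsum.le) (hw i).le
      · simp only [Pi.smul_apply, smul_eq_mul]
        rw [← Finset.mul_sum, inv_mul_cancel₀ hsum.ne']
      · simp only [mulVec_smul, Pi.smul_apply, smul_eq_mul]
        have h2 : (M *ᵥ w) i ≤ c' * w i := (div_le_iff₀ (hw i)).1 (hi₀ i (Finset.mem_univ i))
        calc (∑ i, w i)⁻¹ * (M *ᵥ w) i ≤ (∑ i, w i)⁻¹ * (c' * w i) :=
              mul_le_mul_of_nonneg_left h2 (inv_nonneg.2 hsum.le)
          _ = c' * ((∑ i, w i)⁻¹ * w i) := by ring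
    exact absurd (hmin hmem) (not_le.2 hc')
  calc M *ᵥ w = P *ᵥ (M *ᵥ x) := by rw [mulVec_mulVec, hMP, ← mulVec_mulVec]
    _ = c • w := by rw [hy, mulVec_smul]

/-- A nonnegative matrix that commutes with a positive one is block diagonal as soon as it is block
triangular. -/
theorem eq_zero_of_commute_pos {I : Type*} [Fintype I] {M P : Matrix I I ℝ}
    (hM : ∀ i j, 0 ≤ M i j) (hP : ∀ i j, 0 < P i j) (hMP : M * P = P * M) (U : Set I)
    (hU : ∀ f ∈ U, ∀ g, 0 < M g f → g ∈ U) {g f : I} (hg : g ∈ U) (hf : f ∉ U) : M g f = 0 := by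
  classical
  have : Nonempty I := ⟨g⟩
  obtain ⟨v, c, hv, hMv⟩ := exists_pos_eigenvector hM hP hMP
  obtain ⟨w, c', hw, hMw⟩ := exists_pos_eigenvector (M := Mᵀ) (P := Pᵀ) (fun i j => hM j i)
    (fun i j => hP j i) (by rw [← transpose_mul, ← transpose_mul, hMP])
  rw [mulVec_transpose] at hMw
  have hcc : c' = c := by
    have h1 : w ⬝ᵥ M *ᵥ v = c * (w ⬝ᵥ v) := by rw [hMv, dotProduct_smul, smul_eq_mul]
    have h2 : w ⬝ᵥ M *ᵥ v = c' * (w ⬝ᵥ v) := by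
      rw [dotProduct_mulVec, hMw, smul_dotProduct, smul_eq_mul]
    have h3 : 0 < w ⬝ᵥ v := Finset.sum_pos (fun i _ => mul_pos (hw i) (hv i)) Finset.univ_nonempty
    exact mul_right_cancel₀ h3.ne' (h2.symm.trans h1)
  subst hcc
  set s : Finset I := Finset.univ.filter (· ∈ U)
  have hrow : ∀ i, ∑ j, M i j * v j = c' * v i := fun i => congrFun hMv i
  have hcol : ∀ j, ∑ i, w i * M i j = c' * w j := fun j => congrFun hMw j
  -- Columns with index in `U` vanish in the rows outside `U`. So the sum of w_i M_ij v_j over U × U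
  -- already equals the sum over U × I, and nothing is left for the nonnegative terms over U × Uᶜ.
  have e1 : ∑ i ∈ s, ∑ j, w i * M i j * v j = ∑ i ∈ s, c' * (w i * v i) := by
    refine Finset.sum_congr rfl fun i _ => ?_
    simp_rw [mul_assoc, ← Finset.mul_sum, hrow]
    ring
  have e2 : ∑ i ∈ s, ∑ j ∈ s, w i * M i j * v j = ∑ i ∈ s, c' * (w i * v i) := by
    rw [Finset.sum_comm]
    refine Finset.sum_congr rfl fun j hj => ?_
    rw [← Finset.sum_mul]
    have : ∑ i ∈ s, w i * M i j = ∑ i, w i * M i j := by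
      refine Finset.sum_subset (Finset.subset_univ _) fun i _ hi => ?_
      have : M i j = 0 := by
        by_contra h0
        exact hi (Finset.mem_filter.2 ⟨Finset.mem_univ _, hU j (Finset.mem_filter.1 hj).2 i
          (lt_of_le_of_ne (hM i j) (Ne.symm h0))⟩)
      rw [this, mul_zero]
    rw [this, hcol]; ring
  have e3 : ∑ i ∈ s, ∑ j ∈ sᶜ, w i * M i j * v j = 0 := by
    have : ∀ i, ∑ j, w i * M i j * v j =
        ∑ j ∈ s, w i * M i j * v j + ∑ j ∈ sᶜ, w i * M i j * v j :=
      fun i => (Finset.sum_add_sum_compl s _).symm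
    simp_rw [this, Finset.sum_add_distrib, e2] at e1
    linarith
  have hnn : ∀ i j, 0 ≤ w i * M i j * v j := fun i j =>
    mul_nonneg (mul_nonneg (hw i).le (hM i j)) (hv j).le
  have e4 := (Finset.sum_eq_zero_iff_of_nonneg fun i _ => Finset.sum_nonneg fun j _ => hnn i j).1 e3
    g (Finset.mem_filter.2 ⟨Finset.mem_univ _, hg⟩)
  have e5 := (Finset.sum_eq_zero_iff_of_nonneg fun j _ => hnn g j).1 e4 f
    (Finset.mem_compl.2 fun h => hf (Finset.mem_filter.1 h).2)
  simpa [(hw g).ne', (hv f).ne'] using e5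

end Matrices

/-! ### Calculus of the left preorder. -/

section Orders

variable {B : Type u} [Bicategory.{w, v} B]

theorem LeftLE.refl {a b : B} (F : a ⟶ b) : LeftLE F F :=
  ⟨𝟙 b, ⟨Retract.ofIso (ρ_ F).symm⟩⟩

theorem LeftLE.of_retract {a b c : B} {F : a ⟶ b} {G G' : a ⟶ c} (h : LeftLE F G)
    (R : Retract G' G) : LeftLE F G' := by
  obtain ⟨H, ⟨R'⟩⟩ := h
  exact ⟨H, ⟨R.trans R'⟩⟩

theorem LeftLE.trans {a b c d : B} {E : a ⟶ b} {F : a ⟶ c} {G : a ⟶ d} (h : LeftLE E F)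
    (h' : LeftLE F G) : LeftLE E G := by
  obtain ⟨H, ⟨R⟩⟩ := h
  obtain ⟨K, ⟨R'⟩⟩ := h'
  exact ⟨H ≫ K, ⟨R'.trans ((R.map ((postcomposing _ _ _).obj K)).trans (Retract.ofIso (α_ E H K)))⟩⟩

theorem LeftLE.congr_left {a b c : B} {F F' : a ⟶ b} {G : a ⟶ c} (h : LeftLE F G) (e : F ≅ F') :
    LeftLE F' G := by
  obtain ⟨H, ⟨R⟩⟩ := h
  exact ⟨H, ⟨R.trans (Retract.ofIso (whiskerRightIso e H))⟩⟩

end Orders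

/-! ### Symmetry of the left preorder inside a two-sided cell. -/

section Stability

variable {k : Type u₀} [Field k] {B : Type u} [Bicategory.{w, v} B]
  [∀ a b : B, Preadditive (a ⟶ b)] [∀ a b : B, Linear k (a ⟶ b)]

theorem precomposing_additive (k : Type u₀) [Field k] {B : Type u} [Bicategory.{w, v} B]
    [∀ a b : B, Preadditive (a ⟶ b)] [∀ a b : B, Linear k (a ⟶ b)] [LinearTwoCategory k B]
    {a b : B} (F : a ⟶ b) (c : B) : ((precomposing a b c).obj F).Additive where
  map_add := LinearTwoCategory.whiskerLeft_add k F _ _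

theorem postcomposing_additive (k : Type u₀) [Field k] {B : Type u} [Bicategory.{w, v} B]
    [∀ a b : B, Preadditive (a ⟶ b)] [∀ a b : B, Linear k (a ⟶ b)] [LinearTwoCategory k B]
    (a : B) {b c : B} (F : b ⟶ c) : ((postcomposing a b c).obj F).Additive where
  map_add := LinearTwoCategory.add_whiskerRight k _ _ F

/-- Lets the factors `H`, `K` in the cell preorders be taken among finitely many indecomposables, so
that the preorders can be read off finite sums of multiplicities. -/
theorem IsFinitaryCategory.exists_indecClass_retract {A : Type u} [Category.{v} A] [Preadditive A]
    [Linear k A] (h : IsFinitaryCategory k A) {A' : Type u'} [Category.{v'} A'] [Preadditive A']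
    (T : A ⥤ A') [T.Additive] {G : A'} (hG : HasLocalEnd G) {K : A} (R : Retract G (T.obj K)) :
    ∃ c : IndecClass A, Nonempty (Retract G (T.obj c.rep)) := by
  have h1 : InAdd (fun X => ∃ c : IndecClass A, Nonempty (X ≅ T.obj c.rep)) (T.obj K) :=
    (h.inAdd_isIndec K).map T fun Y hY => by
      obtain ⟨c, ⟨e⟩⟩ := h.exists_indecClass hY
      exact ⟨c, ⟨T.mapIso e⟩⟩
  obtain ⟨Y, ⟨c, ⟨e⟩⟩, ⟨R'⟩⟩ := hG.exists_retract_of_inAdd (h1.of_retract R)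
  exact ⟨c, ⟨R'.trans (Retract.ofIso e)⟩⟩

theorem TwoSidedCell.indec {J : TwoSidedCell B} {a b : B} {F : a ⟶ b} (h : J.mem F) :
    IsIndec F := by
  obtain ⟨_, _, E, -, hJ⟩ := J.isCell
  exact ((hJ F).1 h).1

theorem TwoSidedCell.twoSidedLE {J : TwoSidedCell B} {a b c d : B} {F : a ⟶ b} {G : c ⟶ d}
    (hF : J.mem F) (hG : J.mem G) : TwoSidedLE F G := by
  obtain ⟨_, _, E, -, hJ⟩ := J.isCell
  exact ((hJ F).1 hF).2.2.trans ((hJ G).1 hG).2.1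

theorem TwoSidedCell.mem_of_le {J : TwoSidedCell B} {a b c d e f : B} {F : a ⟶ b} {G : c ⟶ d}
    {H : e ⟶ f} (hF : J.mem F) (hH : J.mem H) (hG : IsIndec G) (h₁ : TwoSidedLE F G)
    (h₂ : TwoSidedLE G H) : J.mem G := by
  obtain ⟨_, _, E, -, hJ⟩ := J.isCell
  exact (hJ G).2 ⟨hG, ((hJ F).1 hF).2.1.trans h₁, h₂.trans ((hJ H).1 hH).2.2⟩

theorem TwoSidedCell.mem_congr (hB : IsFinitaryTwoCategory k B) {J : TwoSidedCell B} {a b : B}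
    {F F' : a ⟶ b} (h : J.mem F) (e : F ≅ F') : J.mem F' :=
  J.mem_of_le h h ((J.indec h).of_iso (hB.finitary_hom a b) e)
    (LeftLE.twoSidedLE ((LeftLE.refl F).of_retract (Retract.ofIso e.symm)))
    (LeftLE.twoSidedLE ((LeftLE.refl F).congr_left e))

variable [LinearTwoCategory k B]

/-- In a two-sided cell of a finitary 2-category the left preorder is symmetric. -/
theorem TwoSidedCell.leftLE_symm (hB : IsFinitaryTwoCategory k B) {J : TwoSidedCell B} {a b c : B}
    {F : a ⟶ b} {G : a ⟶ c} (hF : J.mem F) (hG : J.mem G) (hFG : LeftLE F G) : LeftLE G F := by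
  classical
  have := hB.finite_obj
  have := Fintype.ofFinite B
  have hfin : ∀ x y : B, Finite (IndecClass (x ⟶ y)) := fun x y =>
    (hB.finitary_hom x y).finite_indecClass
  have hft : ∀ x y : B, Fintype (IndecClass (x ⟶ y)) := fun x y => Fintype.ofFinite _
  have hhom : ∀ (x y : B) (X Y : x ⟶ y), Module.Finite k (X ⟶ Y) :=
    fun x y => (hB.finitary_hom x y).finite_hom
  have hpre := @precomposing_additive k _ B _ _ _ _
  have hpost := @postcomposing_additive k _ B _ _ _ _
  let X := Σ x : B, IndecClass (a ⟶ x)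
  -- `M` encodes multiplication HF and `P` multiplication HFZ. Their positive entries are exactly
  -- the relations ≤_L and ≤_J.
  let M : Matrix X X ℝ := fun g f => ∑ H : IndecClass (f.1 ⟶ g.1), mult k g.2.rep (f.2.rep ≫ H.rep)
  let P : Matrix X X ℝ := fun g f => ∑ Z : IndecClass (a ⟶ a), ∑ H : IndecClass (f.1 ⟶ g.1),
    mult k g.2.rep (Z.rep ≫ f.2.rep ≫ H.rep)
  have hloc : ∀ x : X, HasLocalEnd x.2.rep := fun x => (hB.finitary_hom _ _).hasLocalEnd x.2.isIndec
  have hM0 : ∀ g f, 0 ≤ M g f := fun g f => Finset.sum_nonneg fun _ _ => mult_nonneg _ _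
  have hP0 : ∀ g f, 0 ≤ P g f := fun g f =>
    Finset.sum_nonneg fun _ _ => Finset.sum_nonneg fun _ _ => mult_nonneg _ _
  have hMpos : ∀ g f : X, 0 < M g f ↔ LeftLE f.2.rep g.2.rep := by
    intro g f
    constructor
    · intro h
      obtain ⟨H, -, hH⟩ := Finset.exists_lt_of_sum_lt (s := Finset.univ) (f := fun _ => (0 : ℝ))
        (by simpa using h)
      exact ⟨H.rep, (mult_pos_iff (hloc g)).1 hH⟩
    · rintro ⟨K, ⟨R⟩⟩
      obtain ⟨H, hH⟩ := (hB.finitary_hom f.1 g.1).exists_indecClass_retract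
        ((precomposing _ _ _).obj f.2.rep) (hloc g) R
      exact Finset.sum_pos' (fun _ _ => mult_nonneg _ _)
        ⟨H, Finset.mem_univ _, (mult_pos_iff (hloc g)).2 hH⟩
  have hPpos : ∀ g f : X, 0 < P g f ↔ TwoSidedLE f.2.rep g.2.rep := by
    intro g f
    constructor
    · intro h
      obtain ⟨Z, -, hZ⟩ := Finset.exists_lt_of_sum_lt (s := Finset.univ) (f := fun _ => (0 : ℝ))
        (by simpa using h)
      obtain ⟨H, -, hH⟩ := Finset.exists_lt_of_sum_lt (s := Finset.univ) (f := fun _ => (0 : ℝ))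
        (by simpa using hZ)
      exact ⟨Z.rep, H.rep, (mult_pos_iff (hloc g)).1 hH⟩
    · rintro ⟨K, L, ⟨R⟩⟩
      obtain ⟨Z, ⟨R'⟩⟩ := (hB.finitary_hom a a).exists_indecClass_retract
        ((postcomposing _ _ _).obj (f.2.rep ≫ L)) (hloc g) R
      obtain ⟨H, hH⟩ := (hB.finitary_hom f.1 g.1).exists_indecClass_retract
        ((precomposing _ _ _).obj f.2.rep ⋙ (precomposing _ _ _).obj Z.rep) (hloc g) R'
      exact Finset.sum_pos' (fun _ _ => Finset.sum_nonneg fun _ _ => mult_nonneg _ _)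
        ⟨Z, Finset.mem_univ _, Finset.sum_pos' (fun _ _ => mult_nonneg _ _)
          ⟨H, Finset.mem_univ _, (mult_pos_iff (hloc g)).2 hH⟩⟩
  -- Both M * P and P * M count `g` in the products Z ≫ e ≫ H' ≫ H, so the two matrices commute by
  -- associativity.
  let N : X → X → ℝ := fun g e => ∑ c : B, ∑ Z : IndecClass (a ⟶ a),
    ∑ H' : IndecClass (e.1 ⟶ c), ∑ H : IndecClass (c ⟶ g.1),
      mult k g.2.rep (Z.rep ≫ (e.2.rep ≫ H'.rep) ≫ H.rep)
  have hMP : ∀ g e, ∑ x, M g x * P x e = N g e := by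
    intro g e
    rw [Fintype.sum_sigma]
    refine Finset.sum_congr rfl fun c _ => ?_
    have h1 : ∀ (Z : IndecClass (a ⟶ a)) (H' : IndecClass (e.1 ⟶ c)) (H : IndecClass (c ⟶ g.1)),
        mult k g.2.rep (Z.rep ≫ (e.2.rep ≫ H'.rep) ≫ H.rep) = ∑ f : IndecClass (a ⟶ c),
          mult k f.rep (Z.rep ≫ e.2.rep ≫ H'.rep) * mult k g.2.rep (f.rep ≫ H.rep) := by
      intro Z H' H
      rw [mult_congr (k := k) (F := g.2.rep) (α_ Z.rep (e.2.rep ≫ H'.rep) H.rep).symm]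
      exact mult_map (hB.finitary_hom a c) (hB.finitary_hom a g.1)
        ((postcomposing _ _ _).obj H.rep) _ _
    simp_rw [h1]
    refine (Finset.sum_congr rfl fun f _ => ?_).trans (Finset.sum_comm.trans
      (Finset.sum_congr rfl fun Z _ => Finset.sum_comm.trans
        (Finset.sum_congr rfl fun H' _ => Finset.sum_comm)))
    rw [mul_comm, Finset.sum_mul]
    exact Finset.sum_congr rfl fun Z _ => Finset.sum_mul_sum _ _ _ _
  have hPM : ∀ g e, ∑ x, P g x * M x e = N g e := by
    intro g e
    rw [Fintype.sum_sigma]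
    refine Finset.sum_congr rfl fun c _ => ?_
    have h1 : ∀ (Z : IndecClass (a ⟶ a)) (H' : IndecClass (e.1 ⟶ c)) (H : IndecClass (c ⟶ g.1)),
        mult k g.2.rep (Z.rep ≫ (e.2.rep ≫ H'.rep) ≫ H.rep) = ∑ f : IndecClass (a ⟶ c),
          mult k f.rep (e.2.rep ≫ H'.rep) * mult k g.2.rep (Z.rep ≫ f.rep ≫ H.rep) := by
      intro Z H' H
      exact mult_map (hB.finitary_hom a c) (hB.finitary_hom a g.1)
        ((postcomposing _ _ _).obj H.rep ⋙ (precomposing _ _ _).obj Z.rep) _ _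
    simp_rw [h1]
    refine (Finset.sum_congr rfl fun f _ => ?_).trans (Finset.sum_comm.trans
      (Finset.sum_congr rfl fun Z _ => Finset.sum_comm.trans
        (Finset.sum_congr rfl fun H' _ => Finset.sum_comm)))
    rw [Finset.sum_mul]
    refine Finset.sum_congr rfl fun Z _ => ?_
    rw [mul_comm]
    exact Finset.sum_mul_sum _ _ _ _
  obtain ⟨f₀, ⟨eF⟩⟩ := (hB.finitary_hom a b).exists_indecClass (J.indec hF)
  obtain ⟨g₀, ⟨eG⟩⟩ := (hB.finitary_hom a c).exists_indecClass (J.indec hG)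
  let I := {x : X // J.mem x.2.rep}
  let f : I := ⟨⟨b, f₀⟩, J.mem_congr hB hF eF⟩
  let g : I := ⟨⟨c, g₀⟩, J.mem_congr hB hG eG⟩
  -- Cutting the matrices down to J keeps their products: the middle index of a nonzero term lies
  -- ≤_J-between two elements of J, hence in J.
  have hsub : ∀ (Q : X → ℝ), (∀ x, Q x ≠ 0 → J.mem x.2.rep) → ∑ x : I, Q x.1 = ∑ x, Q x := by
    intro Q hQ
    rw [← Finset.sum_subtype (Finset.univ.filter fun x : X => J.mem x.2.rep) (by simp)]
    refine Finset.sum_subset (Finset.subset_univ _) fun x _ hx => ?_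
    by_contra h0
    exact hx (Finset.mem_filter.2 ⟨Finset.mem_univ _, hQ x h0⟩)
  have hcomm : (Matrix.of fun i j : I => M i.1 j.1) * (Matrix.of fun i j : I => P i.1 j.1) =
      (Matrix.of fun i j : I => P i.1 j.1) * (Matrix.of fun i j : I => M i.1 j.1) := by
    ext i j
    simp only [Matrix.mul_apply, Matrix.of_apply]
    rw [hsub (fun x => M i.1 x * P x j.1), hsub (fun x => P i.1 x * M x j.1), hMP, hPM]
    · intro x hx
      have h1 := (hPpos i.1 x).1 (lt_of_le_of_ne (hP0 _ _) (Ne.symm (left_ne_zero_of_mul hx)))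
      have h2 := (hMpos x j.1).1 (lt_of_le_of_ne (hM0 _ _) (Ne.symm (right_ne_zero_of_mul hx)))
      exact J.mem_of_le j.2 i.2 x.2.isIndec h2.twoSidedLE h1
    · intro x hx
      have h1 := (hMpos i.1 x).1 (lt_of_le_of_ne (hM0 _ _) (Ne.symm (left_ne_zero_of_mul hx)))
      have h2 := (hPpos x j.1).1 (lt_of_le_of_ne (hP0 _ _) (Ne.symm (right_ne_zero_of_mul hx)))
      exact J.mem_of_le j.2 i.2 x.2.isIndec h2 h1.twoSidedLE
  by_contra hGF
  -- The upper set of G for ≤_L makes `M` block triangular. If F were outside it, the entry at (G,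
  -- F) would vanish, although F ≤_L G makes it positive.
  have h0 := eq_zero_of_commute_pos (M := Matrix.of fun i j : I => M i.1 j.1) (fun i j => hM0 _ _)
    (fun i j => (hPpos _ _).2 (J.twoSidedLE j.2 i.2)) hcomm
    {x : I | LeftLE G x.1.2.rep} (fun x hx y hxy => hx.trans ((hMpos _ _).1 hxy)) (g := g) (f := f)
    ((LeftLE.refl G).of_retract (Retract.ofIso eG.symm))
    (fun h => hGF (h.of_retract (Retract.ofIso eF)))
  refine absurd h0 (ne_of_gt ((hMpos g.1 f.1).2 ?_))
  exact (hFG.congr_left eF).of_retract (Retract.ofIso eG.symm)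

end Stability

/-! ### Transposition along adjunctions and mates. -/

section Adjunctions

variable {B : Type u} [Bicategory.{w, v} B]

/-- The witness is the transpose of `u`, written out with the unit. -/
theorem exists_eq_whiskerRight_counit {a b : B} {f : a ⟶ b} {g : b ⟶ a} (adj : f ⊣ g) {X : b ⟶ a}
    (u : X ≫ f ⟶ 𝟙 b) : ∃ x : X ⟶ g, u = x ▷ f ≫ adj.counit := by
  refine ⟨𝟙 _ ⊗≫ X ◁ adj.unit ⊗≫ u ▷ g ⊗≫ 𝟙 _, ?_⟩
  symm
  calc _ = 𝟙 _ ⊗≫ X ◁ adj.unit ▷ f ⊗≫ (u ▷ (g ≫ f) ≫ 𝟙 b ◁ adj.counit) ⊗≫ 𝟙 _ := by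
        bicategory
    _ = 𝟙 _ ⊗≫ X ◁ (leftZigzag adj.unit adj.counit) ⊗≫ u := by
        rw [← whisker_exchange]; bicategory
    _ = u := by rw [adj.left_triangle]; bicategory

/-- Transposition turns sections of `κ ▷ g` into lifts of the counit along `κ` and back. This
converts vanishing of a cokernel into membership of a counit in a submodule. -/
theorem exists_section_iff_exists_comp_eq_counit {a b : B} {f : a ⟶ b} {g : b ⟶ a} (adj : f ⊣ g)
    {X : b ⟶ b} (κ : X ⟶ 𝟙 b) :
    (∃ h : g ⟶ X ≫ g, h ≫ κ ▷ g ≫ (λ_ g).hom = 𝟙 g) ↔ ∃ t : g ≫ f ⟶ X, t ≫ κ = adj.counit := by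
  constructor
  · rintro ⟨h, hh⟩
    refine ⟨h ▷ f ≫ (α_ X g f).hom ≫ X ◁ adj.counit ≫ (ρ_ X).hom, ?_⟩
    calc _ = h ▷ f ⊗≫ (X ◁ adj.counit ≫ κ ▷ 𝟙 b) ⊗≫ 𝟙 _ := by bicategory
      _ = (h ≫ κ ▷ g ≫ (λ_ g).hom) ▷ f ≫ adj.counit := by rw [whisker_exchange]; bicategory
      _ = adj.counit := by rw [hh]; bicategory
  · rintro ⟨t, ht⟩
    refine ⟨(ρ_ g).inv ≫ g ◁ adj.unit ≫ (α_ g f g).inv ≫ t ▷ g, ?_⟩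
    calc _ = (ρ_ g).inv ≫ g ◁ adj.unit ≫ (α_ g f g).inv ≫ (t ≫ κ) ▷ g ≫ (λ_ g).hom := by
          simp
      _ = (ρ_ g).inv ≫ rightZigzag adj.unit adj.counit ≫ (λ_ g).hom := by rw [ht]; bicategory
      _ = 𝟙 g := by rw [adj.right_triangle]; bicategory

/-- Dinaturality of the counit. With its counterpart for the unit it assembles the adjunction data
of a 1-morphism from those of cell elements. -/
theorem conjugateEquiv_whiskerRight_counit {a b : B} {l₁ l₂ : a ⟶ b} {r₁ r₂ : b ⟶ a} (adj₁ : l₁ ⊣ r₁)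
    (adj₂ : l₂ ⊣ r₂) (γ : l₂ ⟶ l₁) :
    (conjugateEquiv adj₁ adj₂ γ) ▷ l₂ ≫ adj₂.counit = r₁ ◁ γ ≫ adj₁.counit := by
  rw [conjugateEquiv_apply']
  calc _ = 𝟙 _ ⊗≫ r₁ ◁ adj₂.unit ▷ l₂ ⊗≫ r₁ ◁ γ ▷ r₂ ▷ l₂ ⊗≫
        (adj₁.counit ▷ (r₂ ≫ l₂) ≫ 𝟙 b ◁ adj₂.counit) ⊗≫ 𝟙 _ := by bicategory
    _ = 𝟙 _ ⊗≫ r₁ ◁ adj₂.unit ▷ l₂ ⊗≫ r₁ ◁ (γ ▷ (r₂ ≫ l₂) ≫ l₁ ◁ adj₂.counit) ⊗≫ adj₁.counit := by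
        rw [← whisker_exchange]; bicategory
    _ = 𝟙 _ ⊗≫ r₁ ◁ (leftZigzag adj₂.unit adj₂.counit) ⊗≫ r₁ ◁ γ ≫ adj₁.counit := by
        rw [← whisker_exchange]; bicategory
    _ = _ := by rw [adj₂.left_triangle]; bicategory

theorem unit_whiskerLeft_conjugateEquiv {a b : B} {l₁ l₂ : a ⟶ b} {r₁ r₂ : b ⟶ a} (adj₁ : l₁ ⊣ r₁)
    (adj₂ : l₂ ⊣ r₂) (γ : l₂ ⟶ l₁) :
    adj₁.unit ≫ l₁ ◁ (conjugateEquiv adj₁ adj₂ γ) = adj₂.unit ≫ γ ▷ r₂ := by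
  rw [conjugateEquiv_apply']
  calc _ = 𝟙 _ ⊗≫ (adj₁.unit ▷ 𝟙 a ≫ (l₁ ≫ r₁) ◁ adj₂.unit) ⊗≫ l₁ ◁ r₁ ◁ γ ▷ r₂ ⊗≫
        l₁ ◁ adj₁.counit ▷ r₂ ⊗≫ 𝟙 _ := by bicategory
    _ = 𝟙 _ ⊗≫ adj₂.unit ⊗≫ (adj₁.unit ▷ l₂ ≫ (l₁ ≫ r₁) ◁ γ) ▷ r₂ ⊗≫
        l₁ ◁ adj₁.counit ▷ r₂ ⊗≫ 𝟙 _ := by rw [← whisker_exchange]; bicategory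
    _ = 𝟙 _ ⊗≫ adj₂.unit ⊗≫ γ ▷ r₂ ⊗≫ (leftZigzag adj₁.unit adj₁.counit) ▷ r₂ ⊗≫ 𝟙 _ := by
        rw [← whisker_exchange]; bicategory
    _ = _ := by rw [adj₁.left_triangle]; bicategory

/-- Transport of an adjunction along an isomorphism of the right adjoints. -/
def adjunctionOfIso {a b : B} {f : a ⟶ b} {g g' : b ⟶ a} (adj : f ⊣ g) (e : g ≅ g') : f ⊣ g' where
  unit := adj.unit ≫ f ◁ e.hom
  counit := e.inv ▷ f ≫ adj.counit
  left_triangle := by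
    calc _ = adj.unit ▷ f ⊗≫ f ◁ (e.hom ≫ e.inv) ▷ f ⊗≫ f ◁ adj.counit := by bicategory
      _ = leftZigzag adj.unit adj.counit := by rw [e.hom_inv_id]; bicategory
      _ = _ := adj.left_triangle
  right_triangle := by
    calc _ = g' ◁ adj.unit ⊗≫ (g' ◁ f ◁ e.hom ≫ e.inv ▷ (f ≫ g')) ⊗≫ adj.counit ▷ g' := by
          bicategory
      _ = (g' ◁ adj.unit ⊗≫ e.inv ▷ (f ≫ g)) ⊗≫ (g ≫ f) ◁ e.hom ⊗≫ adj.counit ▷ g' := by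
          have := whisker_exchange e.inv (f ◁ e.hom)
          rw [this]; bicategory
      _ = 𝟙 _ ⊗≫ (g' ◁ adj.unit ≫ e.inv ▷ (f ≫ g)) ⊗≫ ((g ≫ f) ◁ e.hom ≫ adj.counit ▷ g') := by
          bicategory
      _ = 𝟙 _ ⊗≫ e.inv ⊗≫ rightZigzag adj.unit adj.counit ⊗≫ e.hom ⊗≫ 𝟙 _ := by
          rw [whisker_exchange, whisker_exchange]; bicategory
      _ = 𝟙 _ ⊗≫ (e.inv ≫ e.hom) ⊗≫ 𝟙 _ := by rw [adj.right_triangle]; bicategory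
      _ = _ := by rw [e.inv_hom_id]; bicategory

end Adjunctions

/-! ### Principal submodules of representable modules. -/

section SimpleTop

variable {k : Type u₀} [Field k] {A : Type u} [Category.{v} A] [Preadditive A] [Linear k A]

/-- The submodule of `P_X` generated by `κ : Y ⟶ X`. -/
def RepSubmodule.principal (k : Type u₀) [Field k] [Linear k A] {X Y : A} (κ : Y ⟶ X) :
    RepSubmodule k X where
  carrier Z := LinearMap.range (Linear.rightComp k Z κ)
  comp_mem := by
    rintro Y Z f _ ⟨h, rfl⟩
    exact ⟨f ≫ h, by simp⟩

theorem RepSubmodule.principal_isGeneratedBy {X Y : A} (κ : Y ⟶ X) :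
    (RepSubmodule.principal k κ).IsGeneratedBy κ :=
  fun _ _ => ⟨fun ⟨h, e⟩ => ⟨h, e.symm⟩, fun ⟨h, e⟩ => ⟨h, e.symm⟩⟩

theorem RepSubmodule.principal_le {X Y : A} {κ : Y ⟶ X} {K : RepSubmodule k X}
    (h : κ ∈ K.carrier Y) : RepSubmodule.principal k κ ≤ K := by
  rintro Z _ ⟨g, rfl⟩
  exact K.comp_mem g h

/-- The largest proper submodule is the image of the radical of P_D. It misses `d`, because `h ≫ d =
d` forces `h` to be invertible; and a submodule that contains `h ≫ d` with `f ≫ h` invertible for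
some `f` contains `d`. -/
theorem RepSubmodule.principal_hasSimpleTop {X D : A} (hD : HasLocalEnd D) {d : D ⟶ X}
    (hd : d ≠ 0) : (RepSubmodule.principal k d).HasSimpleTop D := by
  let M : RepSubmodule k X :=
    { carrier := fun Y => (⨅ f : D ⟶ Y, (radEnd k D).comap (Linear.leftComp k D f)).map
        (Linear.rightComp k Y d)
      comp_mem := by
        rintro Y Z f _ ⟨h, hh, rfl⟩
        refine ⟨f ≫ h, ?_, by simp⟩
        simp only [SetLike.mem_coe, Submodule.mem_iInf, Submodule.mem_comap] at hh ⊢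
        intro g
        have := hh (g ≫ f)
        simpa using this }
  have hM : ∀ {Y : A} {g : Y ⟶ X}, g ∈ M.carrier Y ↔
      ∃ h : Y ⟶ D, (∀ f : D ⟶ Y, ¬ IsIso (f ≫ h)) ∧ h ≫ d = g := by
    intro Y g
    simp only [M, Submodule.mem_map, Submodule.mem_iInf, Submodule.mem_comap]
    refine exists_congr fun h => and_congr (forall_congr' fun f => ?_) Iff.rfl
    exact mem_radEnd hD
  have hdM : d ∉ M.carrier D := by
    rw [hM]
    rintro ⟨h, hh, e⟩
    exact hh (𝟙 D) (by rw [Category.id_comp]; exact hD.isIso_of_comp_eq hd e)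
  have hdK : d ∈ (RepSubmodule.principal k d).carrier D := ⟨𝟙 D, Category.id_comp d⟩
  refine ⟨M, lt_of_le_not_ge ?_ fun h => hdM (h D hdK), ?_, fun h => hdM (h hdK)⟩
  · intro Y g hg
    obtain ⟨h, -, e⟩ := hM.1 hg
    exact ⟨h, e⟩
  · intro N hN Y g hg
    obtain ⟨h, rfl⟩ := hN.le Y hg
    refine hM.2 ⟨h, fun f hf => hN.not_ge (RepSubmodule.principal_le ?_), rfl⟩
    have : d = (inv (f ≫ h) ≫ f) ≫ h ≫ d := by
      rw [Category.assoc, ← Category.assoc f, IsIso.inv_hom_id_assoc]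
    rw [this]
    exact N.comp_mem _ hg

end SimpleTop

/-! ### The counit F⋆F → 𝟙 and annihilation by F. -/

section Duflo

variable {k : Type u₀} [Field k] {B : Type u} [Bicategory.{w, v} B]
  [∀ a b : B, Preadditive (a ⟶ b)] [∀ a b : B, Linear k (a ⟶ b)]

def Star.mapIso (S : Star k B) {a b : B} {F G : a ⟶ b} (e : F ≅ G) : S.obj F ≅ S.obj G where
  hom := S.map e.inv
  inv := S.map e.hom
  hom_inv_id := by rw [← S.map_comp, e.hom_inv_id, S.map_id]
  inv_hom_id := by rw [← S.map_comp, e.inv_hom_id, S.map_id]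

def Star.mapRetract (S : Star k B) {a b : B} {F G : a ⟶ b} (R : Retract F G) :
    Retract (S.obj F) (S.obj G) where
  i := S.map R.r
  r := S.map R.i
  retract := by rw [← S.map_comp, R.retract, S.map_id]

variable {S : Star k B}

namespace IsFiat

theorem hasLocalEnd (hS : IsFiat S) {a b : B} {F : a ⟶ b} (hF : IsIndec F) : HasLocalEnd F :=
  (hS.finitary.finitary_hom a b).hasLocalEnd hF

theorem isIndec_star (hS : IsFiat S) {a b : B} {F : a ⟶ b} (hF : IsIndec F) : IsIndec (S.obj F) := by
  have hl := hS.hasLocalEnd hF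
  refine HasLocalEnd.isIndec ⟨fun h => hl.id_ne ?_, fun f => ?_⟩
  · apply (hS.map_bijective F F).1
    simp only [S.map_id, map_zero, h]
  · obtain ⟨g, rfl⟩ := (hS.map_bijective F F).2 f
    rcases hl.nilpotent_or_isIso g with ⟨n, hn⟩ | h
    · left
      refine ⟨n, ?_⟩
      have : ∀ m : ℕ, End.of (S.map g) ^ m = S.map (End.of g ^ m : End F) := by
        intro m
        induction m with
        | zero => exact (S.map_id F).symm
        | succ m ih => rw [pow_succ, ih, pow_succ']; exact (S.map_comp _ _).symm
      exact (this n).trans ((congrArg S.map hn).trans (map_zero _))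
    · right
      exact (S.mapIso (asIso (g : F ⟶ F))).isIso_inv

variable (hS : IsFiat S)

noncomputable def adj {a b : B} (F : a ⟶ b) : F ⊣ S.obj F := hS.adjunctions.choose F

theorem map_eq {a b : B} {F G : a ⟶ b} (γ : F ⟶ G) :
    S.map γ = conjugateEquiv (hS.adj G) (hS.adj F) γ := hS.adjunctions.choose_spec γ

noncomputable def bidual {a b : B} (F : a ⟶ b) : S.obj (S.obj F) ≅ F := hS.involutive.choose F

theorem bidual_naturality {a b : B} {F G : a ⟶ b} (γ : F ⟶ G) :
    S.map (S.map γ) ≫ (hS.bidual G).hom = (hS.bidual F).hom ≫ γ :=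
  hS.involutive.choose_spec.1 γ

/-- The adjunction `F⋆ ⊣ F`. -/
noncomputable def leftAdj {a b : B} (F : a ⟶ b) : S.obj F ⊣ F :=
  adjunctionOfIso (hS.adj (S.obj F)) (hS.bidual F)

/-- The counit of `F⋆ ⊣ F`. -/
noncomputable def ev {a b : B} (F : a ⟶ b) : F ≫ S.obj F ⟶ 𝟙 a := (hS.leftAdj F).counit

theorem exists_comp_eq_ev_iff {a b : B} (F : a ⟶ b) {X : a ⟶ a} (κ : X ⟶ 𝟙 a) :
    (∃ t : F ≫ S.obj F ⟶ X, t ≫ κ = hS.ev F) ↔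
      ∃ h : F ⟶ X ≫ F, h ≫ κ ▷ F ≫ (λ_ F).hom = 𝟙 F :=
  (exists_section_iff_exists_comp_eq_counit (hS.leftAdj F) κ).symm

/-- Transposition along G⋆ ⊣ G: every morphism to 𝟙 from a composite with G⋆ factors through the
counit. -/
theorem exists_eq_ev {a b : B} (G : a ⟶ b) {X : a ⟶ b} (u : X ≫ S.obj G ⟶ 𝟙 a) :
    ∃ x : X ≫ S.obj G ⟶ G ≫ S.obj G, u = x ≫ hS.ev G := by
  obtain ⟨x, hx⟩ := exists_eq_whiskerRight_counit (hS.leftAdj G) u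
  exact ⟨_, hx⟩

/-- When G is a summand of HF, a section of `κ ▷ F` whiskered with H restricts to a section of `κ ▷
G`. So the image of `ev` shrinks along ≤_L and is constant on left cells. -/
theorem exists_comp_eq_ev_of_leftLE {a b c : B} {F : a ⟶ b} {G : a ⟶ c} (h : LeftLE F G)
    {X : a ⟶ a} {κ : X ⟶ 𝟙 a} (ht : ∃ t : F ≫ S.obj F ⟶ X, t ≫ κ = hS.ev F) :
    ∃ t : G ≫ S.obj G ⟶ X, t ≫ κ = hS.ev G := by
  rw [exists_comp_eq_ev_iff] at ht ⊢
  obtain ⟨s, hs⟩ := ht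
  obtain ⟨H, ⟨R⟩⟩ := h
  refine ⟨R.i ≫ s ▷ H ≫ (α_ X F H).hom ≫ X ◁ R.r, ?_⟩
  calc _ = R.i ≫ s ▷ H ≫ (α_ X F H).hom ≫ (X ◁ R.r ≫ κ ▷ G) ≫ (λ_ G).hom := by simp
    _ = R.i ≫ (s ≫ κ ▷ F ≫ (λ_ F).hom) ▷ H ≫ R.r := by rw [whisker_exchange]; simp
    _ = 𝟙 G := by rw [hs]; simp

/-- Surjectivity onto P_F need only be tested on 𝟙 F, where it asks for a section of `κ ▷ F`; by
transposition this is a lift of `ev F` along `κ`. -/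
theorem annihilates_iff {a b : B} (F : a ⟶ b) (K : RepSubmodule k (𝟙 a)) :
    Annihilates F K ↔ (∃ (X : a ⟶ a) (κ : X ⟶ 𝟙 a), K.IsGeneratedBy κ) ∧
      hS.ev F ∈ K.carrier _ := by
  constructor
  · rintro ⟨X, κ, hκ, h⟩
    obtain ⟨s, hs⟩ := h F (𝟙 F)
    obtain ⟨t, ht⟩ := (hS.exists_comp_eq_ev_iff F κ).2 ⟨s, hs.symm⟩
    exact ⟨⟨X, κ, hκ⟩, (hκ _ _).2 ⟨t, ht.symm⟩⟩
  · rintro ⟨⟨X, κ, hκ⟩, h⟩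
    obtain ⟨t, ht⟩ := (hκ _ _).1 h
    obtain ⟨s, hs⟩ := (hS.exists_comp_eq_ev_iff F κ).1 ⟨t, ht.symm⟩
    exact ⟨X, κ, hκ, fun Y g => ⟨g ≫ s, by rw [Category.assoc, hs, Category.comp_id]⟩⟩

/-- `d : D ⟶ 𝟙` is a projective cover of the image of the counit `ev F`. -/
structure IsEvCover {a b : B} (F : a ⟶ b) (D : a ⟶ a) (d : D ⟶ 𝟙 a) : Prop where
  indec : IsIndec D
  exists_comp_eq_ev : ∃ t : F ≫ S.obj F ⟶ D, t ≫ d = hS.ev F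
  exists_eq_comp_ev : ∃ b : D ⟶ F ≫ S.obj F, d = b ≫ hS.ev F

end IsFiat

end Duflo

/-! ### Existence, uniqueness and factorization properties of Duflo 1-morphisms. -/

section Duflo

variable {k : Type u₀} [Field k] {B : Type u} [Bicategory.{w, v} B]
  [∀ a b : B, Preadditive (a ⟶ b)] [∀ a b : B, Linear k (a ⟶ b)] {S : Star k B}

theorem LeftCell.mem_iff {J : TwoSidedCell B} {L : LeftCell J} {b c : B} {F : L.src ⟶ b}
    (hF : L.mem F) (G : L.src ⟶ c) :
    L.mem G ↔ IsIndec G ∧ LeftLE F G ∧ LeftLE G F := by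
  obtain ⟨_, E, -, hE⟩ := L.isCell
  obtain ⟨-, h₁, h₂⟩ := (hE F).1 hF
  rw [hE G]
  exact and_congr Iff.rfl (and_congr ⟨h₂.trans, h₁.trans⟩ ⟨fun h => h.trans h₁, fun h => h.trans h₂⟩)

theorem LeftCell.exists_mem {J : TwoSidedCell B} (L : LeftCell J) :
    ∃ (b : B) (F : L.src ⟶ b), L.mem F := by
  obtain ⟨b, F, hF, h⟩ := L.isCell
  exact ⟨b, F, (h F).2 ⟨J.indec hF, .refl F, .refl F⟩⟩

theorem LeftCell.indec {J : TwoSidedCell B} {L : LeftCell J} {b : B} {F : L.src ⟶ b}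
    (hF : L.mem F) : IsIndec F :=
  J.indec (L.mem_twoSidedCell hF)

namespace IsFiat

variable {hS : IsFiat S}

namespace IsEvCover

variable {a b : B} {F : a ⟶ b} {D : a ⟶ a} {d : D ⟶ 𝟙 a}

theorem leftLE' (h : hS.IsEvCover F D d) : LeftLE D F := by
  obtain ⟨s, hs⟩ := (hS.exists_comp_eq_ev_iff F d).1 h.exists_comp_eq_ev
  exact ⟨F, ⟨⟨s, d ▷ F ≫ (λ_ F).hom, hs⟩⟩⟩

theorem of_mem {J : TwoSidedCell B} {L : LeftCell J} {b c : B} {F : L.src ⟶ b} {G : L.src ⟶ c}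
    (hF : L.mem F) (hG : L.mem G) {D : L.src ⟶ L.src} {d : D ⟶ 𝟙 L.src}
    (h : hS.IsEvCover F D d) : hS.IsEvCover G D d where
  indec := h.indec
  exists_comp_eq_ev :=
    hS.exists_comp_eq_ev_of_leftLE ((LeftCell.mem_iff hF G).1 hG).2.1 h.exists_comp_eq_ev
  exists_eq_comp_ev := by
    obtain ⟨b, hb⟩ := h.exists_eq_comp_ev
    obtain ⟨t, ht⟩ := hS.exists_comp_eq_ev_of_leftLE ((LeftCell.mem_iff hF G).1 hG).2.2
      (κ := hS.ev G) ⟨𝟙 _, Category.id_comp _⟩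
    exact ⟨b ≫ t, by rw [hb, Category.assoc, ht]⟩

end IsEvCover

variable [LinearTwoCategory k B]

theorem ev_ne_zero (hS : IsFiat S) {a b : B} {F : a ⟶ b} (hF : IsIndec F) : hS.ev F ≠ 0 := by
  intro h0
  obtain ⟨s, hs⟩ := (hS.exists_comp_eq_ev_iff F (0 : 𝟙 a ⟶ 𝟙 a)).1 ⟨0, by rw [h0, comp_zero]⟩
  have := postcomposing_additive k a F
  have h1 : (0 : 𝟙 a ⟶ 𝟙 a) ▷ F = 0 := ((postcomposing a a b).obj F).map_zero _ _
  rw [h1, zero_comp, comp_zero] at hs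
  exact hF.1 ((IsZero.iff_id_eq_zero F).2 hs.symm)

namespace IsEvCover

variable {a b : B} {F : a ⟶ b} {D : a ⟶ a} {d : D ⟶ 𝟙 a}

theorem ne_zero (h : hS.IsEvCover F D d) (hF : IsIndec F) : d ≠ 0 := by
  rintro rfl
  obtain ⟨t, ht⟩ := h.exists_comp_eq_ev
  exact hS.ev_ne_zero hF (by rw [← ht, comp_zero])

/-- The composite of a lift `D ⟶ F ≫ S.obj F` with a lift `F ≫ S.obj F ⟶ D` fixes `d ≠ 0`, hence is
invertible. -/
theorem retract (h : hS.IsEvCover F D d) (hF : IsIndec F) :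
    Nonempty (Retract D (F ≫ S.obj F)) := by
  have hd := h.ne_zero hF
  obtain ⟨t, ht⟩ := h.exists_comp_eq_ev
  obtain ⟨b, hb⟩ := h.exists_eq_comp_ev
  exact nonempty_retract_of_isIso ((hS.hasLocalEnd h.indec).isIso_of_comp_eq hd (f := b ≫ t)
    (by rw [Category.assoc, ht, ← hb]))

theorem leftLE (h : hS.IsEvCover F D d) (hF : IsIndec F) : LeftLE F D :=
  ⟨S.obj F, h.retract hF⟩

theorem nonempty_iso (h : hS.IsEvCover F D d) (hF : IsIndec F) {D' : a ⟶ a} {d' : D' ⟶ 𝟙 a}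
    (h' : hS.IsEvCover F D' d') : Nonempty (D ≅ D') := by
  obtain ⟨t, ht⟩ := h.exists_comp_eq_ev
  obtain ⟨b, hb⟩ := h.exists_eq_comp_ev
  obtain ⟨t', ht'⟩ := h'.exists_comp_eq_ev
  obtain ⟨b', hb'⟩ := h'.exists_eq_comp_ev
  have := (hS.hasLocalEnd h.indec).isIso_of_comp_eq (h.ne_zero hF) (f := (b ≫ t') ≫ (b' ≫ t))
    (by simp only [Category.assoc]; rw [ht, ← hb', ht', ← hb])
  obtain ⟨R⟩ := nonempty_retract_of_isIso this
  exact (hS.hasLocalEnd h.indec).nonempty_iso_of_retract (hS.hasLocalEnd h'.indec) R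

/-- The cover of the image of `ev F` also covers the image of `ev D⋆`. -/
theorem star (h : hS.IsEvCover F D d) (hF : IsIndec F) : hS.IsEvCover (S.obj D) D d where
  indec := h.indec
  exists_comp_eq_ev := by
    obtain ⟨R⟩ := h.retract hF
    -- D is a summand of `F ≫ S.obj F`, a 1-morphism isomorphic to its own dual, so D⋆ is a summand
    -- of it too and F ≤_L D⋆.
    refine hS.exists_comp_eq_ev_of_leftLE ⟨S.obj F, ⟨?_⟩⟩ h.exists_comp_eq_ev
    exact ((S.mapRetract R).trans (Retract.ofIso (S.mapComp F (S.obj F)))).trans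
      (Retract.ofIso (whiskerRightIso (hS.bidual F) (S.obj F)))
  exists_eq_comp_ev := by
    -- Read on D⋆⋆ ≅ D, the morphism `d` has source 𝟙 ≫ (D⋆)⋆, so it factors through `ev D⋆`.
    obtain ⟨x, hx⟩ := hS.exists_eq_ev (S.obj D) ((λ_ _).hom ≫ (hS.bidual D).hom ≫ d)
    refine ⟨(hS.bidual D).inv ≫ (λ_ _).inv ≫ x, ?_⟩
    simp only [Category.assoc, ← hx]
    simp

end IsEvCover

/-- Splitting F⋆F into indecomposables writes 𝟙 F as a sum of endomorphisms of F, one for each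
summand. By locality one of them is invertible, so the restriction of `ev F` to that summand splits
after whiskering with F, and `ev F` lifts along it. -/
theorem exists_isEvCover (hS : IsFiat S) {a b : B} {F : a ⟶ b} (hF : IsIndec F) :
    ∃ (D : a ⟶ a) (d : D ⟶ 𝟙 a), hS.IsEvCover F D d := by
  obtain ⟨h, hh⟩ := (hS.exists_comp_eq_ev_iff F (hS.ev F)).1 ⟨𝟙 _, Category.id_comp _⟩
  obtain ⟨n, f, s, r, hf, hs⟩ := (hS.finitary.finitary_hom a a).inAdd_isIndec (F ≫ S.obj F)
  have e : ∑ t, h ≫ (s t ≫ r t ≫ hS.ev F) ▷ F ≫ (λ_ F).hom = 𝟙 F := by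
    rw [← hh, ← Preadditive.comp_sum, ← Preadditive.sum_comp, ← whiskerRight_sum k]
    have hev : ∑ t, s t ≫ r t ≫ hS.ev F = hS.ev F := by
      have := congrArg (· ≫ hS.ev F) hs
      simpa [Preadditive.sum_comp] using this
    rw [hev]
  obtain ⟨t, ht⟩ := (hS.hasLocalEnd hF).exists_isIso_of_sum (s := Finset.univ)
    (f := fun t => h ≫ (s t ≫ r t ≫ hS.ev F) ▷ F ≫ (λ_ F).hom) (by rw [e]; infer_instance)
  refine ⟨f t, r t ≫ hS.ev F, hf t, (hS.exists_comp_eq_ev_iff F _).2 ?_, ⟨r t, rfl⟩⟩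
  refine ⟨inv (h ≫ (s t ≫ r t ≫ hS.ev F) ▷ F ≫ (λ_ F).hom) ≫ h ≫ s t ▷ F, ?_⟩
  simp only [Category.assoc]
  rw [← comp_whiskerRight_assoc]
  exact IsIso.inv_hom_id _

/-- The submodule generated by `ev F` satisfies the annihilation condition for the whole left cell
and lies in every submodule that does, so it is the minimal one. The simple top of the submodule
generated by a cover is then automatic. -/
theorem isDuflo_iff (hS : IsFiat S) {J : TwoSidedCell B} {L : LeftCell J} {b : B} {F : L.src ⟶ b}
    (hF : L.mem F) {D : L.src ⟶ L.src} {d : D ⟶ 𝟙 L.src} :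
    IsDuflo k L D d ↔ hS.IsEvCover F D d := by
  constructor
  · rintro ⟨hD, K, ⟨hK, hmin⟩, -, hd⟩
    have h1 : hS.ev F ∈ K.carrier _ := ((hS.annihilates_iff F K).1 (hK F hF)).2
    refine ⟨hD, ?_, ?_⟩
    · obtain ⟨t, ht⟩ := (hd _ _).1 h1
      exact ⟨t, ht.symm⟩
    · have h2 : d ∈ (RepSubmodule.principal k (hS.ev F)).carrier D :=
        hmin (y := RepSubmodule.principal k (hS.ev F)) (fun G hG => (hS.annihilates_iff G _).2
          ⟨⟨_, _, RepSubmodule.principal_isGeneratedBy _⟩,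
            hS.exists_comp_eq_ev_of_leftLE ((LeftCell.mem_iff hF G).1 hG).2.1
              ⟨𝟙 _, Category.id_comp _⟩⟩) (RepSubmodule.principal_le h1) D
          ((hd _ _).2 ⟨𝟙 D, (Category.id_comp d).symm⟩)
      obtain ⟨h, hh⟩ := h2
      exact ⟨h, hh.symm⟩
  · intro h
    refine ⟨h.indec, RepSubmodule.principal k d, ⟨fun G hG => (hS.annihilates_iff G _).2
      ⟨⟨_, _, RepSubmodule.principal_isGeneratedBy _⟩, (h.of_mem hF hG).exists_comp_eq_ev⟩, ?_⟩,
      RepSubmodule.principal_hasSimpleTop (hS.hasLocalEnd h.indec) (h.ne_zero (LeftCell.indec hF)),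
      RepSubmodule.principal_isGeneratedBy d⟩
    intro K hK _
    obtain ⟨b, rfl⟩ := h.exists_eq_comp_ev
    exact RepSubmodule.principal_le (K.comp_mem b ((hS.annihilates_iff F K).1 (hK F hF)).2)

/-- D lies in the right cell because D⋆ lies in the left cell, which holds since `d` also covers the
image of `ev D⋆`. -/
theorem cellMem_of_isDuflo (hS : IsFiat S) {J : TwoSidedCell B} {L : LeftCell J}
    {D : L.src ⟶ L.src} {d : D ⟶ 𝟙 L.src} (h : IsDuflo k L D d) : cellMem S L L D := by
  obtain ⟨b, F, hF⟩ := L.exists_mem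
  have hD := (hS.isDuflo_iff hF).1 h
  have hFi := LeftCell.indec hF
  have hD' := hD.star hFi
  have hSD := hS.isIndec_star hD.indec
  have h1 : L.mem D := (LeftCell.mem_iff hF D).2 ⟨hD.indec, hD.leftLE hFi, hD.leftLE'⟩
  exact ⟨h1, S.obj D, (LeftCell.mem_iff h1 _).2 ⟨hSD, hD'.leftLE', hD'.leftLE hSD⟩,
    ⟨(hS.bidual D).symm⟩⟩

/-- `u` factors through `ev G` by transposition, and `ev G` factors through `d`. -/
theorem exists_comp_eq_of_isDuflo (hS : IsFiat S) {J : TwoSidedCell B} {L : LeftCell J}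
    {D : L.src ⟶ L.src} {d : D ⟶ 𝟙 L.src} (h : IsDuflo k L D d) {b : B} {G : L.src ⟶ b}
    (hG : L.mem G) {X : L.src ⟶ b} (u : X ≫ S.obj G ⟶ 𝟙 L.src) :
    ∃ t : X ≫ S.obj G ⟶ D, t ≫ d = u := by
  obtain ⟨x, rfl⟩ := hS.exists_eq_ev G u
  obtain ⟨t, ht⟩ := ((hS.isDuflo_iff hG).1 h).exists_comp_eq_ev
  exact ⟨x ≫ t, by rw [Category.assoc, ht]⟩

theorem exists_comp_eq_counit (hS : IsFiat S) {J : TwoSidedCell B} {L : LeftCell J}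
    {D : L.src ⟶ L.src} {d : D ⟶ 𝟙 L.src} (h : IsDuflo k L D d) {c : B} {F : c ⟶ L.src}
    (hF : L.starMem S F) : ∃ β : S.obj F ≫ F ⟶ D, β ≫ d = (hS.adj F).counit := by
  obtain ⟨G, hG, ⟨e⟩⟩ := hF
  obtain ⟨t, ht⟩ := hS.exists_comp_eq_of_isDuflo h hG (S.obj F ◁ e.inv ≫ (hS.adj F).counit)
  exact ⟨S.obj F ◁ e.hom ≫ t, by rw [Category.assoc, ht]; simp⟩

/-- The dual of the unit is a morphism F⋆⋆F⋆ → 𝟙⋆; it is lifted along `d` and brought back by full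
faithfulness of ⋆. -/
theorem exists_dual_comp_eq_unit (hS : IsFiat S) {J : TwoSidedCell B} {L : LeftCell J}
    {D : L.src ⟶ L.src} {d : D ⟶ 𝟙 L.src} (h : IsDuflo k L D d) {c : B} {F : L.src ⟶ c}
    (hF : L.mem F) : ∃ α : S.obj D ⟶ F ≫ S.obj F, S.dual d ≫ α = (hS.adj F).unit := by
  -- 𝟙⋆ is identified with 𝟙 through 𝟙⋆⋆ instead of by `mapId`, so that no compatibility between
  -- `mapId` and `bidual` is needed.
  let ζ : S.obj (𝟙 L.src) ≅ 𝟙 L.src :=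
    (S.mapIso (S.mapId _)).symm ≪≫ hS.bidual (𝟙 L.src)
  obtain ⟨t, ht⟩ := hS.exists_comp_eq_of_isDuflo h hF
    ((S.mapComp F (S.obj F)).inv ≫ S.map (hS.adj F).unit ≫ ζ.hom)
  obtain ⟨α, hα⟩ := (hS.map_bijective (S.obj D) (F ≫ S.obj F)).2
    ((S.mapComp F (S.obj F)).hom ≫ t ≫ (hS.bidual D).inv)
  refine ⟨α, (hS.map_bijective _ _).1 ?_⟩
  simp only at hα ⊢
  have h1 : (hS.bidual D).inv ≫ S.map (S.map d) = d ≫ (hS.bidual (𝟙 _)).inv := by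
    rw [Iso.inv_comp_eq, ← Category.assoc, Iso.eq_comp_inv, hS.bidual_naturality]
  rw [Star.dual, S.map_comp, S.map_comp, hα]
  simp only [Category.assoc, reassoc_of% h1, reassoc_of% ht]
  simp [ζ, Star.mapIso, ← S.map_comp, S.map_id]

end IsFiat

end Duflo

/-! ### The maximal 2-ideal and its stability under ⋆. -/

section Ideals

variable {k : Type u₀} [Field k] {B : Type u} [Bicategory.{w, v} B]
  [∀ a b : B, Preadditive (a ⟶ b)] [∀ a b : B, Linear k (a ⟶ b)]
  {J : TwoSidedCell B}

theorem TwoSidedCell.ge_of_inAdd (hB : IsFinitaryTwoCategory k B) {a b : B} {F : a ⟶ b}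
    (hF : IsIndec F) (h : InAdd (fun G : a ⟶ b => J.Ge G) F) : J.Ge F := by
  obtain ⟨G, ⟨x, y, E, hE, hle⟩, ⟨R⟩⟩ :=
    ((hB.finitary_hom a b).hasLocalEnd hF).exists_retract_of_inAdd h
  exact ⟨x, y, E, hE, hle.of_retract R⟩

/-- The triangle identities exhibit F⋆ as a summand of F⋆FF⋆ and F as a summand of FF⋆F. -/
theorem IsFiat.star_mem_cell {S : Star k B} (hS : IsFiat S) {a b : B} {F : a ⟶ b} (hF : J.mem F) :
    J.mem (S.obj F) := by
  refine J.mem_of_le hF hF (hS.isIndec_star (J.indec hF)) ⟨S.obj F, S.obj F, ⟨?_⟩⟩ ⟨F, F, ⟨?_⟩⟩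
  · refine ⟨(ρ_ _).inv ≫ S.obj F ◁ (hS.adj F).unit,
      (α_ _ _ _).inv ≫ (hS.adj F).counit ▷ S.obj F ≫ (λ_ _).hom, ?_⟩
    calc _ = 𝟙 _ ⊗≫ rightZigzag (hS.adj F).unit (hS.adj F).counit ⊗≫ 𝟙 _ := by bicategory
      _ = 𝟙 _ := by rw [(hS.adj F).right_triangle]; bicategory
  · refine ⟨(λ_ _).inv ≫ (hS.adj F).unit ▷ F ≫ (α_ _ _ _).hom,
      F ◁ (hS.adj F).counit ≫ (ρ_ _).hom, ?_⟩
    calc _ = 𝟙 _ ⊗≫ leftZigzag (hS.adj F).unit (hS.adj F).counit ⊗≫ 𝟙 _ := by bicategory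
      _ = 𝟙 _ := by rw [(hS.adj F).left_triangle]; bicategory

theorem IsFiat.star_ge {S : Star k B} (hS : IsFiat S) {a b : B} (F : a ⟶ b) (h : InAdd (fun G : a ⟶ b => J.Ge G) F) :
    InAdd (fun G : b ⟶ a => J.Ge G) (S.obj F) := by
  obtain ⟨n, f, s, r, hf, hs⟩ := h
  refine ⟨n, fun t => S.obj (f t), fun t => S.map (r t), fun t => S.map (s t), fun t => ?_, ?_⟩
  · obtain ⟨x, y, E, hE, H, K, ⟨R⟩⟩ := hf t
    refine ⟨y, x, S.obj E, hS.star_mem_cell hE, S.obj K, S.obj H, ⟨?_⟩⟩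
    exact (S.mapRetract R).trans (Retract.ofIso (S.mapComp H (E ≫ K) ≪≫
      whiskerRightIso (S.mapComp E K) (S.obj H) ≪≫ α_ _ _ _))
  · rw [← S.map_id, ← hs, map_sum]
    simp only [S.map_comp]

/-- The span of the 2-morphisms that factor through some `Z` with `W ≤_J Z`. -/
def spanThrough (k : Type u₀) [Field k] {B : Type u} [Bicategory.{w, v} B]
    [∀ a b : B, Preadditive (a ⟶ b)] [∀ a b : B, Linear k (a ⟶ b)] {c d : B} (W : c ⟶ d) {a b : B} (X Y : a ⟶ b) : Submodule k (X ⟶ Y) :=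
  Submodule.span k
    {γ | ∃ (Z : a ⟶ b) (f : X ⟶ Z) (g : Z ⟶ Y), TwoSidedLE W Z ∧ γ = f ≫ g}

theorem map_mem_spanThrough {c d : B} {W : c ⟶ d} {a b a' b' : B} {X Y : a ⟶ b} {X' Y' : a' ⟶ b'}
    (T : (X ⟶ Y) →ₗ[k] (X' ⟶ Y'))
    (hT : ∀ (Z : a ⟶ b) (f : X ⟶ Z) (g : Z ⟶ Y), TwoSidedLE W Z →
      ∃ (Z' : a' ⟶ b') (f' : X' ⟶ Z') (g' : Z' ⟶ Y'), TwoSidedLE W Z' ∧ T (f ≫ g) = f' ≫ g')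
    {γ : X ⟶ Y} (h : γ ∈ spanThrough k W X Y) : T γ ∈ spanThrough k W X' Y' := by
  have := Submodule.mem_map_of_mem (f := T) h
  rw [spanThrough, Submodule.map_span] at this
  refine Submodule.span_mono ?_ this
  rintro _ ⟨_, ⟨Z, f, g, hZ, rfl⟩, rfl⟩
  exact hT Z f g hZ

variable [LinearTwoCategory k B]

/-- At X ∈ J every avoiding ideal lies in `radEnd`. By locality this subspace contains no
isomorphism, so the sum of these ideals misses 𝟙 as well. -/
theorem maxIdeal_avoids (hB : IsFinitaryTwoCategory k B) : (maxIdeal k J).Avoids := by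
  intro a b X hX h
  have hl := (hB.finitary_hom a b).hasLocalEnd (J.indec hX)
  have hle : (maxIdeal k J).carrier X X ≤ radEnd k X.hom := by
    refine iSup_le fun K γ hγ => (mem_radEnd hl).2 fun hi => K.2 X hX ?_
    rw [← IsIso.hom_inv_id γ]
    exact K.1.comp_mem_right (Z := X) _ hγ
  exact (mem_radEnd hl).1 (hle h) inferInstance

theorem le_maxIdeal {K : TwoIdeal k J} (hK : K.Avoids) : K ≤ maxIdeal k J :=
  fun X Y => le_iSup (fun K : {K : TwoIdeal k J // K.Avoids} => K.1.carrier X Y) ⟨K, hK⟩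

variable (k J)

def whiskerLeftₗ (k : Type u₀) [Field k] {B : Type u} [Bicategory.{w, v} B]
    [∀ a b : B, Preadditive (a ⟶ b)] [∀ a b : B, Linear k (a ⟶ b)] [LinearTwoCategory k B]
    {a b c : B} (F : a ⟶ b) (G H : b ⟶ c) : (G ⟶ H) →ₗ[k] (F ≫ G ⟶ F ≫ H) where
  toFun γ := F ◁ γ
  map_add' := LinearTwoCategory.whiskerLeft_add k F
  map_smul' := LinearTwoCategory.whiskerLeft_smul F

def whiskerRightₗ (k : Type u₀) [Field k] {B : Type u} [Bicategory.{w, v} B]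
    [∀ a b : B, Preadditive (a ⟶ b)] [∀ a b : B, Linear k (a ⟶ b)] [LinearTwoCategory k B]
    {a b c : B} (F G : a ⟶ b) (H : b ⟶ c) : (F ⟶ G) →ₗ[k] (F ≫ H ⟶ G ≫ H) where
  toFun γ := γ ▷ H
  map_add' γ δ := LinearTwoCategory.add_whiskerRight k γ δ H
  map_smul' x γ := LinearTwoCategory.smul_whiskerRight x γ H

theorem TwoIdeal.mem_of_eq {k : Type u₀} [Field k] {B : Type u} [Bicategory.{w, v} B]
    [∀ a b : B, Preadditive (a ⟶ b)] [∀ a b : B, Linear k (a ⟶ b)] [LinearTwoCategory k B]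
    {J : TwoSidedCell B} {K : TwoIdeal k J} {a b : B} {X Y : GeHom J a b} {γ δ : X.hom ⟶ Y.hom} (e : γ = δ)
    (h : δ ∈ K.carrier X Y) : γ ∈ K.carrier X Y := by
  subst e; exact h

/-- The ideal of the 2-morphisms that factor through sums of 1-morphisms `Z` with `W ≤_J Z`. -/
def idealThrough {c d : B} (W : c ⟶ d) : TwoIdeal k J where
  carrier X Y := spanThrough k W X.hom Y.hom
  comp_mem_left {_ _ V X Y} γ {δ} h :=
    map_mem_spanThrough (Linear.leftComp k Y.hom γ)
      (fun Z f g hZ => ⟨Z, γ ≫ f, g, hZ, by simp⟩) h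
  comp_mem_right {_ _ X Y V γ} δ h :=
    map_mem_spanThrough (Linear.rightComp k X.hom δ)
      (fun Z f g hZ => ⟨Z, f, g ≫ δ, hZ, by simp⟩) h
  whiskerLeft_mem {_ _ _} V {X Y} γ h :=
    map_mem_spanThrough (whiskerLeftₗ k V.hom X.hom Y.hom) (fun Z f g hZ =>
      ⟨V.hom ≫ Z, V.hom ◁ f, V.hom ◁ g, hZ.comp_left _, Bicategory.whiskerLeft_comp _ _ _⟩) h
  whiskerRight_mem {_ _ _ X Y} γ V h :=
    map_mem_spanThrough (whiskerRightₗ k X.hom Y.hom V.hom) (fun Z f g hZ =>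
      ⟨Z ≫ V.hom, f ▷ V.hom, g ▷ V.hom, hZ.comp_right _, Bicategory.comp_whiskerRight _ _ _⟩) h

variable {k J}

/-- If 𝟙 is a combination of morphisms through such Z, then by locality one of them is invertible,
and X is a summand of that Z. -/
theorem exists_retract_of_mem_idealThrough {c d : B} {W : c ⟶ d} {a b : B} {X : GeHom J a b}
    (hX : HasLocalEnd X.hom) (h : 𝟙 X.hom ∈ (idealThrough k J W).carrier X X) :
    TwoSidedLE W X.hom := by
  by_contra hW
  refine (mem_radEnd (k := k) hX).1 (?_ : 𝟙 X.hom ∈ radEnd k X.hom) inferInstance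
  refine Submodule.span_le.2 ?_ h
  rintro _ ⟨Z, f, g, hZ, rfl⟩
  refine (mem_radEnd hX).2 fun hi => hW ?_
  obtain ⟨R⟩ := nonempty_retract_of_isIso hi
  exact hZ.of_retract R

/-- The indecomposable 1-morphisms that lie strictly above `J` vanish in `C(J)`. -/
theorem id_mem_maxIdeal (hB : IsFinitaryTwoCategory k B) {a b : B} (W : GeHom J a b)
    (hW : IsIndec W.hom) (hJ : ¬ J.mem W.hom) : 𝟙 W.hom ∈ (maxIdeal k J).carrier W W := by
  obtain ⟨x, y, E, hE, hle⟩ := J.ge_of_inAdd hB hW W.mem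
  refine le_maxIdeal (K := idealThrough k J W.hom) ?_ W W (Submodule.subset_span
    ⟨W.hom, 𝟙 _, 𝟙 _, (LeftLE.refl W.hom).twoSidedLE, by simp⟩)
  -- An identity of X ∈ J in this ideal would give E ≤_J W ≤_J X with E and X in J, and so W ∈ J.
  intro c d X hX h
  exact hJ (J.mem_of_le hE hX hW hle (exists_retract_of_mem_idealThrough
    ((hB.finitary_hom c d).hasLocalEnd (J.indec hX)) h))

variable {S : Star k B}

namespace IsFiat

/-- The dual of an element of `add {F | F ≥_J J}`. -/
abbrev _root_.Fiax.GeHom.star (hS : IsFiat S) {a b : B} (X : GeHom J a b) : GeHom J b a :=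
  ⟨S.obj X.hom, hS.star_ge _ X.mem⟩

/-- The 2-morphisms whose dual lies in the maximal 2-ideal. -/
def starIdeal (hS : IsFiat S) : TwoIdeal k J where
  carrier X Y := ((maxIdeal k J).carrier (Y.star hS) (X.star hS)).comap S.map
  comp_mem_left {_ _ W X Y} γ {δ} h := by
    exact TwoIdeal.mem_of_eq (X := Y.star hS) (Y := W.star hS) (S.map_comp _ _)
      ((maxIdeal k J).comp_mem_right (Z := W.star hS) (S.map γ) h)
  comp_mem_right {_ _ X Y Z γ} δ h := by
    exact TwoIdeal.mem_of_eq (X := Z.star hS) (Y := X.star hS) (S.map_comp _ _)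
      ((maxIdeal k J).comp_mem_left (W := Z.star hS) (S.map δ) h)
  whiskerLeft_mem {_ _ _} W {X Y} γ h := by
    have e : S.map (W.hom ◁ γ) = (S.mapComp W.hom Y.hom).hom ≫ (S.map γ ▷ S.obj W.hom) ≫
        (S.mapComp W.hom X.hom).inv := by
      rw [← Category.assoc, Iso.eq_comp_inv, S.mapComp_whiskerLeft]
    exact TwoIdeal.mem_of_eq (X := (W.comp k Y).star hS) (Y := (W.comp k X).star hS) e <|
      (maxIdeal k J).comp_mem_left (W := (W.comp k Y).star hS)
      (X := (Y.star hS).comp k (W.star hS)) _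
      ((maxIdeal k J).comp_mem_right (Z := (W.comp k X).star hS) _
        ((maxIdeal k J).whiskerRight_mem (W.star hS) h))
  whiskerRight_mem {_ _ _} {X Y} γ W h := by
    have e : S.map (γ ▷ W.hom) = (S.mapComp Y.hom W.hom).hom ≫ (S.obj W.hom ◁ S.map γ) ≫
        (S.mapComp X.hom W.hom).inv := by
      rw [← Category.assoc, Iso.eq_comp_inv, S.mapComp_whiskerRight]
    exact TwoIdeal.mem_of_eq (X := (Y.comp k W).star hS) (Y := (X.comp k W).star hS) e <|
      (maxIdeal k J).comp_mem_left (W := (Y.comp k W).star hS)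
      (X := (W.star hS).comp k (Y.star hS)) _
      ((maxIdeal k J).comp_mem_right (Z := (X.comp k W).star hS) _
        ((maxIdeal k J).whiskerLeft_mem (W.star hS) h))

/-- Since ⋆ preserves J, the preimage of the maximal 2-ideal under ⋆ is again an avoiding 2-ideal.
-/
theorem mem_maxIdeal_of_star (hS : IsFiat S) {a b : B} {X Y : GeHom J a b} {γ : X.hom ⟶ Y.hom}
    (h : S.map γ ∈ (maxIdeal k J).carrier (Y.star hS) (X.star hS)) :
    γ ∈ (maxIdeal k J).carrier X Y := by
  refine le_maxIdeal (K := hS.starIdeal) ?_ X Y h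
  intro c d Z hZ h
  exact maxIdeal_avoids hS.finitary (Z.star hS) (hS.star_mem_cell hZ)
    (TwoIdeal.mem_of_eq (X := Z.star hS) (Y := Z.star hS) (S.map_id Z.hom).symm h)

/-- The reflection of the ideal under ⋆ is applied to `S.map γ`, whose dual is `γ` up to the
isomorphisms `bidual`. -/
theorem star_mem_maxIdeal (hS : IsFiat S) {a b : B} (X Y : GeHom J a b) (γ : X.hom ⟶ Y.hom)
    (h : γ ∈ (maxIdeal k J).carrier X Y) :
    S.map γ ∈ (maxIdeal k J).carrier (Y.star hS) (X.star hS) := by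
  refine hS.mem_maxIdeal_of_star ?_
  have e : S.map (S.map γ) = (hS.bidual X.hom).hom ≫ γ ≫ (hS.bidual Y.hom).inv := by
    rw [← Category.assoc, Iso.eq_comp_inv, hS.bidual_naturality]
  exact TwoIdeal.mem_of_eq (X := (X.star hS).star hS) (Y := (Y.star hS).star hS) e <|
    (maxIdeal k J).comp_mem_left (W := (X.star hS).star hS) (X := X) _
    ((maxIdeal k J).comp_mem_right (Z := (Y.star hS).star hS) _ h)

end IsFiat

end Ideals

/-! ### Closure of the classes add(L_i ∩ R_j) in C(J). -/

section Quotient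

variable {k : Type u₀} [Field k] {B : Type u} [Bicategory.{w, v} B]
  [∀ a b : B, Preadditive (a ⟶ b)] [∀ a b : B, Linear k (a ⟶ b)] [LinearTwoCategory k B]
  {J : TwoSidedCell B}

theorem QHom.mk₂_eq_iff {a b : B} {X Y : QHom k J a b} {γ δ : X.rep.hom ⟶ Y.rep.hom} :
    (QHom.mk₂ γ : X ⟶ Y) = QHom.mk₂ δ ↔ γ - δ ∈ (maxIdeal k J).carrier X.rep Y.rep :=
  Submodule.Quotient.eq _

/-- The projection to `C(J)` as a linear map. -/
def QHom.mkₗ {a b : B} (X Y : QHom k J a b) : (X.rep.hom ⟶ Y.rep.hom) →ₗ[k] (X ⟶ Y) :=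
  ((maxIdeal k J).carrier X.rep Y.rep).mkQ

theorem QHom.mk₂_sum {a b : B} {X Y : QHom k J a b} {ι : Type*} (s : Finset ι)
    (γ : ι → (X.rep.hom ⟶ Y.rep.hom)) :
    (QHom.mk₂ (∑ t ∈ s, γ t) : X ⟶ Y) = ∑ t ∈ s, QHom.mk₂ (γ t) :=
  map_sum (QHom.mkₗ X Y) γ s

def QHom.compLeftFunctor {a b : B} (W : QHom k J a b) (c : B) : QHom k J b c ⥤ QHom k J a c where
  obj X := W.comp X
  map f := W.whiskerLeft f
  map_id X := congrArg QHom.mk₂ (Bicategory.whiskerLeft_id _ _)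
  map_comp f g := by
    obtain ⟨f, rfl⟩ := QHom.mk₂_surjective f
    obtain ⟨g, rfl⟩ := QHom.mk₂_surjective g
    exact congrArg QHom.mk₂ (Bicategory.whiskerLeft_comp _ _ _)

def QHom.compRightFunctor (a : B) {b c : B} (W : QHom k J b c) : QHom k J a b ⥤ QHom k J a c where
  obj X := X.comp W
  map f := QHom.whiskerRight W f
  map_id X := congrArg QHom.mk₂ (Bicategory.id_whiskerRight _ _)
  map_comp f g := by
    obtain ⟨f, rfl⟩ := QHom.mk₂_surjective f
    obtain ⟨g, rfl⟩ := QHom.mk₂_surjective g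
    exact congrArg QHom.mk₂ (Bicategory.comp_whiskerRight f g W.rep.hom)

instance {a b : B} (W : QHom k J a b) (c : B) : (QHom.compLeftFunctor W c).Additive where
  map_add := map_add (QHom.whiskerLeft W) _ _

instance (a : B) {b c : B} (W : QHom k J b c) : (QHom.compRightFunctor a W).Additive where
  map_add := map_add (QHom.whiskerRight W) _ _

variable {S : Star k B}

namespace IsFiat

theorem leftCell_mem_of_leftLE (hS : IsFiat S) {L : LeftCell J} {b c : B} {F : L.src ⟶ b}
    {G : L.src ⟶ c} (hF : L.mem F) (hG : J.mem G) (h : LeftLE F G) : L.mem G :=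
  (LeftCell.mem_iff hF G).2 ⟨J.indec hG, h, J.leftLE_symm hS.finitary (L.mem_twoSidedCell hF) hG h⟩

theorem leftCell_mem_congr (hS : IsFiat S) {L : LeftCell J} {b : B} {F G : L.src ⟶ b}
    (hF : L.mem F) (e : F ≅ G) : L.mem G :=
  hS.leftCell_mem_of_leftLE hF (J.mem_congr hS.finitary (L.mem_twoSidedCell hF) e)
    ((LeftLE.refl F).of_retract (Retract.ofIso e.symm))

theorem starMem_iff (hS : IsFiat S) {L : LeftCell J} {c : B} {F : c ⟶ L.src} :
    L.starMem S F ↔ L.mem (S.obj F) := by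
  constructor
  · rintro ⟨G, hG, ⟨e⟩⟩
    exact hS.leftCell_mem_congr hG ((hS.bidual G).symm ≪≫ S.mapIso e.symm)
  · intro h
    exact ⟨S.obj F, h, ⟨(hS.bidual F).symm⟩⟩

theorem cellMem_star (hS : IsFiat S) {i j : LeftCell J} {F : i.src ⟶ j.src}
    (h : cellMem S i j F) : cellMem S j i (S.obj F) :=
  ⟨hS.starMem_iff.1 h.2, ⟨F, h.1, ⟨Iso.refl _⟩⟩⟩

/-- F ≤_L W and, after dualising, G⋆ ≤_L W⋆. Symmetry of ≤_L inside J turns both relations into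
membership in a left cell. -/
theorem cellMem_of_retract_comp (hS : IsFiat S) {i j l : LeftCell J} {F : i.src ⟶ j.src}
    {G : j.src ⟶ l.src} (hF : cellMem S i j F) (hG : cellMem S j l G) {W : i.src ⟶ l.src}
    (hW : J.mem W) (R : Retract W (F ≫ G)) : cellMem S i l W := by
  refine ⟨hS.leftCell_mem_of_leftLE hF.1 hW ⟨G, ⟨R⟩⟩, hS.starMem_iff.2 ?_⟩
  exact hS.leftCell_mem_of_leftLE (hS.starMem_iff.1 hG.2) (hS.star_mem_cell hW)
    ⟨S.obj F, ⟨(S.mapRetract R).trans (Retract.ofIso (S.mapComp F G))⟩⟩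

/-- The composite is decomposed in the fiat 2-category. Summands outside J have zero identity in
C(J) and drop out of the sum; those in J belong to the required cells. -/
theorem CJMem_comp_of_cellMem (hS : IsFiat S) {i j l : LeftCell J} {X : QHom k J i.src j.src}
    {Y : QHom k J j.src l.src} (hX : cellMem S i j X.rep.hom) (hY : cellMem S j l Y.rep.hom) :
    CJMem S i l (X.comp Y) := by
  classical
  obtain ⟨ι, _, f, s, r, hsum, hf⟩ :=
    (hS.finitary.finitary_hom i.src l.src).exists_isDirectSum (X.rep.hom ≫ Y.rep.hom)
  let R : ∀ t, Retract (f t) (X.rep.hom ≫ Y.rep.hom) := fun t => ⟨r t, s t, hsum.inj_proj t⟩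
  let W : ι → QHom k J i.src l.src := fun t =>
    ⟨⟨f t, (X.comp Y).rep.mem.of_retract (R t)⟩⟩
  let s' : ∀ t, X.comp Y ⟶ W t := fun t => QHom.mk₂ (s t)
  let r' : ∀ t, W t ⟶ X.comp Y := fun t => QHom.mk₂ (r t)
  have htot : ∑ t, s' t ≫ r' t = 𝟙 (X.comp Y) := by
    refine (QHom.mk₂_sum (X := X.comp Y) (Y := X.comp Y) Finset.univ fun t => s t ≫ r t).symm.trans ?_
    exact congrArg (QHom.mk₂ (X := X.comp Y) (Y := X.comp Y)) hsum.total
  refine InAdd.of_fintype (ι := {t // J.mem (f t)}) (fun t => W t.1) (fun t => s' t.1)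
    (fun t => r' t.1) (fun t => hS.cellMem_of_retract_comp hX hY t.2 (R t.1)) ?_
  rw [← htot, ← Finset.sum_subtype (Finset.univ.filter fun t => J.mem (f t)) (by simp)
    (fun t => s' t ≫ r' t)]
  refine Finset.sum_subset (Finset.subset_univ _) fun t _ ht => ?_
  have h0 : 𝟙 (W t) = 0 := (Submodule.Quotient.mk_eq_zero _).2
    (id_mem_maxIdeal hS.finitary (W t).rep (hf t) fun h => ht (by simpa using h))
  rw [← Category.comp_id (s' t), h0, comp_zero, zero_comp]

theorem isCellClosed (hS : IsFiat S) : IsCellClosed J S where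
  comp_mem {i j l} X Y hX hY := by
    refine InAdd.trans (InAdd.map (QHom.compRightFunctor i.src Y) hX
      (Q := fun Z => ∃ X' : QHom k J i.src j.src, cellMem S i j X'.rep.hom ∧ Z = X'.comp Y)
      fun X' hX' => ⟨X', hX', rfl⟩) ?_
    rintro _ ⟨X', hX', rfl⟩
    refine InAdd.trans (InAdd.map (QHom.compLeftFunctor X' l.src) hY
      (Q := fun Z => ∃ Y' : QHom k J j.src l.src, cellMem S j l Y'.rep.hom ∧ Z = X'.comp Y')
      fun Y' hY' => ⟨Y', hY', rfl⟩) ?_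
    rintro _ ⟨Y', hY', rfl⟩
    exact hS.CJMem_comp_of_cellMem hX' hY'
  star_ge := hS.star_ge
  star_ideal := hS.star_mem_maxIdeal
  star_mem {i j} X h := by
    obtain ⟨n, f, s, r, hf, hs⟩ := h
    choose s' hs' using fun t => QHom.mk₂_surjective (s t)
    choose r' hr' using fun t => QHom.mk₂_surjective (r t)
    let f' : Fin n → QHom k J j.src i.src := fun t => ⟨(f t).rep.star hS⟩
    let X' : QHom k J j.src i.src := ⟨X.rep.star hS⟩
    refine ⟨n, f', fun t => (QHom.mk₂ (S.map (r' t)) : X' ⟶ f' t),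
      fun t => (QHom.mk₂ (S.map (s' t)) : f' t ⟶ X'), fun t => hS.cellMem_star (hf t), ?_⟩
    -- On representatives the decomposition of 𝟙 holds only modulo the maximal 2-ideal; stability of
    -- that ideal under ⋆ carries the relation over to the dual.
    have h1 : ∑ t, s' t ≫ r' t - 𝟙 _ ∈ (maxIdeal k J).carrier X.rep X.rep := by
      rw [← QHom.mk₂_eq_iff, QHom.mk₂_sum, QHom.mk₂_id, ← hs]
      exact Finset.sum_congr rfl fun t _ => by rw [hs', hr', QHom.mk₂_comp]
    have h2 := hS.star_mem_maxIdeal _ _ _ h1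
    rw [map_sub, map_sum, S.map_id] at h2
    simp only [S.map_comp] at h2
    refine ((QHom.mk₂_sum (X := X') (Y := X') Finset.univ
      fun t => S.map (r' t) ≫ S.map (s' t)).symm).trans ?_
    exact QHom.mk₂_eq_iff.2 h2

end IsFiat

end Quotient

/-! ### Finitarity of quotient categories. -/

section LocalQuotient

variable (k : Type u₀) [Field k] (A : Type u) [Category.{v} A] [Preadditive A] [Linear k A]
  (Q : Type u') [Category.{v'} Q] [Preadditive Q] [Linear k Q]

/-- A presentation of the morphism spaces of `Q` as quotients of those of `A`. -/
structure HomQuotient where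
  obj : Q → A
  proj : ∀ X Y : Q, (obj X ⟶ obj Y) →ₗ[k] (X ⟶ Y)
  surjective : ∀ X Y, Function.Surjective (proj X Y)
  proj_id : ∀ X, proj X X (𝟙 (obj X)) = 𝟙 X
  proj_comp : ∀ {X Y Z : Q} (f : obj X ⟶ obj Y) (g : obj Y ⟶ obj Z),
    proj X Z (f ≫ g) = proj X Y f ≫ proj Y Z g

namespace HomQuotient

variable {k A Q} (H : HomQuotient k A Q)

def mapIso {X Y : Q} (e : H.obj X ≅ H.obj Y) : X ≅ Y where
  hom := H.proj X Y e.hom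
  inv := H.proj Y X e.inv
  hom_inv_id := by rw [← H.proj_comp, e.hom_inv_id, H.proj_id]
  inv_hom_id := by rw [← H.proj_comp, e.inv_hom_id, H.proj_id]

/-- The projection on endomorphism rings. -/
def endHom (X : Q) : End (H.obj X) →+* End X where
  toFun f := H.proj X X f
  map_one' := H.proj_id X
  map_mul' f g := H.proj_comp g f
  map_zero' := map_zero _
  map_add' := map_add _

theorem hasLocalEnd {X : Q} (hX : HasLocalEnd (H.obj X)) (h0 : 𝟙 X ≠ 0) : HasLocalEnd X where
  id_ne := h0
  nilpotent_or_isIso f := by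
    obtain ⟨g, rfl⟩ := H.surjective X X f
    rcases hX.nilpotent_or_isIso g with hn | h
    · exact Or.inl (IsNilpotent.map hn (H.endHom X))
    · exact Or.inr (H.mapIso (asIso (g : H.obj X ⟶ H.obj X))).isIso_hom

/-- Direct sums and split idempotents are formed in `A`; `hsum` and `hret` say that the resulting
objects come from `Q`. By `hgen` the indecomposables of `Q` are represented by objects that are
indecomposable in `A`. -/
theorem isFinitaryCategory (hA : IsFinitaryCategory k A)
    (hsum : ∀ (n : ℕ) (f : Fin n → Q) (Z : A) (s : ∀ t, Z ⟶ H.obj (f t)) (r : ∀ t, H.obj (f t) ⟶ Z),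
      IsDirectSum Z (fun t => H.obj (f t)) s r → ∃ X : Q, H.obj X = Z)
    (hret : ∀ (X : Q) (Y : A), Retract Y (H.obj X) → ∃ Y' : Q, H.obj Y' = Y)
    (hgen : ∀ X : Q, InAdd (fun Y : Q => IsIndec (H.obj Y)) X) : IsFinitaryCategory k Q := by
  have := hA.finite_hom
  have := hA.isIdempotentComplete
  have := hA.hasFiniteBiproducts
  have hfin : ∀ X Y : Q, Module.Finite k (X ⟶ Y) := fun X Y =>
    Module.Finite.of_surjective _ (H.surjective X Y)
  have hidem : IsIdempotentComplete Q := by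
    refine ⟨fun X p hp => ?_⟩
    have : Module.Finite k (End (H.obj X)) := inferInstanceAs (Module.Finite k (H.obj X ⟶ H.obj X))
    obtain ⟨a, rfl⟩ := H.surjective X X p
    obtain ⟨e, he, hea⟩ := exists_idempotent_lift (k := k) (H.endHom X) a hp
    obtain ⟨Y, i, r, h1, h2⟩ := IsIdempotentComplete.idempotents_split (H.obj X) e he
    obtain ⟨Y, rfl⟩ := hret X Y ⟨i, r, h1⟩
    refine ⟨Y, H.proj Y X i, H.proj X Y r, ?_, ?_⟩
    · rw [← H.proj_comp, h1, H.proj_id]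
    · rw [← H.proj_comp, h2]
      exact hea
  have hloc : ∀ X : Q, IsIndec X → HasLocalEnd X := fun X hX =>
    hasLocalEnd_of_idempotents k (fun h => hX.1 ((IsZero.iff_id_eq_zero X).2 h))
      fun e he => hX.eq_zero_or_eq_id e he
  have hrep : ∀ X : Q, IsIndec X → ∃ Y : Q, IsIndec (H.obj Y) ∧ Nonempty (X ≅ Y) := by
    intro X hX
    obtain ⟨Y, hY, ⟨R⟩⟩ := (hloc X hX).exists_retract_of_inAdd (hgen X)
    refine ⟨Y, hY, (hloc X hX).nonempty_iso_of_retract (H.hasLocalEnd (hA.hasLocalEnd hY) ?_) R⟩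
    intro h
    apply (hloc X hX).id_ne
    rw [← R.retract, ← Category.comp_id R.i, h, comp_zero, zero_comp]
  refine ⟨⟨fun n => ⟨fun f => ?_⟩⟩, hidem, hfin, ?_⟩
  · obtain ⟨Z, s, r, hd⟩ : ∃ Z s r, IsDirectSum Z (fun t => H.obj (f t)) s r :=
      ⟨_, _, _, ⟨biproduct.total, fun t => biproduct.ι_π_self (fun t => H.obj (f t)) t,
        fun t u h => biproduct.ι_π_ne _ h⟩⟩
    obtain ⟨X, rfl⟩ := hsum n f _ _ _ hd
    refine HasBiproduct.mk ⟨⟨X, fun t => H.proj X (f t) (s t), fun t => H.proj (f t) X (r t), ?_⟩,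
      isBilimitOfTotal _ ?_⟩
    · intro t u
      rw [← H.proj_comp]
      split_ifs with h
      · subst h
        rw [hd.inj_proj, H.proj_id, eqToHom_refl]
      · rw [hd.inj_proj_ne _ _ h, map_zero]
    · rw [← H.proj_id, ← hd.total, map_sum]
      exact Finset.sum_congr rfl fun t _ => (H.proj_comp _ _).symm
  · obtain ⟨n, f, hf⟩ := hA.finite_indec
    -- Indecomposables of `A` need not come from `Q`, so only the isomorphism classes that do are
    -- listed.
    let T := {t // ∃ Y : Q, IsIndec (H.obj Y) ∧ Nonempty (H.obj Y ≅ f t)}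
    let g : T → Q := fun t => t.2.choose
    refine ⟨Nat.card T, g ∘ (Finite.equivFin T).symm, fun X hX => ?_⟩
    obtain ⟨Y, hY, ⟨e⟩⟩ := hrep X hX
    obtain ⟨t, ⟨e'⟩⟩ := hf _ hY
    let t' : T := ⟨t, Y, hY, ⟨e'⟩⟩
    refine ⟨Finite.equivFin T t', ⟨?_⟩⟩
    rw [Function.comp_apply, Equiv.symm_apply_apply]
    exact e ≪≫ H.mapIso (e' ≪≫ t'.2.choose_spec.2.some.symm)

end HomQuotient

end LocalQuotient

/-! ### Representatives of 2-morphisms of C_J and the bilax-unital axioms. -/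

section CJ

variable {k : Type u₀} [Field k] {B : Type u} [Bicategory.{w, v} B] [Bicategory.Strict B]
  [∀ a b : B, Preadditive (a ⟶ b)] [∀ a b : B, Linear k (a ⟶ b)] [LinearTwoCategory k B]
  {J : TwoSidedCell B} {S : Star k B}

namespace CJ

variable {h : IsCellClosed J S}

/-- The 1-morphism of the fiat 2-category that underlies a 1-morphism of `C_J`. -/
abbrev rep {i j : (CJ h).Obj} (F : (CJ h).Hom i j) : LeftCell.src i ⟶ LeftCell.src j :=
  F.hom.rep.hom

/-- The class in `C_J` of a 2-morphism of the fiat 2-category. -/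
def mk {i j : (CJ h).Obj} {F G : (CJ h).Hom i j} : (rep F ⟶ rep G) →ₗ[k] (F ⟶ G) :=
  QHom.mkₗ F.hom G.hom

theorem mk_surjective {i j : (CJ h).Obj} {F G : (CJ h).Hom i j} (f : F ⟶ G) :
    ∃ γ, f = mk γ :=
  QHom.mk₂_surjective f

theorem mk_id {i j : (CJ h).Obj} (F : (CJ h).Hom i j) : mk (𝟙 (rep F)) = 𝟙 F := rfl

theorem mk_comp {i j : (CJ h).Obj} {F G H : (CJ h).Hom i j} (γ : rep F ⟶ rep G)
    (δ : rep G ⟶ rep H) : (mk (γ ≫ δ) : F ⟶ H) = (mk γ : F ⟶ G) ≫ (mk δ : G ⟶ H) := rfl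

theorem mk_eq_iff {i j : (CJ h).Obj} {F G : (CJ h).Hom i j} {γ δ : rep F ⟶ rep G} :
    (mk γ : F ⟶ G) = mk δ ↔ γ - δ ∈ (maxIdeal k J).carrier F.hom.rep G.hom.rep :=
  QHom.mk₂_eq_iff

/-- By strictness both associators are `eqToHom`s, so identities in C_J can be checked on
representatives by bicategorical coherence. -/
theorem associator_hom {i j l m : (CJ h).Obj} (F : (CJ h).Hom i j) (G : (CJ h).Hom j l)
    (H : (CJ h).Hom l m) :
    (TwoSemicat.associator F G H).hom = mk (F := (CJ h).comp ((CJ h).comp F G) H)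
      (G := (CJ h).comp F ((CJ h).comp G H)) (α_ (rep F) (rep G) (rep H)).hom := by
  rw [Bicategory.Strict.associator_eqToIso]
  exact (TwoSemicat.FullHom.eqToHom_eq (LeftCell.obj k) (CJMem S) ((CJ h).assoc F G H)).trans
    (QHom.mk₂_eqToHom _)

theorem associator_inv {i j l m : (CJ h).Obj} (F : (CJ h).Hom i j) (G : (CJ h).Hom j l)
    (H : (CJ h).Hom l m) :
    (TwoSemicat.associator F G H).inv = mk (F := (CJ h).comp F ((CJ h).comp G H))
      (G := (CJ h).comp ((CJ h).comp F G) H) (α_ (rep F) (rep G) (rep H)).inv := by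
  rw [Bicategory.Strict.associator_eqToIso]
  exact (TwoSemicat.FullHom.eqToHom_eq (LeftCell.obj k) (CJMem S) ((CJ h).assoc F G H).symm).trans
    (QHom.mk₂_eqToHom _)

/-- Every axiom holds already for representatives in the fiat 2-category, by the interchange law and
coherence of the unitors. -/
theorem isBilaxUnital (D : ∀ i : LeftCell J, i.src ⟶ i.src) (d : ∀ i, D i ⟶ 𝟙 i.src)
    (hD : ∀ i, cellMem S i i (D i)) : TwoSemicat.IsBilaxUnital (CJ.units h D d hD) where
  l_naturality {_ i F F'} γ := by
    obtain ⟨γ, rfl⟩ := mk_surjective γ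
    refine congrArg mk (?_ : γ ▷ D i ≫ rep F' ◁ d i ≫ (ρ_ _).hom = (rep F ◁ d i ≫ (ρ_ _).hom) ≫ γ)
    rw [← whisker_exchange_assoc]; simp
  r_naturality {i _ G G'} γ := by
    obtain ⟨γ, rfl⟩ := mk_surjective γ
    refine congrArg mk (?_ : D i ◁ γ ≫ d i ▷ rep G' ≫ (λ_ _).hom = (d i ▷ rep G ≫ (λ_ _).hom) ≫ γ)
    rw [whisker_exchange_assoc]; simp
  l_r {_ i _} F G := by
    rw [associator_hom]
    refine congrArg (mk (F := (CJ h).comp ((CJ h).comp F ((CJ.units h D d hD).I i)) G)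
      (G := (CJ h).comp F G)) (?_ : (rep F ◁ d i ≫ (ρ_ _).hom) ▷ rep G =
      (α_ _ _ _).hom ≫ rep F ◁ (d i ▷ rep G ≫ (λ_ _).hom))
    simp
  l_comp {_ _ i} H F := by
    rw [associator_hom]
    refine congrArg mk (?_ : (α_ _ _ _).hom ≫ rep H ◁ (rep F ◁ d i ≫ (ρ_ _).hom) =
      (rep H ≫ rep F) ◁ d i ≫ (ρ_ _).hom)
    simp
  r_comp {i _ _} G K := by
    rw [associator_hom]
    refine congrArg mk (?_ : (α_ _ _ _).hom ≫ d i ▷ (rep G ≫ rep K) ≫ (λ_ _).hom =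
      (d i ▷ rep G ≫ (λ_ _).hom) ▷ rep K)
    simp
  l'_naturality {_ i F F'} γ := by
    obtain ⟨γ, rfl⟩ := mk_surjective γ
    refine congrArg mk (?_ : ((ρ_ _).inv ≫ rep F ◁ S.dual (d i)) ≫ γ ▷ S.obj (D i) =
      γ ≫ (ρ_ _).inv ≫ rep F' ◁ S.dual (d i))
    rw [Category.assoc, whisker_exchange]; simp
  r'_naturality {i _ G G'} γ := by
    obtain ⟨γ, rfl⟩ := mk_surjective γ
    refine congrArg mk (?_ : ((λ_ _).inv ≫ S.dual (d i) ▷ rep G) ≫ S.obj (D i) ◁ γ =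
      γ ≫ (λ_ _).inv ≫ S.dual (d i) ▷ rep G')
    rw [Category.assoc, ← whisker_exchange]; simp
  l'_r' {_ i _} F G := by
    rw [associator_hom]
    refine congrArg mk (?_ : ((ρ_ _).inv ≫ rep F ◁ S.dual (d i)) ▷ rep G ≫ (α_ _ _ _).hom =
      rep F ◁ ((λ_ _).inv ≫ S.dual (d i) ▷ rep G))
    simp
  l'_comp {_ _ i} H F := by
    rw [associator_hom]
    refine congrArg mk (?_ : ((ρ_ _).inv ≫ (rep H ≫ rep F) ◁ S.dual (d i)) ≫ (α_ _ _ _).hom =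
      rep H ◁ ((ρ_ _).inv ≫ rep F ◁ S.dual (d i)))
    simp
  r'_comp {i _ _} G K := by
    rw [associator_hom]
    refine congrArg mk (?_ : ((λ_ _).inv ≫ S.dual (d i) ▷ rep G) ▷ rep K ≫ (α_ _ _ _).hom =
      (λ_ _).inv ≫ S.dual (d i) ▷ (rep G ≫ rep K))
    simp

end CJ

end CJ

/-! ### Finitarity of C_J and the induced weak involution. -/

section CJ

variable {k : Type u₀} [Field k] {B : Type u} [Bicategory.{w, v} B] [Bicategory.Strict B]
  [∀ a b : B, Preadditive (a ⟶ b)] [∀ a b : B, Linear k (a ⟶ b)] [LinearTwoCategory k B]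
  {J : TwoSidedCell B} {S : Star k B}

/-- A left cell is determined by its source and by the isomorphism classes of indecomposables in it,
for which there are finitely many possibilities. -/
theorem IsFiat.finite_leftCell {B : Type u} [Bicategory.{w, v} B]
    [∀ a b : B, Preadditive (a ⟶ b)] [∀ a b : B, Linear k (a ⟶ b)] [LinearTwoCategory k B]
    {J : TwoSidedCell B} {S : Star k B} (hS : IsFiat S) : Finite (LeftCell J) := by
  have := hS.finitary.finite_obj
  have : ∀ a b : B, Finite (IndecClass (a ⟶ b)) := fun a b =>
    (hS.finitary.finitary_hom a b).finite_indecClass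
  let Φ : LeftCell J → Σ a : B, Set (Σ b : B, IndecClass (a ⟶ b)) :=
    fun L => ⟨L.src, {x | L.mem x.2.rep}⟩
  have key : ∀ (L : LeftCell J) (m : ∀ {b : B}, (L.src ⟶ b) → Prop)
      (hm : ∃ (b : B) (F : L.src ⟶ b), J.mem F ∧
        ∀ {c : B} (G : L.src ⟶ c), m G ↔ IsIndec G ∧ LeftLE F G ∧ LeftLE G F) {b : B} (F : L.src ⟶ b),
      (∀ c : IndecClass (L.src ⟶ b), L.mem c.rep → m c.rep) → L.mem F → m F := by
    intro L m hm b F hc hF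
    obtain ⟨c, ⟨e⟩⟩ := (hS.finitary.finitary_hom _ b).exists_indecClass (LeftCell.indec hF)
    exact hS.leftCell_mem_congr (L := ⟨L.src, m, hm⟩) (hc c (hS.leftCell_mem_congr hF e)) e.symm
  refine Finite.of_injective Φ ?_
  rintro ⟨a, m, hm⟩ ⟨a', m', hm'⟩ hLM
  obtain ⟨rfl, hset⟩ := Sigma.mk.inj_iff.1 hLM
  have hset := Set.ext_iff.1 (eq_of_heq hset)
  have : @m = @m' := by
    funext b F
    exact propext ⟨key ⟨a, m, hm⟩ m' hm' F fun c => (hset ⟨b, c⟩).1,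
      key ⟨a, m', hm'⟩ m hm F fun c => (hset ⟨b, c⟩).2⟩
  subst this
  rfl

namespace CJ

variable {h : IsCellClosed J S}

theorem mk_sum {i j : (CJ h).Obj} {F G : (CJ h).Hom i j} {ι : Type*} (s : Finset ι)
    (γ : ι → (rep F ⟶ rep G)) : (mk (∑ t ∈ s, γ t) : F ⟶ G) = ∑ t ∈ s, mk (γ t) :=
  map_sum mk γ s

/-- The morphism spaces of `C_J` are quotients of those of the fiat 2-category. -/
def homQuotient (i j : (CJ h).Obj) :
    HomQuotient k (LeftCell.src i ⟶ LeftCell.src j) ((CJ h).Hom i j) where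
  obj := rep
  proj _ _ := mk
  surjective _ _ f := (mk_surjective f).imp fun _ e => e.symm
  proj_id := mk_id
  proj_comp := mk_comp

/-- A retract of a 1-morphism of `C_J` as a 1-morphism of `C_J`. -/
def ofRetract {i j : (CJ h).Obj} (X : (CJ h).Hom i j) {Y : LeftCell.src i ⟶ LeftCell.src j}
    (R : Retract Y (rep X)) : (CJ h).Hom i j where
  hom := ⟨⟨Y, X.hom.rep.mem.of_retract R⟩⟩
  mem := by
    refine InAdd.of_retract X.mem ⟨QHom.mk₂ R.i, QHom.mk₂ R.r, ?_⟩
    exact congrArg QHom.mk₂ R.retract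

theorem exists_of_isDirectSum {i j : (CJ h).Obj} {n : ℕ} (f : Fin n → (CJ h).Hom i j)
    (Z : LeftCell.src i ⟶ LeftCell.src j) (s : ∀ t, Z ⟶ rep (f t)) (r : ∀ t, rep (f t) ⟶ Z)
    (hd : IsDirectSum Z (fun t => rep (f t)) s r) : ∃ X : (CJ h).Hom i j, rep X = Z := by
  let W : QHom k J (LeftCell.src i) (LeftCell.src j) := ⟨⟨Z, InAdd.trans
    (P := fun Y => ∃ t, Y = rep (f t)) ⟨n, _, s, r, fun t => ⟨t, rfl⟩, hd.total⟩
    (by rintro _ ⟨t, rfl⟩; exact (f t).hom.rep.mem)⟩⟩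
  refine ⟨⟨W, InAdd.trans (P := fun Y => ∃ t, Y = (f t).hom)
    ⟨n, _, fun t => QHom.mk₂ (s t), fun t => QHom.mk₂ (r t), fun t => ⟨t, rfl⟩, ?_⟩
    (by rintro _ ⟨t, rfl⟩; exact (f t).mem)⟩, rfl⟩
  refine (QHom.mk₂_sum (X := W) (Y := W) Finset.univ fun t => s t ≫ r t).symm.trans ?_
  exact congrArg (QHom.mk₂ (X := W) (Y := W)) hd.total

theorem inAdd_cellMem {i j : (CJ h).Obj} (X : (CJ h).Hom i j) :
    InAdd (fun Y : (CJ h).Hom i j => cellMem S i j (rep Y)) X := by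
  obtain ⟨n, f, s, r, hf, hs⟩ := X.mem
  exact ⟨n, fun t => ⟨f t, InAdd.of_mem (hf t)⟩, s, r, hf, hs⟩

theorem isFinitaryCategory (hS : IsFiat S) (i j : (CJ h).Obj) :
    IsFinitaryCategory k ((CJ h).Hom i j) := by
  refine (homQuotient i j).isFinitaryCategory (hS.finitary.finitary_hom _ _)
    (fun n f Z s r hd => exists_of_isDirectSum f Z s r hd)
    (fun X Y R => ⟨ofRetract X R, rfl⟩) (fun X => ?_)
  obtain ⟨n, f, s, r, hf, hs⟩ := inAdd_cellMem X
  exact ⟨n, f, s, r, fun t => LeftCell.indec (hf t).1, hs⟩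

theorem isIndec_of_cellMem (hS : IsFiat S) {i j : (CJ h).Obj} (F : (CJ h).Hom i j)
    (hF : cellMem S i j (rep F)) : IsIndec F := by
  refine ((homQuotient i j).hasLocalEnd (X := F) (hS.hasLocalEnd (LeftCell.indec hF.1)) ?_).isIndec
  intro h0
  refine maxIdeal_avoids hS.finitary F.hom.rep (LeftCell.mem_twoSidedCell i hF.1) ?_
  have : (mk (𝟙 (rep F)) : F ⟶ F) = mk 0 := by rw [mk_id, h0, map_zero]
  have := mk_eq_iff.1 this
  rw [sub_zero] at this
  exact this

theorem isFinitaryBilaxUnital (hS : IsFiat S) (D : ∀ i : LeftCell J, i.src ⟶ i.src)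
    (d : ∀ i, D i ⟶ 𝟙 i.src) (hD : ∀ i, cellMem S i i (D i)) :
    TwoSemicat.IsFinitaryBilaxUnital (CJ.units h D d hD) where
  bilaxUnital := isBilaxUnital D d hD
  finite_obj := hS.finite_leftCell (J := J)
  finitary_hom := isFinitaryCategory hS
  indec_lax i := isIndec_of_cellMem hS _ (hD i)
  indec_oplax i := isIndec_of_cellMem hS _ (hS.cellMem_star (hD i))

theorem star_map_mk {i j : (CJ h).Obj} {F G : (CJ h).Hom i j} (γ : rep F ⟶ rep G) :
    (CJ.star h).map (mk γ : F ⟶ G) =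
      mk (F := (CJ.star h).obj G) (G := (CJ.star h).obj F) (S.map γ) := rfl

theorem star_isEquivalence (hS : IsFiat S) : (CJ.star h).IsEquivalence where
  map_id F := congrArg (mk (F := (CJ.star h).obj F) (G := (CJ.star h).obj F)) (S.map_id (rep F))
  map_comp {_ _ F G H} γ δ := by
    obtain ⟨γ, rfl⟩ := mk_surjective γ
    obtain ⟨δ, rfl⟩ := mk_surjective δ
    exact congrArg (mk (F := (CJ.star h).obj H) (G := (CJ.star h).obj F)) (S.map_comp γ δ)
  mapComp_whiskerLeft F G G' γ := by
    obtain ⟨γ, rfl⟩ := mk_surjective γ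
    exact congrArg (mk (F := (CJ.star h).obj ((CJ h).comp F G'))
      (G := (CJ h).comp ((CJ.star h).obj G) ((CJ.star h).obj F))) (S.mapComp_whiskerLeft (rep F) γ)
  mapComp_whiskerRight {_ _ _ F F'} γ G := by
    obtain ⟨γ, rfl⟩ := mk_surjective γ
    exact congrArg (mk (F := (CJ.star h).obj ((CJ h).comp F' G))
      (G := (CJ h).comp ((CJ.star h).obj G) ((CJ.star h).obj F))) (S.mapComp_whiskerRight γ (rep G))
  mapComp_assoc F G H := by
    rw [associator_hom, associator_hom]
    exact congrArg (mk (F := (CJ.star h).obj ((CJ h).comp F ((CJ h).comp G H)))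
      (G := (CJ h).comp ((CJ.star h).obj H) ((CJ h).comp ((CJ.star h).obj G) ((CJ.star h).obj F))))
      (S.mapComp_assoc (rep F) (rep G) (rep H))
  map_bijective F G := by
    constructor
    · intro γ δ e
      obtain ⟨γ, rfl⟩ := mk_surjective γ
      obtain ⟨δ, rfl⟩ := mk_surjective δ
      -- Faithfulness on the quotient says that ⋆ reflects the maximal 2-ideal.
      refine mk_eq_iff.2 (hS.mem_maxIdeal_of_star ?_)
      have e' := (mk_eq_iff (F := (CJ.star h).obj G) (G := (CJ.star h).obj F)
        (γ := S.map γ) (δ := S.map δ)).1 e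
      exact TwoIdeal.mem_of_eq (X := G.hom.rep.star hS) (Y := F.hom.rep.star hS) (map_sub S.map γ δ) e'
    · intro γ
      obtain ⟨γ, rfl⟩ := mk_surjective γ
      obtain ⟨γ, rfl⟩ := (hS.map_bijective (rep F) (rep G)).2 γ
      exact ⟨mk γ, rfl⟩
  ess_surj {i j} G := ⟨(CJ.star h).obj G,
    ⟨(homQuotient j i).mapIso (X := (CJ.star h).obj ((CJ.star h).obj G)) (Y := G)
      (hS.bidual (rep G))⟩⟩

theorem star_isInvolutive (hS : IsFiat S) : (CJ.star h).IsInvolutive := by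
  obtain ⟨θ, h1, h2⟩ := hS.involutive
  refine ⟨fun {i j} F => (homQuotient i j).mapIso (X := (CJ.star h).obj ((CJ.star h).obj F)) (Y := F)
      (θ (rep F)), ?_, ?_⟩
  · intro i j F G γ
    obtain ⟨γ, rfl⟩ := mk_surjective γ
    exact congrArg (mk (F := (CJ.star h).obj ((CJ.star h).obj F)) (G := G)) (h1 γ)
  · intro i j l F G
    exact congrArg (mk (F := (CJ.star h).obj ((CJ.star h).obj ((CJ h).comp F G)))
      (G := (CJ h).comp F G)) (h2 (rep F) (rep G))

end CJ

end CJ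

/-! ### Zigzags and mates through factored units and counits. -/

section Adjunctions

variable {B : Type u} [Bicategory.{w, v} B]

/-- By interchange `e` and `e'` slide out of the zigzag, which leaves the triangle identity of `adj`
between them. -/
theorem zigzag_eq_comp_of_factorization {a b : B} {f : a ⟶ b} {g : b ⟶ a} (adj : f ⊣ g) {D : b ⟶ b}
    {D' : a ⟶ a} {d : D ⟶ 𝟙 b} {d' : 𝟙 a ⟶ D'} {e e' : f ⟶ f} {η : D' ⟶ f ≫ g} {β : g ≫ f ⟶ D}
    (hη : d' ≫ η = adj.unit ≫ e ▷ g) (hβ : β ≫ d = g ◁ e' ≫ adj.counit) :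
    ((λ_ f).inv ≫ d' ▷ f) ≫ η ▷ f ≫ (α_ f g f).hom ≫ f ◁ β ≫ f ◁ d ≫ (ρ_ f).hom = e' ≫ e := by
  calc _ = (λ_ f).inv ≫ (d' ≫ η) ▷ f ≫ (α_ f g f).hom ≫ f ◁ (β ≫ d) ≫ (ρ_ f).hom := by simp
    _ = 𝟙 _ ⊗≫ adj.unit ▷ f ⊗≫ (e ▷ (g ≫ f) ≫ f ◁ g ◁ e') ⊗≫ f ◁ adj.counit ⊗≫ 𝟙 _ := by
        rw [hη, hβ]; bicategory
    _ = 𝟙 _ ⊗≫ (adj.unit ▷ f ≫ (f ≫ g) ◁ e') ⊗≫ (e ▷ (g ≫ f) ≫ f ◁ adj.counit) ⊗≫ 𝟙 _ := by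
        rw [← whisker_exchange]; bicategory
    _ = e' ⊗≫ leftZigzag adj.unit adj.counit ⊗≫ e := by
        rw [← whisker_exchange, ← whisker_exchange]; bicategory
    _ = e' ≫ e := by rw [adj.left_triangle]; bicategory

/-- Serves two fiax axioms: γ = 𝟙 gives the second triangle identity, and general γ the formula for
⋆ on 2-morphisms. -/
theorem mate_eq_conjugateEquiv_of_factorization {a b : B} {f f' : a ⟶ b} {g g' : b ⟶ a}
    (adj : f ⊣ g) (adj' : f' ⊣ g') {D : b ⟶ b} {D' : a ⟶ a} {d : D ⟶ 𝟙 b} {d' : 𝟙 a ⟶ D'}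
    {e : f ⟶ f} {e' : f' ⟶ f'} {η : D' ⟶ f ≫ g} {β : g' ≫ f' ⟶ D}
    (hη : d' ≫ η = adj.unit ≫ e ▷ g) (hβ : β ≫ d = g' ◁ e' ≫ adj'.counit) (γ : f ⟶ f') :
    ((ρ_ g').inv ≫ g' ◁ d') ≫ g' ◁ η ≫ g' ◁ γ ▷ g ≫ (α_ g' f' g).inv ≫ β ▷ g ≫ d ▷ g ≫
      (λ_ g).hom = conjugateEquiv adj' adj (e ≫ γ ≫ e') := by
  rw [conjugateEquiv_apply']
  calc _ = (ρ_ g').inv ≫ g' ◁ (d' ≫ η) ≫ g' ◁ γ ▷ g ≫ (α_ g' f' g).inv ≫ (β ≫ d) ▷ g ≫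
        (λ_ g).hom := by simp
    _ = _ := by rw [hη, hβ]; simp

end Adjunctions

/-! ### Duals of the lax unitors. -/

section Star

variable {k : Type u₀} [Field k] {B : Type u} [Bicategory.{w, v} B]
  [∀ a b : B, Preadditive (a ⟶ b)] [∀ a b : B, Linear k (a ⟶ b)] {S : Star k B}

/-- The whiskered identity at the end stands for the `eqToHom` in `IsFiax.star_l`, since I⋆ = I'
holds by definition in C_J. -/
theorem Star.map_whiskerLeft_comp_rightUnitor {a b : B} (F : a ⟶ b) {D : b ⟶ b} (d : D ⟶ 𝟙 b) :
    S.map (F ◁ d ≫ (ρ_ F).hom) ≫ (S.mapComp F D).hom ≫ 𝟙 (S.obj D) ▷ S.obj F =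
      (λ_ (S.obj F)).inv ≫ S.dual d ▷ S.obj F := by
  rw [S.map_comp, ← S.map_rightUnitor]
  have := S.mapComp_whiskerLeft F d
  simp [Star.dual, this, ← comp_whiskerRight]

theorem Star.map_whiskerRight_comp_leftUnitor {a b : B} {D : a ⟶ a} (d : D ⟶ 𝟙 a) (F : a ⟶ b) :
    S.map (d ▷ F ≫ (λ_ F).hom) ≫ (S.mapComp D F).hom ≫ S.obj F ◁ 𝟙 (S.obj D) =
      (ρ_ (S.obj F)).inv ≫ S.obj F ◁ S.dual d := by
  rw [S.map_comp, ← S.map_leftUnitor]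
  have := S.mapComp_whiskerRight d F
  simp [Star.dual, this, ← whiskerLeft_comp]

end Star

/-! ### Adjunction data and the fiax structure on C_J. -/

section CJ

variable {k : Type u₀} [Field k] {B : Type u} [Bicategory.{w, v} B] [Bicategory.Strict B]
  [∀ a b : B, Preadditive (a ⟶ b)] [∀ a b : B, Linear k (a ⟶ b)] [LinearTwoCategory k B]
  {J : TwoSidedCell B} {S : Star k B}

theorem whiskerLeft_sum (k : Type u₀) [Field k] {B : Type u} [Bicategory.{w, v} B]
    [∀ a b : B, Preadditive (a ⟶ b)] [∀ a b : B, Linear k (a ⟶ b)] [LinearTwoCategory k B]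
    {a b c : B} (H : a ⟶ b) {F G : b ⟶ c} {n : ℕ} (γ : Fin n → (F ⟶ G)) :
    H ◁ (∑ t, γ t) = ∑ t, H ◁ γ t :=
  map_sum (AddMonoidHom.mk' (fun γ : F ⟶ G => H ◁ γ)
    (fun γ δ => LinearTwoCategory.whiskerLeft_add k H γ δ)) γ _

namespace CJ

variable {h : IsCellClosed J S}

/-- The unit and the counit of `(F, F⋆)` factor through the Duflo 1-morphisms, up to a
representative of the identity of `F` in `C_J`. -/
theorem exists_factorizations (hS : IsFiat S) {D : ∀ i : LeftCell J, i.src ⟶ i.src}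
    {d : ∀ i, D i ⟶ 𝟙 i.src} (hd : ∀ i, IsDuflo k i (D i) (d i)) {j i : (CJ h).Obj}
    (F : (CJ h).Hom j i) :
    ∃ (e : rep F ⟶ rep F) (η : S.obj (D j) ⟶ rep F ≫ S.obj (rep F))
      (β : S.obj (rep F) ≫ rep F ⟶ D i), (mk e : F ⟶ F) = 𝟙 F ∧
      S.dual (d j) ≫ η = (hS.adj (rep F)).unit ≫ e ▷ S.obj (rep F) ∧
      β ≫ d i = S.obj (rep F) ◁ e ≫ (hS.adj (rep F)).counit := by
  obtain ⟨n, f, s, r, hf, hs⟩ := inAdd_cellMem F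
  choose s hs' using fun t => mk_surjective (s t)
  choose r hr' using fun t => mk_surjective (r t)
  choose η hη using fun t => hS.exists_dual_comp_eq_unit (hd j) (hf t).1
  choose β hβ using fun t => hS.exists_comp_eq_counit (hd i) (hf t).2
  -- The factored units and counits of the cell elements `f t` are carried to F along `s t`, `r t`
  -- and their duals. The sum of the `s t ≫ r t` is 𝟙 F only in C_J, which is where `e` comes from.
  refine ⟨∑ t, s t ≫ r t, ∑ t, η t ≫ rep (f t) ◁ S.map (s t) ≫ r t ▷ S.obj (rep F),
    ∑ t, S.obj (rep F) ◁ s t ≫ S.map (r t) ▷ rep (f t) ≫ β t, ?_, ?_, ?_⟩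
  · rw [mk_sum, ← hs]
    exact Finset.sum_congr rfl fun t _ => by rw [hs', hr']; rfl
  · rw [Preadditive.comp_sum, whiskerRight_sum k, Preadditive.comp_sum]
    refine Finset.sum_congr rfl fun t _ => ?_
    have := unit_whiskerLeft_conjugateEquiv (hS.adj (rep (f t))) (hS.adj (rep F)) (s t)
    rw [← hS.map_eq] at this
    rw [← Category.assoc, hη, ← Category.assoc, this, comp_whiskerRight, Category.assoc]
  · rw [Preadditive.sum_comp, whiskerLeft_sum k, Preadditive.sum_comp]
    refine Finset.sum_congr rfl fun t _ => ?_
    have := conjugateEquiv_whiskerRight_counit (hS.adj (rep F)) (hS.adj (rep (f t))) (r t)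
    rw [← hS.map_eq] at this
    rw [Category.assoc, Category.assoc, hβ, this, whiskerLeft_comp, Category.assoc]

theorem isFiax (hS : IsFiat S) {D : ∀ i : LeftCell J, i.src ⟶ i.src}
    {d : ∀ i, D i ⟶ 𝟙 i.src} (hd : ∀ i, IsDuflo k i (D i) (d i))
    (hD : ∀ i, cellMem S i i (D i)) : (CJ.units h D d hD).IsFiax (CJ.star h) where
  finitary := isFinitaryBilaxUnital hS D d hD
  equivalence := star_isEquivalence hS
  star_I _ := rfl
  star_l {j i} F := congrArg (mk (F := (CJ.star h).obj F)
      (G := (CJ h).comp ((CJ.units h D d hD).I' i) ((CJ.star h).obj F)))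
    (Star.map_whiskerLeft_comp_rightUnitor (rep F) (d i))
  star_r {i j} G := congrArg (mk (F := (CJ.star h).obj G)
      (G := (CJ h).comp ((CJ.star h).obj G) ((CJ.units h D d hD).I' i)))
    (Star.map_whiskerRight_comp_leftUnitor (d i) (rep G))
  adjunctions := by
    choose e η β he hη hβ using fun (j i : (CJ h).Obj) (F : (CJ h).Hom j i) =>
      exists_factorizations hS hd F
    -- As `e` represents the identity, inserting it on both sides of `γ` does not change the class
    -- of the conjugate.
    have mate : ∀ {j i : (CJ h).Obj} {F G : (CJ h).Hom j i} (γ : rep F ⟶ rep G),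
        mk (F := (CJ.star h).obj G) (G := (CJ.star h).obj F)
          (conjugateEquiv (hS.adj (rep G)) (hS.adj (rep F)) (e j i F ≫ γ ≫ e j i G)) =
        (CJ.star h).map (mk γ) := by
      intro j i F G γ
      have h1 : (mk γ : F ⟶ G) = mk (e j i F ≫ γ ≫ e j i G) := by
        rw [mk_comp, mk_comp, he, he, Category.id_comp, Category.comp_id]
      rw [h1, star_map_mk]
      exact congrArg (mk (F := (CJ.star h).obj G) (G := (CJ.star h).obj F)) (hS.map_eq _).symm
    refine ⟨fun {j i} F => mk (F := (CJ.units h D d hD).I' j) (G := (CJ h).comp F ((CJ.star h).obj F))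
        (η j i F), fun {j i} F => mk (F := (CJ h).comp ((CJ.star h).obj F) F)
        (G := (CJ.units h D d hD).I i) (β j i F), ?_, ?_, ?_⟩
    · intro j i F
      rw [associator_hom]
      refine (congrArg (mk (F := F) (G := F))
        (zigzag_eq_comp_of_factorization (hS.adj (rep F)) (hη j i F) (hβ j i F))).trans ?_
      rw [mk_comp, he, Category.comp_id]
    · intro j i F
      rw [associator_inv]
      -- The second triangle identity is the mate formula for γ = 𝟙.
      have := mate_eq_conjugateEquiv_of_factorization (hS.adj (rep F)) (hS.adj (rep F))
        (hη j i F) (hβ j i F) (𝟙 _)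
      rw [id_whiskerRight, whiskerLeft_id, Category.id_comp] at this
      refine (congrArg (mk (F := (CJ.star h).obj F) (G := (CJ.star h).obj F)) this).trans
        ((mate (F := F) (G := F) (𝟙 _)).trans ?_)
      exact (star_isEquivalence hS).map_id F
    · intro j i F G γ
      obtain ⟨γ, rfl⟩ := mk_surjective γ
      rw [associator_inv]
      exact (mate γ).symm.trans (congrArg (mk (F := (CJ.star h).obj G) (G := (CJ.star h).obj F))
        (mate_eq_conjugateEquiv_of_factorization (hS.adj (rep F)) (hS.adj (rep G))
        (hη j i F) (hβ j i G) γ).symm)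
  involutive := star_isInvolutive hS

end CJ

end CJ

end Fiax

theorem mainTheorem11 {k : Type*} [Field k] [IsAlgClosed k] {B : Type*} [Bicategory B]
    [Bicategory.Strict B] [∀ a b : B, Preadditive (a ⟶ b)] [∀ a b : B, Linear k (a ⟶ b)]
    [Fiax.LinearTwoCategory k B] (S : Fiax.Star k B) (hS : Fiax.IsFiat S)
    (J : Fiax.TwoSidedCell B) :
    IsGreatest {K : Fiax.TwoIdeal k J | K.Avoids} (Fiax.maxIdeal k J) ∧
    (∀ i : Fiax.LeftCell J, ∃ (D : i.src ⟶ i.src) (d : D ⟶ 𝟙 i.src), Fiax.IsDuflo k i D d ∧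
      ∀ (D' : i.src ⟶ i.src) (d' : D' ⟶ 𝟙 i.src), Fiax.IsDuflo k i D' d' →
        Nonempty (D' ≅ D)) ∧
    ∃ h : Fiax.IsCellClosed J S,
      ∀ (D : ∀ i : Fiax.LeftCell J, i.src ⟶ i.src) (d : ∀ i, D i ⟶ 𝟙 i.src),
        (∀ i, Fiax.IsDuflo k i (D i) (d i)) →
        ∃ hD : ∀ i, Fiax.cellMem S i i (D i),
          (Fiax.CJ.units h D d hD).IsFiax (Fiax.CJ.star h) := by
  refine ⟨⟨Fiax.maxIdeal_avoids hS.finitary, fun K hK => Fiax.le_maxIdeal hK⟩, fun i => ?_,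
    hS.isCellClosed, fun D d hd => ⟨fun i => hS.cellMem_of_isDuflo (hd i), Fiax.CJ.isFiax hS hd _⟩⟩
  obtain ⟨b, F, hF⟩ := i.exists_mem
  have hFi := Fiax.LeftCell.indec hF
  obtain ⟨D, d, h⟩ := hS.exists_isEvCover hFi
  exact ⟨D, d, (hS.isDuflo_iff hF).2 h, fun D' d' h' =>
    ((hS.isDuflo_iff hF).1 h').nonempty_iso hFi h⟩
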